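/- Let $\nu_\pm>0$ and $\alpha_\pm\ge 0$, and put $\mu_\pm=\nu_\pm\sqrt2/\alpha_\pm$ (with $\mu_\pm=\infty$ if $\alpha_\pm=0$). Let $\chi_n$, $n\ge 0$, be the normalized Hermite functions on $\mathbb R$. For $U=U(x,q_+,q_-)\in L^2(\mathbb R^3)$ write $U\sim\{u_{m,n}\}$, where $u_{m,n}(x)=\iint U(x,q_+,q_-)\chi_m(q_+)\chi_n(q_-)\,dq_+dq_-$, $m,n\ge 0$, so that $U=\sum_{m,n} u_{m,n}(x)\chi_m(q_+)\chi_n(q_-)$; a function in $H^1(\mathbb R)$ is identified with its continuous representative. Put $$r_{m,n}=\nu_+^2(m+\tfrac12)+\nu_-^2(n+\tfrac12),\qquad (L_{m,n}u)(x)=-u''(x)+r_{m,n}u(x)\quad(x\ne\pm1),$$ $[u'](a)=u'(a+0)-u'(a-0)$, and $u_{-1,n}=u_{m,-1}=0$. Let $\mathcal D_{\alpha,\nu}$ be the set of $U\sim\{u_{m,n}\}$ in $L^2(\mathbb R^3)$ such that: every $u_{m,n}$ is in $H^1(\mathbb R)$, with restrictions to $(-\infty,-1)$, $(-1,1)$,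 $(1,\infty)$ in $H^2$; $\sum_{m,n}\int_{\mathbb R}|L_{m,n}u_{m,n}|^2dx<\infty$; and for all $m,n\ge0$ $$[u_{m,n}'](1)=\tfrac{\alpha_+}{\sqrt2}\bigl(\sqrt{m+1}\,u_{m+1,n}(1)+\sqrt m\,u_{m-1,n}(1)\bigr),\qquad [u_{m,n}'](-1)=\tfrac{\alpha_-}{\sqrt2}\bigl(\sqrt{n+1}\,u_{m,n+1}(-1)+\sqrt n\,u_{m,n-1}(-1)\bigr).$$ The operator $A_{\alpha,\nu}$ in $L^2(\mathbb R^3)$ has domain $\mathcal D_{\alpha,\nu}$ and acts by $A_{\alpha,\nu}U\sim\{L_{m,n}u_{m,n}\}$. Let $a_{\alpha,\nu}=a+\alpha_+b_++\alpha_-b_-$, where $$a[U]=\sum_{m,n}\int_{\mathbb R}\bigl(|u_{m,n}'|^2+r_{m,n}|u_{m,n}|^2\bigr)dx,$$ $$b_+[U]=\mathrm{Re}\sum_{m,n}\sqrt{2m}\,u_{m,n}(1)\overline{u_{m-1,n}(1)},\qquad b_-[U]=\mathrm{Re}\sum_{m,n}\sqrt{2n}\,u_{m,n}(-1)\overline{u_{m,n-1}(-1)}.$$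 Let the energy space $d$, which does not depend on $\alpha_\pm$, be the set of $U\sim\{u_{m,n}\}$ in $L^2(\mathbb R^3)$ with all $u_{m,n}\in H^1(\mathbb R)$ and $a[U]<\infty$. It contains $\mathcal D_{0,\nu}$ as a dense subset for the norm $a[U]^{1/2}$ (so that it is the completion of $\mathcal D_{0,\nu}$ in this norm, being complete), and the series in $b_\pm$ converge absolutely on $d$. **Theorem.** 1. If $\mu_+\ge1$ and $\mu_-\ge1$, the quadratic form $a_{\alpha,\nu}$ is bounded below: there are $c,c'\in\mathbb R$ with $a_{\alpha,\nu}[U]\ge c\|U\|^2$ for all $U\in d$, and $\mathrm{Re}\,(A_{\alpha,\nu}U,U)\ge c'\|U\|^2$ for all $U\in\mathcal D_{\alpha,\nu}$. 2. If $\mu_+>1$ and $\mu_->1$, the form $a_{\alpha,\nu}$ with domain $d$ is closed, and the operator it defines in $L^2(\mathbb R^3)$ (that is, the operator taking $U$ to $F$ exactly when $U\in d$ and $a_{\alpha,\nu}(U,V)=(F,V)$ for all $V\in d$, where $a_{\alpha,\nu}(\cdot,\cdot)$ is the sesquilinear form obtained by polarization) is self-adjoint and coincides with $A_{\alpha,\nu}$.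 -/

import Mathlib

open MeasureTheory Filter Topology Set

noncomputable section

namespace Smilansky

/-! ### The Hilbert space and the expansion in Hermite functions -/

/-- The Hilbert space `L²(ℝ³)` of functions `U(x, q₊, q₋)`. -/
abbrev GH : Type := Lp ℂ 2 (volume : Measure (ℝ × ℝ × ℝ))

/-- The normalized Hermite functions `χ_n(q) = (n! √π)^{-1/2} He_n(√2 q) e^{-q²/2}`, where
`He_n` is the probabilists' Hermite polynomial. (In terms of the physicists' polynomial `H_n`,
`He_n(√2 q) = 2^{-n/2} H_n(q)`.) They satisfy
`√(k+1) χ_{k+1} - √2 q χ_k + √k χ_{k-1} = 0`. -/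
def hermiteFun (n : ℕ) (q : ℝ) : ℝ :=
  Polynomial.aeval (√2 * q) (Polynomial.hermite n) * Real.exp (-q ^ 2 / 2)
    / √((n.factorial : ℝ) * √Real.pi)

/-- The Hermite coefficient `x ↦ ∫∫ U(x, q₊, q₋) χ_m(q₊) χ_n(q₋) dq₊ dq₋`. As a function of `x`
it is determined by `U` up to a null set. -/
def hermiteCoeff (U : GH) (m n : ℕ) (x : ℝ) : ℂ :=
  ∫ q : ℝ × ℝ, U (x, q) * ((hermiteFun m q.1 * hermiteFun n q.2 : ℝ) : ℂ)

/-! ### Sobolev spaces on the line -/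

/-- `u` is (the continuous representative of) an element of the Sobolev space `H¹(I)` of an
interval `I`: it is the indefinite integral of its almost everywhere derivative, and `u` and `u'`
are square integrable on `I`. -/
def MemH1On (I : Set ℝ) (u : ℝ → ℂ) : Prop :=
  MemLp u 2 (volume.restrict I) ∧ MemLp (deriv u) 2 (volume.restrict I) ∧
    ∀ x ∈ I, ∀ y ∈ I, u y - u x = ∫ t in x..y, deriv u t

/-- `u` belongs to `H¹(ℝ)`. -/
def MemH1 (u : ℝ → ℂ) : Prop := MemH1On univ u

/-- `u` belongs to the Sobolev space `H²(I)` of an open interval `I`. -/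
def MemH2On (I : Set ℝ) (u : ℝ → ℂ) : Prop := MemH1On I u ∧ MemH1On I (deriv u)

open Classical in
/-- The component `u_{m,n}` in `U ∼ {u_{m,n}}`: the Hermite coefficient, modified on a null set
so as to be the continuous representative whenever it belongs to `H¹(ℝ)`. -/
def comp (U : GH) (m n : ℕ) : ℝ → ℂ :=
  if h : ∃ u : ℝ → ℂ, MemH1 u ∧ u =ᵐ[volume] hermiteCoeff U m n then h.choose
  else hermiteCoeff U m n

/-- The jump `[u'](a) = u'(a+0) - u'(a-0)` exists and equals `j`. -/
def HasDerivJump (u : ℝ → ℂ) (a : ℝ) (j : ℂ) : Prop :=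
  ∃ l r : ℂ, Tendsto (deriv u) (𝓝[<] a) (𝓝 l) ∧ Tendsto (deriv u) (𝓝[>] a) (𝓝 r) ∧ j = r - l

/-! ### The operator -/

/-- `r_{m,n} = ν₊² (m + 1/2) + ν₋² (n + 1/2)`. -/
def rCoef (νp νm : ℝ) (m n : ℕ) : ℝ :=
  νp ^ 2 * ((m : ℝ) + 1 / 2) + νm ^ 2 * ((n : ℝ) + 1 / 2)

/-- `(L_{m,n} u)(x) = -u''(x) + r_{m,n} u(x)`, for (almost every) `x ≠ ±1`. -/
def Lop (νp νm : ℝ) (m n : ℕ) (u : ℝ → ℂ) (x : ℝ) : ℂ :=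
  -deriv (deriv u) x + (rCoef νp νm m n : ℂ) * u x

/-- The domain of the operator `A_{α,ν}`. For `m = 0` the term `√m u_{m-1,n}(1)` vanishes because
of its factor `√0`, in accordance with the convention `u_{-1,n} = 0`; similarly for `n = 0`. -/
def opDomain (νp νm αp αm : ℝ) : Set GH :=
  {U | (∀ m n, MemH1 (comp U m n)) ∧
    (∀ m n, MemH2On (Iio (-1)) (comp U m n) ∧ MemH2On (Ioo (-1) 1) (comp U m n) ∧
      MemH2On (Ioi 1) (comp U m n)) ∧
    (Summable fun p : ℕ × ℕ => ∫ x, ‖Lop νp νm p.1 p.2 (comp U p.1 p.2) x‖ ^ 2) ∧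
    (∀ m n, HasDerivJump (comp U m n) 1
      (((αp / √2 : ℝ) : ℂ) * (((√((m : ℝ) + 1) : ℝ) : ℂ) * comp U (m + 1) n 1
        + ((√(m : ℝ) : ℝ) : ℂ) * comp U (m - 1) n 1))) ∧
    (∀ m n, HasDerivJump (comp U m n) (-1)
      (((αm / √2 : ℝ) : ℂ) * (((√((n : ℝ) + 1) : ℝ) : ℂ) * comp U m (n + 1) (-1)
        + ((√(n : ℝ) : ℝ) : ℂ) * comp U m (n - 1) (-1))))}

/-- `F ∼ {L_{m,n} u_{m,n}}`, where `U ∼ {u_{m,n}}`. -/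
def OpAction (νp νm : ℝ) (U F : GH) : Prop :=
  ∀ m n, hermiteCoeff F m n =ᵐ[volume] Lop νp νm m n (comp U m n)

/-- `T` is the operator `A_{α,ν}`: its domain is `opDomain`, and `T U ∼ {L_{m,n} u_{m,n}}` there. -/
def IsSmilanskyOp (νp νm αp αm : ℝ) (T : GH →ₗ.[ℂ] GH) : Prop :=
  (T.domain : Set GH) = opDomain νp νm αp αm ∧ ∀ U : T.domain, OpAction νp νm U (T U)

/-! ### The quadratic forms -/

/-- `∫ (|u_{m,n}'|² + r_{m,n} |u_{m,n}|²) dx`. -/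
def aTerm (νp νm : ℝ) (U : GH) (p : ℕ × ℕ) : ℝ :=
  ∫ x, (‖deriv (comp U p.1 p.2) x‖ ^ 2 + rCoef νp νm p.1 p.2 * ‖comp U p.1 p.2 x‖ ^ 2)

/-- `√(2m) u_{m,n}(1) conj(u_{m-1,n}(1))`, which is `0` for `m = 0`. -/
def bPlusTerm (U : GH) (p : ℕ × ℕ) : ℂ :=
  ((√(2 * (p.1 : ℝ)) : ℝ) : ℂ) * comp U p.1 p.2 1 * star (comp U (p.1 - 1) p.2 1)

/-- `√(2n) u_{m,n}(-1) conj(u_{m,n-1}(-1))`, which is `0` for `n = 0`. -/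
def bMinusTerm (U : GH) (p : ℕ × ℕ) : ℂ :=
  ((√(2 * (p.2 : ℝ)) : ℝ) : ℂ) * comp U p.1 p.2 (-1) * star (comp U p.1 (p.2 - 1) (-1))

/-- The form `a[U]`. -/
def formA (νp νm : ℝ) (U : GH) : ℝ := ∑' p, aTerm νp νm U p

/-- The form `b₊[U]`. -/
def formBPlus (U : GH) : ℝ := (∑' p, bPlusTerm U p).re

/-- The form `b₋[U]`. -/
def formBMinus (U : GH) : ℝ := (∑' p, bMinusTerm U p).re

/-- The form `a_{α,ν} = a + α₊ b₊ + α₋ b₋`. -/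
def form (νp νm αp αm : ℝ) (U : GH) : ℝ :=
  formA νp νm U + αp * formBPlus U + αm * formBMinus U

/-- The energy space `d`, as a subset of `L²(ℝ³)`: the orthogonal sum of the spaces `H¹(ℝ)` with
the norms `(∫ (|u'|² + r_{m,n} |u|²))^{1/2}`. -/
def energySpace (νp νm : ℝ) : Set GH :=
  {U | (∀ m n, MemH1 (comp U m n)) ∧ Summable (aTerm νp νm U)}

/-! ### Quadratic forms and self-adjoint operators in general -/

section General

variable {H : Type*} [NormedAddCommGroup H] [InnerProductSpace ℂ H]

/-- The quadratic form `q` with domain `d` is bounded below. -/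
def FormBoundedBelow (d : Set H) (q : H → ℝ) : Prop :=
  ∃ c : ℝ, ∀ U ∈ d, c * ‖U‖ ^ 2 ≤ q U

/-- The (semibounded) quadratic form `q` with domain `d` is closed: if `V_j ∈ d` converge to `U`
in `H` and `q[V_j - V_l] → 0` as `j, l → ∞`, then `U ∈ d` and `q[V_j - U] → 0`. -/
def FormClosed (d : Set H) (q : H → ℝ) : Prop :=
  ∀ (V : ℕ → H) (U : H), (∀ j, V j ∈ d) → Tendsto V atTop (𝓝 U) →
    Tendsto (fun p : ℕ × ℕ => q (V p.1 - V p.2)) atTop (𝓝 0) →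
    U ∈ d ∧ Tendsto (fun j => q (V j - U)) atTop (𝓝 0)

/-- The sesquilinear form `q(U, V)`, linear in `U` and antilinear in `V`, obtained from the
quadratic form `q` by polarization. -/
def polarForm (q : H → ℝ) (U V : H) : ℂ :=
  (((q (U + V) : ℝ) : ℂ) - ((q (U - V) : ℝ) : ℂ)
    + Complex.I * ((q (U + Complex.I • V) : ℝ) : ℂ)
    - Complex.I * ((q (U - Complex.I • V) : ℝ) : ℂ)) / 4

/-- `T` is the operator defined by the quadratic form `q` with domain `d`: `U ∈ Dom T` and
`T U = F` if and only if `U ∈ d` and `q(U, V) = (F, V)` for all `V ∈ d`. (Mathlib's `inner` is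
antilinear in its first argument.) -/
def IsFormOperator (d : Set H) (q : H → ℝ) (T : H →ₗ.[ℂ] H) : Prop :=
  ∀ U F : H, (U, F) ∈ T.graph ↔ U ∈ d ∧ ∀ V ∈ d, polarForm q U V = inner ℂ V F

end General

/-- `μ = ν √2 / α`, with the value `∞` for `α = 0`. -/
def mu (ν α : ℝ) : ENNReal := ENNReal.ofReal (ν * √2) / ENNReal.ofReal α

end Smilansky

end

/-! ### Indefinite integrals on intervals -/

namespace Smilansky

/-! The form. For `r ≥ 0` and `u ∈ H¹(ℝ)`, `2√r (|u(1)|² + |u(-1)|²) ≤ ∫ (|u'|² + r|u|²) + ∫ |u|²`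
(`MemH1.trace`): each of the two points receives `√r` from either side, and the interaction between
the points costs only one extra copy of the `L²` norm. In `b₊` the products of neighbouring traces
carry the weights `√(2m)`. By `2xy ≤ x² + y²` they reduce to diagonal terms with weight proportional
to `√m + √(m+1) ≤ 2√(m+1/2) ≤ (2/ν₊)√r_{m,n}`, and likewise for `b₋` (`summable_neighbour`).
Together this gives `|a_{α,ν}[U] - a[U]| ≤ θ (a[U] + ‖U‖²)` for any `θ` that is at least `1/μ₊` and
`1/μ₋` (`abs_form_sub_formA_le`). For `θ ≤ 1` the form is bounded below by `-‖U‖²`. For `θ < 1` it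
is comparable with `a` up to multiples of `‖U‖²`, hence closed since `a` is, and the Riesz theorem
yields its self-adjoint operator `T`, with `T + 2` surjective (`exists_formOperator`).

`T ⊆ A`. Testing the form with `v(x) χ_m(q₊) χ_n(q₋)` gives a weak equation for each component, with
point masses at `±1`. Regularity of weak solutions (`IsWeakSolution.regular`) turns it into the
differential equation and the jump conditions.

`A ⊆ T`. A vector of the domain of `A` is not known in advance to have finite energy, so the form
bound does not apply to it. Instead `Re (AU, U) ≥ -‖U‖²` is proved directly on the domain of `A`
(`neg_norm_sq_le_re_inner`). In the partial sum over the square `m, n < N`, Green's formula and the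
estimates above leave only the coupling across the edge, of size `√N` times the squared traces with
`m = N` or `n = N`. A trace is bounded by the graph norm of its component with a factor of order
`√(1+r)` (`norm_sq_le_of_memH2On`), so the leak is at most a constant times `N G_N`, where `G_N` is
summable. As the harmonic series diverges, `N G_N` is arbitrarily small for arbitrarily large `N`.
Now let `U` be in the domain of `A` and solve `(T + 2)W = (A + 2)U`. Then `A(U - W) = -2(U - W)`,
and the lower bound forces `U = W`.

Components are handled through the unitary Hermite expansion of `L²(ℝ³)` as a Hilbert sum of copies
of `L²(ℝ)`. The completeness of the Hermite functions behind it comes from injectivity of the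
Fourier transform. -/

/-- `f` is an indefinite integral of the locally integrable function `f'` on `I`. -/
def IsPrimitiveOn (I : Set ℝ) (f f' : ℝ → ℂ) : Prop :=
  ∀ x ∈ I, ∀ y ∈ I, IntervalIntegrable f' volume x y ∧ f y - f x = ∫ t in x..y, f' t

namespace IsPrimitiveOn

variable {I : Set ℝ} {f f' g g' : ℝ → ℂ}

lemma mono {J : Set ℝ} (h : IsPrimitiveOn I f f') (hJ : J ⊆ I) : IsPrimitiveOn J f f' :=
  fun x hx y hy => h x (hJ hx) y (hJ hy)

lemma add (hf : IsPrimitiveOn I f f') (hg : IsPrimitiveOn I g g') :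
    IsPrimitiveOn I (fun x => f x + g x) (fun x => f' x + g' x) := by
  intro x hx y hy
  obtain ⟨h1, h2⟩ := hf x hx y hy
  obtain ⟨h3, h4⟩ := hg x hx y hy
  refine ⟨h1.add h3, ?_⟩
  rw [intervalIntegral.integral_add h1 h3, ← h2, ← h4]
  ring

lemma const_mul (c : ℂ) (hf : IsPrimitiveOn I f f') :
    IsPrimitiveOn I (fun x => c * f x) (fun x => c * f' x) := by
  intro x hx y hy
  obtain ⟨h1, h2⟩ := hf x hx y hy
  refine ⟨h1.const_mul c, ?_⟩
  rw [intervalIntegral.integral_const_mul, ← h2]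
  ring

lemma star (hf : IsPrimitiveOn I f f') :
    IsPrimitiveOn I (fun x => star (f x)) (fun x => star (f' x)) := by
  intro x hx y hy
  obtain ⟨h1, h2⟩ := hf x hx y hy
  let L : ℂ →L[ℝ] ℂ := Complex.conjCLE.toContinuousLinearMap
  refine ⟨⟨L.integrable_comp h1.1, L.integrable_comp h1.2⟩, ?_⟩
  have h3 := L.intervalIntegral_comp_comm h1
  rw [← h2, map_sub] at h3
  exact h3.symm

/-- An indefinite integral is absolutely continuous. -/
lemma absolutelyContinuousOnInterval (hf : IsPrimitiveOn I f f') [OrdConnected I]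
    {a b : ℝ} (ha : a ∈ I) (hb : b ∈ I) : AbsolutelyContinuousOnInterval f a b := by
  have hsub : uIcc a b ⊆ I := OrdConnected.uIcc_subset ‹_› ha hb
  -- The increments of `f` are dominated by those of the primitive of `‖f'‖`, from which absolute
  -- continuity is inherited.
  have hG := (hf a ha b hb).1.norm.absolutelyContinuousOnInterval_intervalIntegral
    (left_mem_uIcc : a ∈ uIcc a b)
  rw [absolutelyContinuousOnInterval_iff] at hG ⊢
  intro ε hε
  obtain ⟨δ, hδ, h⟩ := hG ε hε
  refine ⟨δ, hδ, fun E hE hs => lt_of_le_of_lt (Finset.sum_le_sum fun i hi => ?_) (h E hE hs)⟩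
  have h1 := hE.1 i hi
  have hx : (E.2 i).1 ∈ uIcc a b := h1.1
  have hy : (E.2 i).2 ∈ uIcc a b := h1.2
  rw [dist_comm, dist_comm (∫ v in a..(E.2 i).1, _), dist_eq_norm, dist_eq_norm,
    (hf _ (hsub hx) _ (hsub hy)).2, intervalIntegral.integral_interval_sub_left
      (hf _ ha _ (hsub hy)).1.norm (hf _ ha _ (hsub hx)).1.norm]
  rw [Real.norm_eq_abs]
  exact intervalIntegral.norm_integral_le_abs_integral_norm

lemma ae_hasDerivAt_Ioo (hf : IsPrimitiveOn I f f') [OrdConnected I]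
    {a b : ℝ} (ha : a ∈ I) (hb : b ∈ I) : ∀ᵐ x, x ∈ Ioo a b → HasDerivAt f (f' x) x := by
  have h := (hf a ha b hb).1.ae_hasDerivAt_integral
  filter_upwards [h] with x hx hxab
  have hle : a ≤ b := (hxab.1.trans hxab.2).le
  have h1 := hx (by rw [uIcc_of_le hle]; exact Ioo_subset_Icc_self hxab) a left_mem_uIcc
  have h2 := h1.const_add (f a)
  refine h2.congr_of_eventuallyEq ?_
  filter_upwards [Ioo_mem_nhds hxab.1 hxab.2] with y hy
  have hyI : y ∈ I := OrdConnected.out ‹_› ha hb (Ioo_subset_Icc_self hy)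
  rw [← (hf a ha y hyI).2]
  ring

/-- An indefinite integral is differentiable almost everywhere. -/
lemma ae_hasDerivAt (hf : IsPrimitiveOn I f f') [OrdConnected I] (hI : IsOpen I) :
    ∀ᵐ x, x ∈ I → HasDerivAt f (f' x) x := by
  -- Countably many intervals with rational ends in `I` cover `I`, so their exceptional null sets
  -- may be united.
  have h : ∀ p : ℚ × ℚ, ∀ᵐ x, (p.1 : ℝ) ∈ I → (p.2 : ℝ) ∈ I → x ∈ Ioo (p.1 : ℝ) p.2 →
      HasDerivAt f (f' x) x := by
    intro p
    by_cases h1 : (p.1 : ℝ) ∈ I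
    · by_cases h2 : (p.2 : ℝ) ∈ I
      · filter_upwards [hf.ae_hasDerivAt_Ioo h1 h2] with x hx _ _ using hx
      · exact ae_of_all _ fun x _ h => absurd h h2
    · exact ae_of_all _ fun x h => absurd h h1
  filter_upwards [ae_all_iff.2 h] with x hx hxI
  obtain ⟨ε, hε, hball⟩ := Metric.isOpen_iff.1 hI x hxI
  obtain ⟨p, hp1, hp2⟩ := exists_rat_btwn (show x - ε < x by linarith)
  obtain ⟨q, hq1, hq2⟩ := exists_rat_btwn (show x < x + ε by linarith)
  rw [Real.ball_eq_Ioo] at hball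
  exact hx (p, q) (hball ⟨hp1, by linarith⟩) (hball ⟨by linarith, hq2⟩) ⟨hp2, hq1⟩

lemma continuousOn (hf : IsPrimitiveOn I f f') [OrdConnected I] (hI : IsOpen I) :
    ContinuousOn f I := by
  intro x hxI
  obtain ⟨ε, hε, hball⟩ := Metric.isOpen_iff.1 hI x hxI
  rw [Real.ball_eq_Ioo] at hball
  have ha : x - ε / 2 ∈ I := hball ⟨by linarith, by linarith⟩
  have hb : x + ε / 2 ∈ I := hball ⟨by linarith, by linarith⟩
  have h := (hf.absolutelyContinuousOnInterval ha hb).continuousOn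
  rw [uIcc_of_le (by linarith)] at h
  exact (h.continuousAt (Icc_mem_nhds (by linarith) (by linarith))).continuousWithinAt

/-- The product rule for indefinite integrals. -/
lemma mul (hf : IsPrimitiveOn I f f') (hg : IsPrimitiveOn I g g') [OrdConnected I] :
    IsPrimitiveOn I (fun x => f x * g x) (fun x => f' x * g x + f x * g' x) := by
  have key : ∀ x ∈ I, ∀ y ∈ I, IntervalIntegrable (fun x => f' x * g x + f x * g' x) volume x y := by
    intro x hx y hy
    exact ((hf x hx y hy).1.mul_continuousOn
      (hg.absolutelyContinuousOnInterval hx hy).continuousOn).add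
      ((hg x hx y hy).1.continuousOn_mul (hf.absolutelyContinuousOnInterval hx hy).continuousOn)
  intro a ha b hb
  refine ⟨key a ha b hb, ?_⟩
  have hsub : uIcc a b ⊆ I := OrdConnected.uIcc_subset ‹_› ha hb
  set P : ℝ → ℂ := fun x => ∫ t in a..x, (f' t * g t + f t * g' t) with hP
  have hPP : IsPrimitiveOn (uIcc a b) P (fun x => f' x * g x + f x * g' x) := by
    intro x hx y hy
    refine ⟨key x (hsub hx) y (hsub hy), ?_⟩
    exact intervalIntegral.integral_interval_sub_left (key _ ha _ (hsub hy)) (key _ ha _ (hsub hx))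
  -- The difference between `f g` and the candidate primitive `P` is absolutely continuous with
  -- derivative zero almost everywhere, hence constant.
  have hAC : AbsolutelyContinuousOnInterval (f • g - P) a b :=
    ((hf.absolutelyContinuousOnInterval ha hb).smul (hg.absolutelyContinuousOnInterval ha hb)).sub
      (hPP.absolutelyContinuousOnInterval left_mem_uIcc right_mem_uIcc)
  have hD : ∀ᵐ x, x ∈ uIcc a b → HasDerivAt (f • g - P) 0 x := by
    have hI' : ∀ {u u' : ℝ → ℂ}, IsPrimitiveOn (uIcc a b) u u' →
        ∀ᵐ x, x ∈ uIcc a b → HasDerivAt u (u' x) x := by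
      intro u u' hu
      have h0 := (hu.mono (J := Ioo (min a b) (max a b)) Ioo_subset_Icc_self).ae_hasDerivAt isOpen_Ioo
      have h1 : ∀ᵐ x : ℝ, x ≠ min a b := by simp [ae_iff, measure_singleton]
      have h2 : ∀ᵐ x : ℝ, x ≠ max a b := by simp [ae_iff, measure_singleton]
      filter_upwards [h0, h1, h2] with x hx hx1 hx2 hxab
      exact hx ⟨lt_of_le_of_ne hxab.1 (Ne.symm hx1), lt_of_le_of_ne hxab.2 hx2⟩
    filter_upwards [hI' (hf.mono hsub), hI' (hg.mono hsub), hI' hPP] with x h1 h2 h3 hx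
    have := ((h1 hx).mul (h2 hx)).sub (h3 hx)
    simpa using this
  obtain ⟨C, hC⟩ := hAC.const_of_ae_hasDerivAt_zero hD
  have h1 := hC a left_mem_uIcc
  have h2 := hC b right_mem_uIcc
  simp only [Pi.sub_apply, smul_eq_mul, Pi.mul_apply] at h1 h2
  have h3 : P a = 0 := by simp [hP]
  have h4 : P b = ∫ t in a..b, (f' t * g t + f t * g' t) := rfl
  rw [← h4]
  linear_combination h2 - h1 - h3

/-- A continuously differentiable function is an indefinite integral of its derivative. -/
lemma of_hasDerivAt [OrdConnected I] (h : ∀ x ∈ I, HasDerivAt f (f' x) x)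
    (hc : ContinuousOn f' I) : IsPrimitiveOn I f f' := by
  intro a ha b hb
  have hsub : uIcc a b ⊆ I := OrdConnected.uIcc_subset ‹_› ha hb
  have h1 : IntervalIntegrable f' volume a b := (hc.mono hsub).intervalIntegrable
  exact ⟨h1, (intervalIntegral.integral_eq_sub_of_hasDerivAt (fun x hx => h x (hsub hx)) h1).symm⟩

end IsPrimitiveOn

/-! ### The fundamental theorem of calculus with one-sided limits and on half-lines -/

section Improper

variable {φ φ' : ℝ → ℂ} {a b c : ℝ} {l r : ℂ}

/-- Nothing is assumed of `φ` at `a` itself; the one-sided limit `l` plays the role of the end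
value. This is needed for `φ = u' v̄`, which may jump at `±1`. -/
lemma integral_left_of_isPrimitiveOn (h : IsPrimitiveOn (Ioo a b) φ φ')
    (hl : Tendsto φ (𝓝[>] a) (𝓝 l)) (hi : IntegrableOn φ' (Ioo a b)) (hc : c ∈ Ioo a b) :
    ∫ x in a..c, φ' x = φ c - l := by
  have hii : IntegrableOn φ' (uIcc c a) := by
    rw [uIcc_of_ge hc.1.le, integrableOn_Icc_iff_integrableOn_Ioc]
    exact hi.mono_set fun x hx => ⟨hx.1, hx.2.trans_lt hc.2⟩
  have h1 : ContinuousWithinAt (fun x => ∫ t in c..x, φ' t) (uIcc c a) a :=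
    intervalIntegral.continuousOn_primitive_interval hii a right_mem_uIcc
  have h2 : Tendsto (fun x => ∫ t in c..x, φ' t) (𝓝[>] a) (𝓝 (∫ t in c..a, φ' t)) := by
    refine h1.tendsto.mono_left ?_
    rw [uIcc_of_ge hc.1.le, ← nhdsWithin_Ioo_eq_nhdsGT hc.1]
    exact nhdsWithin_mono _ Ioo_subset_Icc_self
  have h3 : Tendsto (fun x => ∫ t in c..x, φ' t) (𝓝[>] a) (𝓝 (l - φ c)) := by
    refine (hl.sub_const (φ c)).congr' ?_
    filter_upwards [Ioo_mem_nhdsGT (hc.1.trans hc.2)] with x hx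
    exact (h c hc x hx).2
  rw [intervalIntegral.integral_symm, tendsto_nhds_unique h2 h3]
  ring

lemma integral_right_of_isPrimitiveOn (h : IsPrimitiveOn (Ioo a b) φ φ')
    (hr : Tendsto φ (𝓝[<] b) (𝓝 r)) (hi : IntegrableOn φ' (Ioo a b)) (hc : c ∈ Ioo a b) :
    ∫ x in c..b, φ' x = r - φ c := by
  have hii : IntegrableOn φ' (uIcc c b) := by
    rw [uIcc_of_le hc.2.le, integrableOn_Icc_iff_integrableOn_Ioo]
    exact hi.mono_set fun x hx => ⟨hc.1.trans hx.1, hx.2⟩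
  have h1 : ContinuousWithinAt (fun x => ∫ t in c..x, φ' t) (uIcc c b) b :=
    intervalIntegral.continuousOn_primitive_interval hii b right_mem_uIcc
  have h2 : Tendsto (fun x => ∫ t in c..x, φ' t) (𝓝[<] b) (𝓝 (∫ t in c..b, φ' t)) := by
    refine h1.tendsto.mono_left ?_
    rw [uIcc_of_le hc.2.le, ← nhdsWithin_Ioo_eq_nhdsLT hc.2]
    exact nhdsWithin_mono _ Ioo_subset_Icc_self
  have h3 : Tendsto (fun x => ∫ t in c..x, φ' t) (𝓝[<] b) (𝓝 (r - φ c)) := by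
    refine (hr.sub_const (φ c)).congr' ?_
    filter_upwards [Ioo_mem_nhdsLT (hc.1.trans hc.2)] with x hx
    exact (h c hc x hx).2
  exact tendsto_nhds_unique h2 h3

lemma integral_Ioo_of_isPrimitiveOn (hab : a < b)
    (h : IsPrimitiveOn (Ioo a b) φ φ') (hl : Tendsto φ (𝓝[>] a) (𝓝 l))
    (hr : Tendsto φ (𝓝[<] b) (𝓝 r)) (hi : IntegrableOn φ' (Ioo a b)) :
    ∫ x in Ioo a b, φ' x = r - l := by
  have hc : (a + b) / 2 ∈ Ioo a b := ⟨by linarith, by linarith⟩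
  have h1 : IntervalIntegrable φ' volume a ((a + b) / 2) := by
    rw [intervalIntegrable_iff_integrableOn_Ioo_of_le hc.1.le]
    exact hi.mono_set (Ioo_subset_Ioo_right hc.2.le)
  have h2 : IntervalIntegrable φ' volume ((a + b) / 2) b := by
    rw [intervalIntegrable_iff_integrableOn_Ioo_of_le hc.2.le]
    exact hi.mono_set (Ioo_subset_Ioo_left hc.1.le)
  rw [← integral_Ioc_eq_integral_Ioo, ← intervalIntegral.integral_of_le hab.le,
    ← intervalIntegral.integral_add_adjacent_intervals h1 h2,
    integral_left_of_isPrimitiveOn h hl hi hc, integral_right_of_isPrimitiveOn h hr hi hc]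
  ring

/-- Integrability of `φ'` makes `φ` converge at infinity, and an integrable function can only have
the limit zero there, because neighbourhoods of infinity have infinite measure. -/
lemma tendsto_atTop_of_isPrimitiveOn (h : IsPrimitiveOn (Ioi a) φ φ')
    (hφ : IntegrableOn φ (Ioi a)) (hi : IntegrableOn φ' (Ioi a)) : Tendsto φ atTop (𝓝 0) := by
  have hc : a + 1 ∈ Ioi a := by simp
  have h1 : Tendsto (fun x => ∫ t in (a + 1)..x, φ' t) atTop (𝓝 (∫ t in Ioi (a + 1), φ' t)) :=
    intervalIntegral_tendsto_integral_Ioi _ (hi.mono_set (Ioi_subset_Ioi (by simp))) tendsto_id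
  have h2 : Tendsto φ atTop (𝓝 (φ (a + 1) + ∫ t in Ioi (a + 1), φ' t)) := by
    refine (h1.const_add (φ (a + 1))).congr' ?_
    filter_upwards [Ioi_mem_atTop a] with x hx
    rw [← (h _ hc x hx).2]
    ring
  have h3 : φ (a + 1) + ∫ t in Ioi (a + 1), φ' t = 0 := by
    refine IntegrableAtFilter.eq_zero_of_tendsto ⟨Ioi a, Ioi_mem_atTop _, hφ⟩ ?_ h2
    intro s hs
    obtain ⟨b, hb⟩ := mem_atTop_sets.1 hs
    rw [← top_le_iff, ← Real.volume_Ici (a := b)]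
    exact measure_mono hb
  rwa [h3] at h2

lemma tendsto_atBot_of_isPrimitiveOn (h : IsPrimitiveOn (Iio a) φ φ')
    (hφ : IntegrableOn φ (Iio a)) (hi : IntegrableOn φ' (Iio a)) : Tendsto φ atBot (𝓝 0) := by
  have hc : a - 1 ∈ Iio a := by simp
  have h1 : Tendsto (fun x => ∫ t in x..(a - 1), φ' t) atBot (𝓝 (∫ t in Iic (a - 1), φ' t)) :=
    intervalIntegral_tendsto_integral_Iic _ (hi.mono_set (Iic_subset_Iio.2 (by simp))) tendsto_id
  have h2 : Tendsto φ atBot (𝓝 (φ (a - 1) - ∫ t in Iic (a - 1), φ' t)) := by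
    refine (h1.const_sub (φ (a - 1))).congr' ?_
    filter_upwards [Iio_mem_atBot a] with x hx
    rw [← (h x hx _ hc).2]
    ring
  have h3 : φ (a - 1) - ∫ t in Iic (a - 1), φ' t = 0 := by
    refine IntegrableAtFilter.eq_zero_of_tendsto ⟨Iio a, Iio_mem_atBot _, hφ⟩ ?_ h2
    intro s hs
    obtain ⟨b, hb⟩ := mem_atBot_sets.1 hs
    rw [← top_le_iff, ← Real.volume_Iic (a := b)]
    exact measure_mono hb
  rwa [h3] at h2

lemma integral_Ioi_of_isPrimitiveOn
    (h : IsPrimitiveOn (Ioi a) φ φ') (hl : Tendsto φ (𝓝[>] a) (𝓝 l))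
    (hφ : IntegrableOn φ (Ioi a)) (hi : IntegrableOn φ' (Ioi a)) :
    ∫ x in Ioi a, φ' x = -l := by
  have h1 := intervalIntegral_tendsto_integral_Ioi a hi tendsto_id
  refine tendsto_nhds_unique h1 ?_
  have h2 : Tendsto (fun x => φ x - l) atTop (𝓝 (-l)) := by
    simpa using (tendsto_atTop_of_isPrimitiveOn h hφ hi).sub_const l
  refine h2.congr' ?_
  filter_upwards [Ioi_mem_atTop a] with x hx
  exact (integral_left_of_isPrimitiveOn (b := x + 1) (h.mono fun y hy => hy.1) hl
    (hi.mono_set fun y hy => hy.1) ⟨hx, by simp⟩).symm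

lemma integral_Iio_of_isPrimitiveOn
    (h : IsPrimitiveOn (Iio a) φ φ') (hl : Tendsto φ (𝓝[<] a) (𝓝 l))
    (hφ : IntegrableOn φ (Iio a)) (hi : IntegrableOn φ' (Iio a)) :
    ∫ x in Iio a, φ' x = l := by
  rw [← integral_Iic_eq_integral_Iio]
  have hi' : IntegrableOn φ' (Iic a) := by rwa [integrableOn_Iic_iff_integrableOn_Iio]
  have h1 := intervalIntegral_tendsto_integral_Iic a hi' tendsto_id
  refine tendsto_nhds_unique h1 ?_
  have h2 : Tendsto (fun x => l - φ x) atBot (𝓝 l) := by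
    simpa using (tendsto_atBot_of_isPrimitiveOn h hφ hi).const_sub l
  refine h2.congr' ?_
  filter_upwards [Iio_mem_atBot a] with x hx
  exact (integral_right_of_isPrimitiveOn (a := x - 1) (h.mono fun y hy => hy.2) hl
    (hi.mono_set fun y hy => hy.2) ⟨by simp, hx⟩).symm

end Improper

/-! ### Sobolev functions on intervals -/

section H1

variable {I : Set ℝ} {u v f f' : ℝ → ℂ}

/-- The integral in the definition of `MemH1On` would be the default value zero for a nonintegrable
derivative. Square integrability on bounded intervals excludes this. -/
lemma MemH1On.isPrimitiveOn [OrdConnected I] (hu : MemH1On I u) :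
    IsPrimitiveOn I u (deriv u) := by
  intro x hx y hy
  refine ⟨?_, hu.2.2 x hx y hy⟩
  have hsub : uIcc x y ⊆ I := OrdConnected.uIcc_subset ‹_› hx hy
  have h1 : MemLp (deriv u) 2 (volume.restrict (uIoc x y)) :=
    hu.2.1.mono_measure (Measure.restrict_mono (uIoc_subset_uIcc.trans hsub) le_rfl)
  have : IsFiniteMeasure (volume.restrict (uIoc x y)) := by rw [uIoc]; infer_instance
  have : IntegrableOn (deriv u) (uIoc x y) := h1.integrable (by norm_num)
  exact intervalIntegrable_iff.2 this

lemma IsPrimitiveOn.deriv_ae_eq [OrdConnected I] (hI : IsOpen I) (h : IsPrimitiveOn I f f') :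
    deriv f =ᵐ[volume.restrict I] f' := by
  rw [EventuallyEq, ae_restrict_iff' hI.measurableSet]
  exact (h.ae_hasDerivAt hI).mono fun x hx hxI => (hx hxI).deriv

/-- The usual way to recognise an `H¹` function: exhibit any square integrable density `f'`. It
agrees almost everywhere with the pointwise `deriv f` used in the definition. -/
lemma IsPrimitiveOn.memH1On [OrdConnected I] (hI : IsOpen I) (h : IsPrimitiveOn I f f')
    (hf : MemLp f 2 (volume.restrict I)) (hf' : MemLp f' 2 (volume.restrict I)) :
    MemH1On I f := by
  have hd := h.deriv_ae_eq hI
  refine ⟨hf, (memLp_congr_ae hd).2 hf', fun x hx y hy => ?_⟩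
  rw [(h x hx y hy).2]
  refine intervalIntegral.integral_congr_ae ?_
  have hsub : uIcc x y ⊆ I := OrdConnected.uIcc_subset ‹_› hx hy
  rw [EventuallyEq, ae_restrict_iff' hI.measurableSet] at hd
  filter_upwards [hd] with t ht htxy
  exact (ht (hsub (uIoc_subset_uIcc htxy))).symm

lemma MemH1On.mono {J : Set ℝ} (hu : MemH1On I u) (hJ : J ⊆ I) : MemH1On J u :=
  ⟨hu.1.mono_measure (Measure.restrict_mono hJ le_rfl),
    hu.2.1.mono_measure (Measure.restrict_mono hJ le_rfl),
    fun x hx y hy => hu.2.2 x (hJ hx) y (hJ hy)⟩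

lemma MemH1On.add [OrdConnected I] (hI : IsOpen I) (hu : MemH1On I u) (hv : MemH1On I v) :
    MemH1On I (fun x => u x + v x) :=
  (hu.isPrimitiveOn.add hv.isPrimitiveOn).memH1On hI (hu.1.add hv.1) (hu.2.1.add hv.2.1)

lemma MemH1On.const_mul [OrdConnected I] (hI : IsOpen I) (c : ℂ) (hu : MemH1On I u) :
    MemH1On I (fun x => c * u x) :=
  (hu.isPrimitiveOn.const_mul c).memH1On hI (hu.1.const_mul c) (hu.2.1.const_mul c)

lemma MemH1On.continuousOn [OrdConnected I] (hI : IsOpen I) (hu : MemH1On I u) :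
    ContinuousOn u I := hu.isPrimitiveOn.continuousOn hI

lemma MemH1.continuous (hu : MemH1 u) : Continuous u :=
  continuousOn_univ.1 (MemH1On.continuousOn isOpen_univ hu)

lemma MemH1.memLp (hu : MemH1 u) : MemLp u 2 volume := by simpa using hu.1

lemma MemH1.memLp_deriv (hu : MemH1 u) : MemLp (deriv u) 2 volume := by simpa using hu.2.1

lemma MemH1.isPrimitiveOn (hu : MemH1 u) : IsPrimitiveOn univ u (deriv u) :=
  MemH1On.isPrimitiveOn hu

lemma MemH1.on (hu : MemH1 u) (I : Set ℝ) : MemH1On I u := MemH1On.mono hu (subset_univ I)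

lemma MemH1.of_isPrimitiveOn (h : IsPrimitiveOn univ f f') (hf : MemLp f 2 volume)
    (hf' : MemLp f' 2 volume) : MemH1 f :=
  h.memH1On isOpen_univ (by simpa using hf) (by simpa using hf')

lemma IsPrimitiveOn.deriv_ae_eq_univ (h : IsPrimitiveOn univ f f') : deriv f =ᵐ[volume] f' := by
  simpa using h.deriv_ae_eq isOpen_univ

lemma MemH1.add (hu : MemH1 u) (hv : MemH1 v) : MemH1 (fun x => u x + v x) :=
  MemH1On.add isOpen_univ hu hv

lemma MemH1.const_mul (c : ℂ) (hu : MemH1 u) : MemH1 (fun x => c * u x) :=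
  MemH1On.const_mul isOpen_univ c hu

lemma MemH1.deriv_add (hu : MemH1 u) (hv : MemH1 v) :
    deriv (fun x => u x + v x) =ᵐ[volume] fun x => deriv u x + deriv v x :=
  (hu.isPrimitiveOn.add hv.isPrimitiveOn).deriv_ae_eq_univ

lemma deriv_const_mul_fun (c : ℂ) (u : ℝ → ℂ) :
    deriv (fun x => c * u x) = fun x => c * deriv u x := by
  funext x
  exact deriv_const_mul_field c

lemma MemH1.eq_of_ae_eq (hu : MemH1 u) (hv : MemH1 v) (h : u =ᵐ[volume] v) : u = v :=
  Continuous.ae_eq_iff_eq volume hu.continuous hv.continuous |>.1 h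

lemma memH1_zero : MemH1 (fun _ => (0 : ℂ)) :=
  ⟨by simp, by simp, by simp⟩

end H1

/-! ### Integration by parts and Green's formula -/

section Product

variable {I : Set ℝ} {u v : ℝ → ℂ}

/-- The derivative of `u v̄`. -/
lemma MemH1On.isPrimitiveOn_mul_star [OrdConnected I] (hu : MemH1On I u) (hv : MemH1On I v) :
    IsPrimitiveOn I (fun x => u x * star (v x))
      (fun x => deriv u x * star (v x) + u x * star (deriv v x)) :=
  hu.isPrimitiveOn.mul hv.isPrimitiveOn.star

lemma _root_.MeasureTheory.MemLp.integrable_mul_star {μ : Measure ℝ} (hu : MemLp u 2 μ)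
    (hv : MemLp v 2 μ) : Integrable (fun x => u x * star (v x)) μ :=
  hu.integrable_mul hv.star

lemma MemH1On.integrable_deriv_mul_star (hu : MemH1On I u) (hv : MemH1On I v) :
    IntegrableOn (fun x => deriv u x * star (v x) + u x * star (deriv v x)) I :=
  (hu.2.1.integrable_mul_star hv.1).add (hu.1.integrable_mul_star hv.2.1)

variable {a b : ℝ} {l r l' r' : ℂ}

lemma MemH1On.integral_Ioo (hab : a < b) (hu : MemH1On (Ioo a b) u) (hv : MemH1On (Ioo a b) v)
    (hul : Tendsto u (𝓝[>] a) (𝓝 l)) (hur : Tendsto u (𝓝[<] b) (𝓝 r))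
    (hvl : Tendsto v (𝓝[>] a) (𝓝 l')) (hvr : Tendsto v (𝓝[<] b) (𝓝 r')) :
    ∫ x in Ioo a b, (deriv u x * star (v x) + u x * star (deriv v x)) =
      r * star r' - l * star l' :=
  integral_Ioo_of_isPrimitiveOn hab (hu.isPrimitiveOn_mul_star hv) (hul.mul hvl.star)
    (hur.mul hvr.star) (hu.integrable_deriv_mul_star hv)

lemma MemH1On.integral_Ioi (hu : MemH1On (Ioi a) u) (hv : MemH1On (Ioi a) v)
    (hul : Tendsto u (𝓝[>] a) (𝓝 l)) (hvl : Tendsto v (𝓝[>] a) (𝓝 l')) :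
    ∫ x in Ioi a, (deriv u x * star (v x) + u x * star (deriv v x)) = -(l * star l') :=
  integral_Ioi_of_isPrimitiveOn (hu.isPrimitiveOn_mul_star hv) (hul.mul hvl.star)
    (hu.1.integrable_mul_star hv.1) (hu.integrable_deriv_mul_star hv)

lemma MemH1On.integral_Iio (hu : MemH1On (Iio a) u) (hv : MemH1On (Iio a) v)
    (hul : Tendsto u (𝓝[<] a) (𝓝 l)) (hvl : Tendsto v (𝓝[<] a) (𝓝 l')) :
    ∫ x in Iio a, (deriv u x * star (v x) + u x * star (deriv v x)) = l * star l' :=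
  integral_Iio_of_isPrimitiveOn (hu.isPrimitiveOn_mul_star hv) (hul.mul hvl.star)
    (hu.1.integrable_mul_star hv.1) (hu.integrable_deriv_mul_star hv)

lemma integral_three {E : Type*} [NormedAddCommGroup E] [NormedSpace ℝ E] {g : ℝ → E}
    (h1 : IntegrableOn g (Iio (-1))) (h2 : IntegrableOn g (Ioo (-1) 1))
    (h3 : IntegrableOn g (Ioi 1)) :
    Integrable g ∧ ∫ x, g x =
      (∫ x in Iio (-1), g x) + (∫ x in Ioo (-1) 1, g x) + ∫ x in Ioi 1, g x := by
  have h1' : IntegrableOn g (Iic (-1)) := by rwa [integrableOn_Iic_iff_integrableOn_Iio]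
  have h2' : IntegrableOn g (Ioc (-1) 1) := by rwa [integrableOn_Ioc_iff_integrableOn_Ioo]
  have e1 : Iic (-1) ∪ Ioc (-1) 1 = Iic (1 : ℝ) := Iic_union_Ioc_eq_Iic (by norm_num)
  have h4 : IntegrableOn g (Iic 1) := e1 ▸ h1'.union h2'
  have e2 : Iic 1 ∪ Ioi (1 : ℝ) = univ := Iic_union_Ioi
  have h5 : IntegrableOn g univ := e2 ▸ h4.union h3
  refine ⟨integrableOn_univ.1 h5, ?_⟩
  rw [← setIntegral_univ, ← e2, setIntegral_union (Iic_disjoint_Ioi le_rfl) measurableSet_Ioi h4 h3,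
    ← e1, setIntegral_union (Iic_disjoint_Ioc le_rfl) measurableSet_Ioc h1' h2',
    integral_Iic_eq_integral_Iio, integral_Ioc_eq_integral_Ioo]

/-- Green's formula on the line with the points `±1` removed, for a function with prescribed jumps
of the derivative. -/
lemma integral_deriv_deriv_mul_star {u v : ℝ → ℂ} {jp jm : ℂ}
    (h1 : MemH2On (Iio (-1)) u) (h2 : MemH2On (Ioo (-1) 1) u) (h3 : MemH2On (Ioi 1) u)
    (hp : HasDerivJump u 1 jp) (hm : HasDerivJump u (-1) jm) (hv : MemH1 v) :
    Integrable (fun x => deriv (deriv u) x * star (v x) + deriv u x * star (deriv v x)) ∧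
    ∫ x, (deriv (deriv u) x * star (v x) + deriv u x * star (deriv v x)) =
      -(jp * star (v 1)) - jm * star (v (-1)) := by
  obtain ⟨l, r, hl, hr, rfl⟩ := hp
  obtain ⟨l', r', hl', hr', rfl⟩ := hm
  obtain ⟨hi, he⟩ := integral_three (h1.2.integrable_deriv_mul_star (hv.on _))
    (h2.2.integrable_deriv_mul_star (hv.on _)) (h3.2.integrable_deriv_mul_star (hv.on _))
  refine ⟨hi, ?_⟩
  have hc : ∀ (x : ℝ) (s : Set ℝ), Tendsto v (𝓝[s] x) (𝓝 (v x)) := fun x s =>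
    hv.continuous.continuousAt.continuousWithinAt
  rw [he, MemH1On.integral_Iio h1.2 (hv.on _) hl' (hc _ _),
    MemH1On.integral_Ioo (by norm_num) h2.2 (hv.on _) hr' hl (hc _ _) (hc _ _),
    MemH1On.integral_Ioi h3.2 (hv.on _) hr (hc _ _)]
  ring

end Product

/-! ### Trace inequalities -/

lemma MemH1.integrable_norm_sq {u : ℝ → ℂ} (hu : MemH1 u) : Integrable (fun x => ‖u x‖ ^ 2) :=
  hu.memLp.integrable_norm_pow (by norm_num)

lemma MemH1.integrable_norm_sq_deriv {u : ℝ → ℂ} (hu : MemH1 u) :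
    Integrable (fun x => ‖deriv u x‖ ^ 2) :=
  hu.memLp_deriv.integrable_norm_pow (by norm_num)

/-- Completing the square in `‖z - s w‖²`. With `z = u'` and `w = u` the left side is `s (|u|²)'`,
so integrating it against suitable weights gives trace estimates. -/
lemma re_mul_star_add_le (s : ℝ) (z w : ℂ) :
    s * (z * star w + w * star z).re ≤ ‖z‖ ^ 2 + s ^ 2 * ‖w‖ ^ 2 := by
  have h : 0 ≤ ‖z - s * w‖ ^ 2 := sq_nonneg _
  have e : ‖z - s * w‖ ^ 2 = ‖z‖ ^ 2 + s ^ 2 * ‖w‖ ^ 2 - s * (z * star w + w * star z).re := by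
    simp only [← Complex.normSq_eq_norm_sq, Complex.normSq_apply, Complex.sub_re, Complex.sub_im,
      Complex.mul_re, Complex.mul_im, Complex.ofReal_re, Complex.ofReal_im, Complex.add_re,
      Complex.star_def, Complex.conj_re, Complex.conj_im]
    ring
  linarith

/-- The inequality is used with the weight `-s`: since `u` decays at infinity, the integral of `-s
(|u|²)'` over the half-line is `s |u(a)|²`. -/
lemma MemH1.trace_Ioi {u : ℝ → ℂ} (hu : MemH1 u) (a s : ℝ) :
    s * ‖u a‖ ^ 2 ≤ ∫ x in Ioi a, (‖deriv u x‖ ^ 2 + s ^ 2 * ‖u x‖ ^ 2) := by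
  have hc : Tendsto u (𝓝[>] a) (𝓝 (u a)) := hu.continuous.continuousAt.continuousWithinAt
  have h := MemH1On.integral_Ioi (hu.on _) (hu.on _) hc hc
  have hi := (hu.on (Ioi a)).integrable_deriv_mul_star (hu.on (Ioi a))
  have h1 : s * ‖u a‖ ^ 2 = ∫ x in Ioi a,
      -s * (deriv u x * star (u x) + u x * star (deriv u x)).re := by
    rw [integral_const_mul]
    erw [integral_re hi]
    rw [h]
    simp only [Complex.star_def, Complex.mul_conj, Complex.normSq_eq_norm_sq]
    simp [-Complex.ofReal_pow]
  rw [h1]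
  refine integral_mono (hi.re.const_mul (-s))
    (hu.integrable_norm_sq_deriv.add (hu.integrable_norm_sq.const_mul _)).integrableOn fun x => ?_
  simpa using re_mul_star_add_le (-s) (deriv u x) (u x)

lemma MemH1.trace_Iio {u : ℝ → ℂ} (hu : MemH1 u) (a s : ℝ) :
    s * ‖u a‖ ^ 2 ≤ ∫ x in Iio a, (‖deriv u x‖ ^ 2 + s ^ 2 * ‖u x‖ ^ 2) := by
  have hc : Tendsto u (𝓝[<] a) (𝓝 (u a)) := hu.continuous.continuousAt.continuousWithinAt
  have h := MemH1On.integral_Iio (hu.on _) (hu.on _) hc hc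
  have hi := (hu.on (Iio a)).integrable_deriv_mul_star (hu.on (Iio a))
  have h1 : s * ‖u a‖ ^ 2 = ∫ x in Iio a,
      s * (deriv u x * star (u x) + u x * star (deriv u x)).re := by
    rw [integral_const_mul]
    erw [integral_re hi]
    rw [h]
    simp only [Complex.star_def, Complex.mul_conj, Complex.normSq_eq_norm_sq]
    simp [-Complex.ofReal_pow]
  rw [h1]
  refine integral_mono (hi.re.const_mul s)
    (hu.integrable_norm_sq_deriv.add (hu.integrable_norm_sq.const_mul _)).integrableOn fun x => ?_
  exact re_mul_star_add_le s (deriv u x) (u x)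

/-- The weight `w = s tanh(s x)` solves the Riccati equation `w' = s² - w²`. -/
lemma hasDerivAt_mul_tanh (s x : ℝ) :
    HasDerivAt (fun x => s * Real.tanh (s * x)) (s ^ 2 - (s * Real.tanh (s * x)) ^ 2) x := by
  have hc : Real.cosh (s * x) ≠ 0 := (Real.cosh_pos _).ne'
  have h0 : HasDerivAt (fun x : ℝ => s * x) s x := by simpa using (hasDerivAt_id x).const_mul s
  have h1 := ((h0.sinh.div h0.cosh hc).const_mul s)
  have e : (fun x => s * Real.tanh (s * x)) =
      fun y => s * ((fun x => Real.sinh (s * x)) / fun x => Real.cosh (s * x)) y := by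
    funext y
    simp [Real.tanh_eq_sinh_div_cosh]
  rw [e]
  refine h1.congr_deriv ?_
  simp only [Real.tanh_eq_sinh_div_cosh]
  field_simp

/-- By the Riccati equation `(w|u|²)' = (s² - w²)|u|² + w(|u|²)' ≤ |u'|² + s²|u|²`, and `w` is odd
with `w(1) = s tanh s`, so both ends contribute with the same sign. -/
lemma MemH1.trace_Ioo {u : ℝ → ℂ} (hu : MemH1 u) (s : ℝ) :
    s * Real.tanh s * (‖u 1‖ ^ 2 + ‖u (-1)‖ ^ 2) ≤
      ∫ x in Ioo (-1) 1, (‖deriv u x‖ ^ 2 + s ^ 2 * ‖u x‖ ^ 2) := by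
  set w : ℝ → ℝ := fun x => s * Real.tanh (s * x) with hw
  have hwc : Continuous w :=
    continuous_iff_continuousAt.2 fun x => (hasDerivAt_mul_tanh s x).continuousAt
  have hwp : IsPrimitiveOn univ (fun x => (w x : ℂ)) (fun x => ((s ^ 2 - w x ^ 2 : ℝ) : ℂ)) :=
    IsPrimitiveOn.of_hasDerivAt (fun x _ => (hasDerivAt_mul_tanh s x).ofReal_comp)
      (by fun_prop)
  have hup := MemH1On.isPrimitiveOn_mul_star hu hu
  have hp := (hwp.mul hup).mono (subset_univ (Ioo (-1 : ℝ) 1))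
  have hii : Integrable (fun x => deriv u x * star (u x) + u x * star (deriv u x)) := by
    simpa [IntegrableOn] using MemH1On.integrable_deriv_mul_star hu hu
  have hi : IntegrableOn (fun x => ((s ^ 2 - w x ^ 2 : ℝ) : ℂ) * (u x * star (u x)) +
      (w x : ℂ) * (deriv u x * star (u x) + u x * star (deriv u x))) (Ioo (-1) 1) := by
    rw [← integrableOn_Icc_iff_integrableOn_Ioo]
    refine Integrable.add ?_ ?_
    · exact ((hu.memLp.integrable_mul_star hu.memLp).integrableOn).continuousOn_mul
        (by fun_prop) isCompact_Icc
    · exact hii.integrableOn.continuousOn_mul (by fun_prop) isCompact_Icc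
  have hc : Continuous fun x => (w x : ℂ) * (u x * star (u x)) :=
    (Complex.continuous_ofReal.comp hwc).mul (hu.continuous.mul hu.continuous.star)
  have h := integral_Ioo_of_isPrimitiveOn (by norm_num) hp
    hc.continuousAt.continuousWithinAt hc.continuousAt.continuousWithinAt hi
  have h1 : s * Real.tanh s * (‖u 1‖ ^ 2 + ‖u (-1)‖ ^ 2) = ∫ x in Ioo (-1) 1,
      (((s ^ 2 - w x ^ 2 : ℝ) : ℂ) * (u x * star (u x)) +
      (w x : ℂ) * (deriv u x * star (u x) + u x * star (deriv u x))).re := by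
    erw [integral_re hi]
    rw [h]
    simp only [Complex.star_def, Complex.mul_conj, Complex.normSq_eq_norm_sq, hw]
    simp only [mul_one, mul_neg, Real.tanh_neg, ← Complex.ofReal_mul, ← Complex.ofReal_sub]
    simp only [RCLike.re_to_complex, Complex.ofReal_re]
    ring
  rw [h1]
  refine integral_mono hi.re
    (hu.integrable_norm_sq_deriv.add (hu.integrable_norm_sq.const_mul _)).integrableOn fun x => ?_
  have h2 := re_mul_star_add_le (w x) (deriv u x) (u x)
  have h3 : (((s ^ 2 - w x ^ 2 : ℝ) : ℂ) * (u x * star (u x)) +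
      (w x : ℂ) * (deriv u x * star (u x) + u x * star (deriv u x))).re =
      (s ^ 2 - w x ^ 2) * ‖u x‖ ^ 2 +
        w x * (deriv u x * star (u x) + u x * star (deriv u x)).re := by
    rw [Complex.add_re, Complex.re_ofReal_mul, Complex.re_ofReal_mul, Complex.star_def,
      Complex.mul_conj, Complex.ofReal_re, Complex.normSq_eq_norm_sq]
  simp only at h3 ⊢
  rw [h3]
  linarith

/-- Replacing `r` by `r + 1` pays for the loss in `tanh`. With `s = √(r+1)` and `cosh² = sinh² + 1`
the claim becomes `r ≤ sinh² s`, while `sinh s ≥ s` gives even `sinh² s ≥ r + 1`. -/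
lemma sqrt_le_mul_tanh {r : ℝ} (hr : 0 ≤ r) : √r ≤ √(r + 1) * Real.tanh √(r + 1) := by
  set s := √(r + 1) with hs
  have hs2 : s ^ 2 = r + 1 := Real.sq_sqrt (by linarith)
  have hs0 : 0 ≤ s := Real.sqrt_nonneg _
  have hsh : s ≤ Real.sinh s := Real.self_le_sinh_iff.2 hs0
  have hc := Real.cosh_sq s
  have hcp := Real.cosh_pos s
  rw [Real.tanh_eq_sinh_div_cosh]
  refine Real.sqrt_le_iff.2 ⟨by positivity, ?_⟩
  rw [← mul_div_assoc, div_pow, le_div_iff₀ (by positivity), hc, mul_pow, hs2]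
  nlinarith

/-- The sharp trace inequality at the two points `±1`. -/
theorem MemH1.trace {u : ℝ → ℂ} (hu : MemH1 u) {r : ℝ} (hr : 0 ≤ r) :
    2 * √r * (‖u 1‖ ^ 2 + ‖u (-1)‖ ^ 2) ≤
      (∫ x, (‖deriv u x‖ ^ 2 + r * ‖u x‖ ^ 2)) + ∫ x, ‖u x‖ ^ 2 := by
  -- The additional `∫ |u|²` on the right is absorbed into the coefficient `s² = r + 1`.
  set s := √(r + 1) with hs
  have hs2 : s ^ 2 = r + 1 := Real.sq_sqrt (by linarith)
  have hi : Integrable fun x => ‖deriv u x‖ ^ 2 + s ^ 2 * ‖u x‖ ^ 2 :=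
    hu.integrable_norm_sq_deriv.add (hu.integrable_norm_sq.const_mul _)
  have h0 : (∫ x, (‖deriv u x‖ ^ 2 + r * ‖u x‖ ^ 2)) + ∫ x, ‖u x‖ ^ 2 =
      ∫ x, (‖deriv u x‖ ^ 2 + s ^ 2 * ‖u x‖ ^ 2) := by
    have hi' : Integrable fun x => ‖deriv u x‖ ^ 2 + r * ‖u x‖ ^ 2 :=
      hu.integrable_norm_sq_deriv.add (hu.integrable_norm_sq.const_mul _)
    rw [← integral_add hi' hu.integrable_norm_sq]
    congr 1
    funext x
    rw [hs2]
    ring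
  rw [h0, (integral_three hi.integrableOn hi.integrableOn hi.integrableOn).2]
  have h1 := hu.trace_Ioi 1 s
  have h2 := hu.trace_Iio (-1) s
  have h3 := hu.trace_Ioo s
  have h4 := sqrt_le_mul_tanh hr
  have h5 : √r ≤ s := Real.sqrt_le_sqrt (by linarith)
  have h6 : 0 ≤ ‖u 1‖ ^ 2 + ‖u (-1)‖ ^ 2 := by positivity
  -- Each point receives `s` from the half-line and `s tanh s` from the middle interval; both are at
  -- least `√r`.
  nlinarith [mul_le_mul_of_nonneg_right h4 h6, mul_le_mul_of_nonneg_right h5 h6]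

/-- Cauchy–Schwarz against the constant function, in the form that the variance of `g` is
nonnegative. -/
lemma sq_integral_Ioo_le {a b : ℝ} (hab : a < b) {g : ℝ → ℝ} (h1 : IntegrableOn g (Ioo a b))
    (h2 : IntegrableOn (fun x => g x ^ 2) (Ioo a b)) :
    (∫ x in Ioo a b, g x) ^ 2 ≤ (b - a) * ∫ x in Ioo a b, g x ^ 2 := by
  set G := ∫ x in Ioo a b, g x with hG
  have hba : 0 < b - a := by linarith
  have h : 0 ≤ ∫ x in Ioo a b, (g x - G / (b - a)) ^ 2 :=
    integral_nonneg fun x => sq_nonneg _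
  have e : ∫ x in Ioo a b, (g x - G / (b - a)) ^ 2 =
      (∫ x in Ioo a b, g x ^ 2) - 2 * (G / (b - a)) * G + (G / (b - a)) ^ 2 * (b - a) := by
    have e1 : ∀ x, (g x - G / (b - a)) ^ 2 =
        g x ^ 2 - 2 * (G / (b - a)) * g x + (G / (b - a)) ^ 2 := fun x => by ring
    have h3 : IntegrableOn (fun x => g x ^ 2 - 2 * (G / (b - a)) * g x) (Ioo a b) :=
      h2.sub (h1.const_mul _)
    simp_rw [e1]
    rw [integral_add h3 (integrable_const _), integral_sub h2 (h1.const_mul _), integral_const_mul, integral_const]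
    simp [Measure.real, hab.le, mul_comm, ← hG]
  rw [e] at h
  have e2 : 2 * (G / (b - a)) * G = 2 * (G ^ 2 / (b - a)) := by ring
  have e3 : (G / (b - a)) ^ 2 * (b - a) = G ^ 2 / (b - a) := by field_simp
  rw [e2, e3] at h
  have h3 : G ^ 2 / (b - a) ≤ ∫ x in Ioo a b, g x ^ 2 := by linarith
  rw [div_le_iff₀ hba] at h3
  linarith


/-! ### Point values controlled by the graph norm -/

section PointBound

lemma memH1On_Ioo_of_contDiff {a b : ℝ} {f f' : ℝ → ℝ} (h : ∀ x, HasDerivAt f (f' x) x)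
    (hc : Continuous f') : MemH1On (Ioo a b) (fun x => (f x : ℂ)) := by
  have hf : Continuous f := continuous_iff_continuousAt.2 fun x => (h x).continuousAt
  have hb : ∀ g : ℝ → ℝ, Continuous g →
      MemLp (fun x => (g x : ℂ)) 2 (volume.restrict (Ioo a b)) := by
    intro g hg
    have hg' : Continuous fun x => (g x : ℂ) := Complex.continuous_ofReal.comp hg
    obtain ⟨C, hC⟩ := isCompact_Icc.exists_bound_of_continuousOn (s := Icc a b) hg'.continuousOn
    have h1 : MemLp (fun x => (g x : ℂ)) 2 (volume.restrict (Icc a b)) :=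
      MemLp.of_bound hg'.aestronglyMeasurable C
        ((ae_restrict_iff' measurableSet_Icc).2 (ae_of_all _ hC))
    exact h1.mono_measure (Measure.restrict_mono Ioo_subset_Icc_self le_rfl)
  have hp : IsPrimitiveOn (Ioo a b) (fun x => (f x : ℂ)) (fun x => (f' x : ℂ)) :=
    IsPrimitiveOn.of_hasDerivAt (fun x _ => (h x).ofReal_comp)
      (Complex.continuous_ofReal.comp hc).continuousOn
  exact hp.memH1On isOpen_Ioo (hb f hf) (hb f' hc)

/-- The value of an `H²` function at the left end of an interval of length `h`. -/
lemma eq_integral_of_memH2On {u : ℝ → ℂ} {a b h : ℝ} {l : ℂ} (hh : 0 < h) (hb : a + h < b)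
    (hu : MemH2On (Ioo a b) u) (hc : ContinuousAt u a) (hl : Tendsto (deriv u) (𝓝[>] a) (𝓝 l)) :
    ∃ v v'' : ℝ → ℝ, Continuous v ∧ Continuous v'' ∧ (∀ x ∈ Ioo a (a + h), |v x| ≤ h) ∧
      (∀ x ∈ Ioo a (a + h), |v'' x| ≤ 4 / h) ∧
      u a = ∫ x in Ioo a (a + h), (deriv (deriv u) x * (v x : ℂ) - u x * (v'' x : ℂ)) := by
  -- A cubic with `v(a) = 0`, `v'(a) = 1` and `v = v' = 0` at `a + h`. In two integrations by parts
  -- of `∫ u'' v` every boundary term disappears except `u(a)`; in particular the unknown limit `l`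
  -- of `u'` drops out.
  set v : ℝ → ℝ := fun x => (x - a) * (1 - (x - a) / h) ^ 2 with hv
  set v' : ℝ → ℝ := fun x => 1 - 4 * (x - a) / h + 3 * (x - a) ^ 2 / h ^ 2 with hv'
  set v'' : ℝ → ℝ := fun x => -4 / h + 6 * (x - a) / h ^ 2 with hv''
  have hne : h ≠ 0 := hh.ne'
  have d0 : ∀ x, HasDerivAt (fun x : ℝ => x - a) 1 x := fun x => (hasDerivAt_id x).sub_const a
  have d1 : ∀ x, HasDerivAt v (v' x) x := by
    intro x
    have h1 := (d0 x).mul ((((d0 x).div_const h).const_sub 1).pow 2)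
    refine h1.congr_deriv ?_
    simp only [hv', Pi.pow_apply, Nat.reduceSub, pow_one, Nat.cast_ofNat]
    field_simp
    ring
  have d2 : ∀ x, HasDerivAt v' (v'' x) x := by
    intro x
    have h1 := ((((d0 x).const_mul 4).div_const h).const_sub 1).add
      ((((d0 x).pow 2).const_mul 3).div_const (h ^ 2))
    refine h1.congr_deriv ?_
    simp only [hv'']
    field_simp
    ring
  have c1 : Continuous v := by fun_prop
  have c2 : Continuous v' := by fun_prop
  have c3 : Continuous v'' := by fun_prop
  have hsub : Ioo a (a + h) ⊆ Ioo a b := Ioo_subset_Ioo_right hb.le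
  have hmem : a + h ∈ Ioo a b := ⟨by linarith, hb⟩
  have hu1 : MemH1On (Ioo a (a + h)) u := hu.1.mono hsub
  have hu2 : MemH1On (Ioo a (a + h)) (deriv u) := hu.2.mono hsub
  have cu : ContinuousAt u (a + h) := (hu.1.continuousOn isOpen_Ioo).continuousAt
    (isOpen_Ioo.mem_nhds hmem)
  have cu' : ContinuousAt (deriv u) (a + h) := (hu.2.continuousOn isOpen_Ioo).continuousAt
    (isOpen_Ioo.mem_nhds hmem)
  have H1 : MemH1On (Ioo a (a + h)) (fun x => (v x : ℂ)) := memH1On_Ioo_of_contDiff d1 c2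
  have H2 : MemH1On (Ioo a (a + h)) (fun x => (v' x : ℂ)) := memH1On_Ioo_of_contDiff d2 c3
  have e1 : deriv (fun x => (v x : ℂ)) = fun x => (v' x : ℂ) :=
    funext fun x => ((d1 x).ofReal_comp).deriv
  have e2 : deriv (fun x => (v' x : ℂ)) = fun x => (v'' x : ℂ) :=
    funext fun x => ((d2 x).ofReal_comp).deriv
  have cv : Continuous fun x => (v x : ℂ) := Complex.continuous_ofReal.comp c1
  have cv' : Continuous fun x => (v' x : ℂ) := Complex.continuous_ofReal.comp c2
  have G1 := MemH1On.integral_Ioo (by linarith) hu2 H1 hl cu'.continuousWithinAt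
    cv.continuousAt.continuousWithinAt cv.continuousAt.continuousWithinAt
  have G2 := MemH1On.integral_Ioo (by linarith) hu1 H2 hc.continuousWithinAt
    cu.continuousWithinAt cv'.continuousAt.continuousWithinAt cv'.continuousAt.continuousWithinAt
  have I1 := hu2.integrable_deriv_mul_star H1
  have I2 := hu1.integrable_deriv_mul_star H2
  have v0 : v a = 0 := by simp [hv]
  have v1 : v (a + h) = 0 := by simp [hv, hne]
  have v0' : v' a = 1 := by simp [hv']
  have v1' : v' (a + h) = 0 := by simp only [hv']; field_simp; ring
  rw [e1] at G1 I1
  rw [e2] at G2 I2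
  simp only [v0, v1, v0', v1', Complex.star_def, Complex.conj_ofReal, Complex.ofReal_zero,
    Complex.ofReal_one] at G1 G2 I1 I2
  refine ⟨v, v'', c1, c3, ?_, ?_, ?_⟩
  · intro x hx
    have hx0 : 0 < x - a := by linarith [hx.1]
    have hxh : x - a < h := by linarith [hx.2]
    have h1 : (x - a) / h < 1 := by rwa [div_lt_one hh]
    have h2 : 0 < (x - a) / h := by positivity
    simp only [hv]
    rw [abs_of_nonneg (by positivity)]
    have h3 : (1 - (x - a) / h) ^ 2 ≤ 1 := by nlinarith
    nlinarith
  · intro x hx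
    have hx0 : 0 < x - a := by linarith [hx.1]
    have hxh : x - a < h := by linarith [hx.2]
    have e3 : v'' x = (-4 * h + 6 * (x - a)) / h ^ 2 := by simp only [hv'']; field_simp
    have e4 : 4 / h = 4 * h / h ^ 2 := by field_simp
    rw [e3, e4, abs_div, abs_of_pos (show (0 : ℝ) < h ^ 2 by positivity)]
    gcongr
    rw [abs_le]
    constructor <;> linarith
  · have h1 := integral_sub I1 I2
    rw [G1, G2] at h1
    have e3 : ∀ x, (deriv (deriv u) x * (v x : ℂ) + deriv u x * (v' x : ℂ) -
        (deriv u x * (v' x : ℂ) + u x * (v'' x : ℂ))) =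
        deriv (deriv u) x * (v x : ℂ) - u x * (v'' x : ℂ) := fun x => by ring
    simp_rw [e3] at h1
    rw [h1]
    simp

/-- The value of `u` at a point is controlled by `u` and `-u'' + r u`. -/
lemma norm_sq_le_of_memH2On {u : ℝ → ℂ} {a b r : ℝ} {l : ℂ} (hr : 0 ≤ r) (hb : a + 1 < b)
    (hu : MemH2On (Ioo a b) u) (hc : ContinuousAt u a) (hl : Tendsto (deriv u) (𝓝[>] a) (𝓝 l)) :
    ‖u a‖ ^ 2 ≤ 50 * √(1 + r) * ∫ x in Ioo a b,
      (‖u x‖ ^ 2 + ‖-deriv (deriv u) x + (r : ℂ) * u x‖ ^ 2) := by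
  set R := √(1 + r) with hR
  have hR2 : R ^ 2 = 1 + r := Real.sq_sqrt (by linarith)
  have hR1 : 1 ≤ R := Real.one_le_sqrt.2 (by linarith)
  have hR0 : 0 < R := by linarith
  -- The length balances the two contributions: `|v| ≤ h` multiplies `|u''| ≤ r|u| + |f|` with `r h
  -- ≤ R`, and `|v''| ≤ 4/h = 4R` multiplies `|u|`. This gives the coefficient `5R` in `g`, and
  -- Cauchy–Schwarz on length `h = 1/R` turns `50 R²` into `50 R`.
  set h := R⁻¹ with hh
  have hh0 : 0 < h := by positivity
  have hh1 : h ≤ 1 := inv_le_one_of_one_le₀ hR1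
  have hhR : h * R = 1 := inv_mul_cancel₀ hR0.ne'
  obtain ⟨v, v'', cv, cv'', bv, bv'', e⟩ :=
    eq_integral_of_memH2On hh0 (show a + h < b by linarith) hu hc hl
  have hsub : Ioo a (a + h) ⊆ Ioo a b := Ioo_subset_Ioo_right (by linarith)
  set f : ℝ → ℂ := fun x => -deriv (deriv u) x + (r : ℂ) * u x with hf
  have hfL : MemLp f 2 (volume.restrict (Ioo a b)) := (hu.2.2.1.neg).add (hu.1.1.const_mul _)
  set g : ℝ → ℝ := fun x => 5 * R * ‖u x‖ + h * ‖f x‖ with hg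
  have hgL : MemLp g 2 (volume.restrict (Ioo a b)) :=
    (hu.1.1.norm.const_mul _).add (hfL.norm.const_mul _)
  have hgL' : MemLp g 2 (volume.restrict (Ioo a (a + h))) :=
    hgL.mono_measure (Measure.restrict_mono hsub le_rfl)
  have hg1 : IntegrableOn g (Ioo a (a + h)) := hgL'.integrable (by norm_num)
  have hg2 : IntegrableOn (fun x => g x ^ 2) (Ioo a (a + h)) := hgL'.integrable_sq
  have h1 : ‖u a‖ ≤ ∫ x in Ioo a (a + h), g x := by
    rw [e]
    refine norm_integral_le_of_norm_le hg1 ?_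
    rw [ae_restrict_iff' measurableSet_Ioo]
    refine ae_of_all _ fun x hx => ?_
    have e1 : deriv (deriv u) x = (r : ℂ) * u x - f x := by simp [hf]
    have h2 : ‖deriv (deriv u) x‖ ≤ r * ‖u x‖ + ‖f x‖ := by
      rw [e1]
      refine (norm_sub_le _ _).trans ?_
      rw [norm_mul, Complex.norm_real, Real.norm_of_nonneg hr]
    have h3 : ‖(v x : ℂ)‖ ≤ h := by rw [Complex.norm_real]; exact bv x hx
    have h4 : ‖(v'' x : ℂ)‖ ≤ 4 * R := by
      rw [Complex.norm_real]
      refine (bv'' x hx).trans_eq ?_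
      rw [hh]
      field_simp
    calc ‖deriv (deriv u) x * (v x : ℂ) - u x * (v'' x : ℂ)‖
        ≤ ‖deriv (deriv u) x‖ * ‖(v x : ℂ)‖ + ‖u x‖ * ‖(v'' x : ℂ)‖ := by
          rw [← norm_mul, ← norm_mul]
          exact norm_sub_le _ _
      _ ≤ (r * ‖u x‖ + ‖f x‖) * h + ‖u x‖ * (4 * R) := by gcongr
      _ ≤ g x := by
          simp only [hg]
          have h5 : r * h ≤ R := by
            have : r ≤ R ^ 2 := by linarith
            calc r * h ≤ R ^ 2 * h := by gcongr
              _ = R * (h * R) := by ring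
              _ = R := by rw [hhR, mul_one]
          nlinarith [norm_nonneg (u x), mul_le_mul_of_nonneg_right h5 (norm_nonneg (u x))]
  have h2 := sq_integral_Ioo_le (show a < a + h by linarith) hg1 hg2
  have h3 : Integrable (fun x => ‖u x‖ ^ 2 + ‖f x‖ ^ 2) (volume.restrict (Ioo a b)) :=
    (hu.1.1.integrable_norm_pow (by norm_num)).add (hfL.integrable_norm_pow (by norm_num))
  have h4 : ∫ x in Ioo a (a + h), g x ^ 2 ≤
      50 * R ^ 2 * ∫ x in Ioo a b, (‖u x‖ ^ 2 + ‖f x‖ ^ 2) := by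
    rw [← integral_const_mul]
    calc ∫ x in Ioo a (a + h), g x ^ 2
        ≤ ∫ x in Ioo a (a + h), 50 * R ^ 2 * (‖u x‖ ^ 2 + ‖f x‖ ^ 2) := by
          refine integral_mono hg2 ((IntegrableOn.mono_set h3 hsub).const_mul _) fun x => ?_
          simp only [hg]
          have h5 : h ≤ R := by linarith
          have h6 : 5 * R * ‖u x‖ + h * ‖f x‖ ≤ 5 * R * (‖u x‖ + ‖f x‖) := by
            nlinarith [mul_le_mul_of_nonneg_right h5 (norm_nonneg (f x)), norm_nonneg (u x),
              mul_nonneg hR0.le (norm_nonneg (f x))]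
          have h7 : 0 ≤ 5 * R * ‖u x‖ + h * ‖f x‖ := by positivity
          calc (5 * R * ‖u x‖ + h * ‖f x‖) ^ 2 ≤ (5 * R * (‖u x‖ + ‖f x‖)) ^ 2 := by gcongr
            _ = 25 * R ^ 2 * (‖u x‖ + ‖f x‖) ^ 2 := by ring
            _ ≤ 25 * R ^ 2 * (2 * (‖u x‖ ^ 2 + ‖f x‖ ^ 2)) := by
                gcongr
                nlinarith [sq_nonneg (‖u x‖ - ‖f x‖)]
            _ = 50 * R ^ 2 * (‖u x‖ ^ 2 + ‖f x‖ ^ 2) := by ring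
      _ ≤ ∫ x in Ioo a b, 50 * R ^ 2 * (‖u x‖ ^ 2 + ‖f x‖ ^ 2) :=
          setIntegral_mono_set (h3.const_mul _) (ae_of_all _ fun x => by positivity)
            hsub.eventuallyLE
  calc ‖u a‖ ^ 2 ≤ (∫ x in Ioo a (a + h), g x) ^ 2 := by gcongr
    _ ≤ (a + h - a) * ∫ x in Ioo a (a + h), g x ^ 2 := h2
    _ ≤ (a + h - a) * (50 * R ^ 2 * ∫ x in Ioo a b, (‖u x‖ ^ 2 + ‖f x‖ ^ 2)) := by
        gcongr
        linarith
    _ = 50 * (h * R) * R * ∫ x in Ioo a b, (‖u x‖ ^ 2 + ‖f x‖ ^ 2) := by ring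
    _ = 50 * R * ∫ x in Ioo a b, (‖u x‖ ^ 2 + ‖f x‖ ^ 2) := by rw [hhR, mul_one]

end PointBound

/-! ### Regularity of weak solutions -/

section Weak

lemma _root_.MeasureTheory.LocallyIntegrable.intervalIntegrable_real {g : ℝ → ℂ}
    (hg : LocallyIntegrable g) (a b : ℝ) : IntervalIntegrable g volume a b :=
  intervalIntegrable_iff.2 ((hg.integrableOn_isCompact isCompact_uIcc).mono_set uIoc_subset_uIcc)

lemma memLp_indicator_Ioo {w : ℝ → ℂ} {R : ℝ} (hw : MemLp w 2 (volume.restrict (Ioo (-R) R))) :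
    MemLp ((Ioo (-R) R).indicator w) 2 volume :=
  (memLp_indicator_iff_restrict measurableSet_Ioo).2 hw

/-- A square integrable function on `(-R, R)` with mean value zero, extended by zero, is the
derivative of an `H¹` function supported in `[-R, R]`. -/
lemma exists_memH1_of_integral_eq_zero {w : ℝ → ℂ} {R : ℝ} (hR : 0 < R)
    (hw : MemLp w 2 (volume.restrict (Ioo (-R) R))) (h0 : ∫ x in Ioo (-R) R, w x = 0) :
    ∃ v, MemH1 v ∧ deriv v =ᵐ[volume] (Ioo (-R) R).indicator w ∧
      (∀ x, x ≤ -R → v x = 0) ∧ (∀ x, R ≤ x → v x = 0) := by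
  set W := (Ioo (-R) R).indicator w with hW
  have hWL : MemLp W 2 volume := memLp_indicator_Ioo hw
  have hWi : Integrable W := by
    rw [hW, integrable_indicator_iff measurableSet_Ioo]
    exact hw.integrable (by norm_num)
  set v : ℝ → ℂ := fun x => ∫ t in (-R)..x, W t with hv
  have hii : ∀ a b, IntervalIntegrable W volume a b := fun a b => hWi.intervalIntegrable
  have hp : IsPrimitiveOn univ v W := fun x _ y _ =>
    ⟨hii x y, intervalIntegral.integral_interval_sub_left (hii _ _) (hii _ _)⟩
  have hl : ∀ x, x ≤ -R → v x = 0 := by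
    intro x hx
    simp only [hv]
    rw [intervalIntegral.integral_symm, intervalIntegral.integral_of_le hx,
      setIntegral_eq_zero_of_forall_eq_zero, neg_zero]
    intro t ht
    exact indicator_of_notMem (fun h => absurd h.1 (not_lt.2 ht.2)) _
  have hr : ∀ x, R ≤ x → v x = 0 := by
    intro x hx
    simp only [hv]
    rw [intervalIntegral.integral_of_le (by linarith), hW, setIntegral_indicator measurableSet_Ioo]
    have : Ioc (-R) x ∩ Ioo (-R) R = Ioo (-R) R :=
      inter_eq_right.2 fun t ht => ⟨ht.1, (ht.2.trans_le hx).le⟩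
    rw [this, h0]
  have hc : Continuous v := continuousOn_univ.1 (hp.continuousOn isOpen_univ)
  have hs : HasCompactSupport v := by
    refine HasCompactSupport.intro (isCompact_Icc (a := -R) (b := R)) fun x hx => ?_
    rw [mem_Icc, not_and_or, not_le, not_le] at hx
    rcases hx with hx | hx
    · exact hl x hx.le
    · exact hr x hx.le
  exact ⟨v, MemH1.of_isPrimitiveOn hp (hc.memLp_of_hasCompactSupport hs) hWL,
    hp.deriv_ae_eq_univ, hl, hr⟩

/-- A function on `(-R, R)` orthogonal to all derivatives of `H¹` functions supported in `[-R, R]`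
is constant. -/
lemma exists_ae_eq_const_of_orthogonal {K : ℝ → ℂ} {R : ℝ} (hR : 0 < R)
    (hK : MemLp K 2 (volume.restrict (Ioo (-R) R)))
    (h : ∀ v, MemH1 v → (∀ x, x ≤ -R → v x = 0) → (∀ x, R ≤ x → v x = 0) →
      ∫ x in Ioo (-R) R, K x * star (deriv v x) = 0) :
    ∃ m : ℂ, ∀ᵐ x, x ∈ Ioo (-R) R → K x = m := by
  -- Once its mean `m` is subtracted, `K - m` is itself the derivative of an admissible `v`. Testing
  -- with this `v` gives `∫ |K - m|² = 0`.
  set m : ℂ := (∫ x in Ioo (-R) R, K x) / ((2 * R : ℝ) : ℂ) with hm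
  refine ⟨m, ?_⟩
  have hKi : IntegrableOn K (Ioo (-R) R) := hK.integrable (by norm_num)
  have hwL : MemLp (fun x => K x - m) 2 (volume.restrict (Ioo (-R) R)) := hK.sub (memLp_const m)
  have h0 : ∫ x in Ioo (-R) R, (K x - m) = 0 := by
    rw [integral_sub hKi (integrable_const _), integral_const]
    have h2 : ((2 * R : ℝ) : ℂ) ≠ 0 := by exact_mod_cast (by positivity : (2 * R : ℝ) ≠ 0)
    have e : (volume.restrict (Ioo (-R) R)).real univ = 2 * R := by
      simp [Measure.real, hR.le]
      ring_nf
    rw [e, hm, Complex.real_smul, mul_div_cancel₀ _ h2, sub_self]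
  obtain ⟨v, hv, hd, hl, hr⟩ := exists_memH1_of_integral_eq_zero hR hwL h0
  have hd' : deriv v =ᵐ[volume.restrict (Ioo (-R) R)] fun x => K x - m := by
    rw [EventuallyEq, ae_restrict_iff' measurableSet_Ioo]
    filter_upwards [hd] with x hx hxR
    rw [hx, indicator_of_mem hxR]
  have h1 := h v hv hl hr
  have h2 : ∫ x in Ioo (-R) R, K x * star (K x - m) = 0 := by
    rw [← h1]
    refine integral_congr_ae ?_
    filter_upwards [hd'] with x hx
    rw [hx]
  have h3 : ∫ x in Ioo (-R) R, m * star (K x - m) = 0 := by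
    rw [integral_const_mul]
    have : ∫ x in Ioo (-R) R, star (K x - m) = star (∫ x in Ioo (-R) R, (K x - m)) := integral_conj
    rw [this, h0]
    simp
  have h4 : ∫ x in Ioo (-R) R, ((‖K x - m‖ ^ 2 : ℝ) : ℂ) = 0 := by
    have e : ∀ x, ((‖K x - m‖ ^ 2 : ℝ) : ℂ) = K x * star (K x - m) - m * star (K x - m) := by
      intro x
      rw [← sub_mul, Complex.star_def, Complex.mul_conj, Complex.normSq_eq_norm_sq]
    simp_rw [e]
    rw [integral_sub (hK.integrable_mul_star hwL) ((memLp_const m).integrable_mul_star hwL), h2, h3,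
      sub_zero]
  rw [integral_complex_ofReal, Complex.ofReal_eq_zero,
    integral_eq_zero_iff_of_nonneg (fun x => by positivity)
      (hwL.integrable_norm_pow (by norm_num))] at h4
  have h5 := (ae_restrict_iff' measurableSet_Ioo).1 h4
  filter_upwards [h5] with x hx hxR
  have := hx hxR
  simpa [sub_eq_zero] using this

variable {u f : ℝ → ℂ} {r : ℝ} {βp βm : ℂ}

/-- A primitive of `r u - f` with the prescribed jumps at `±1`. -/
noncomputable def jumpPrimitive (g : ℝ → ℂ) (βp βm : ℂ) (x : ℝ) : ℂ :=
  -(∫ t in (0 : ℝ)..x, g t) + (if 1 < x then βp else 0) + (if -1 < x then βm else 0)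

/-- The two hypotheses on `I` say that it lies on one side of each of `1` and `-1`, so the step
functions are constant on it. -/
lemma isPrimitiveOn_jumpPrimitive {g : ℝ → ℂ} (hg : LocallyIntegrable g) {I : Set ℝ}
    (h1 : ∀ x ∈ I, ∀ y ∈ I, (1 < x ↔ 1 < y)) (h2 : ∀ x ∈ I, ∀ y ∈ I, (-1 < x ↔ -1 < y)) :
    IsPrimitiveOn I (jumpPrimitive g βp βm) (fun x => -g x) := by
  have hii : ∀ a b, IntervalIntegrable g volume a b := hg.intervalIntegrable_real
  intro x hx y hy
  refine ⟨(hii x y).neg, ?_⟩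
  rw [intervalIntegral.integral_neg, ← intervalIntegral.integral_interval_sub_left (hii 0 y) (hii 0 x)]
  simp only [jumpPrimitive, h1 x hx y hy, h2 x hx y hy]
  ring

lemma measurable_jumpPrimitive {g : ℝ → ℂ} (hg : LocallyIntegrable g) :
    Measurable (jumpPrimitive g βp βm) := by
  have hii : ∀ a b, IntervalIntegrable g volume a b := hg.intervalIntegrable_real
  have hc : Continuous fun x => ∫ t in (0 : ℝ)..x, g t := intervalIntegral.continuous_primitive hii 0
  exact (hc.measurable.neg.add (Measurable.ite measurableSet_Ioi measurable_const
    measurable_const)).add (Measurable.ite measurableSet_Ioi measurable_const measurable_const)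

lemma memLp_jumpPrimitive {g : ℝ → ℂ} (hg : LocallyIntegrable g) (R : ℝ) :
    MemLp (jumpPrimitive g βp βm) 2 (volume.restrict (Ioo (-R) R)) := by
  have hii : ∀ a b, IntervalIntegrable g volume a b := hg.intervalIntegrable_real
  have hc : Continuous fun x => ∫ t in (0 : ℝ)..x, g t := intervalIntegral.continuous_primitive hii 0
  obtain ⟨C, hC⟩ := isCompact_Icc.exists_bound_of_continuousOn (s := Icc (-R) R) hc.continuousOn
  refine MemLp.of_bound (measurable_jumpPrimitive hg).aestronglyMeasurable (C + ‖βp‖ + ‖βm‖)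
    ((ae_restrict_iff' measurableSet_Ioo).2 (ae_of_all _ fun x hx => ?_))
  refine (norm_add_le _ _).trans (add_le_add ((norm_add_le _ _).trans (add_le_add ?_ ?_)) ?_)
  · rw [norm_neg]
    exact hC x (Ioo_subset_Icc_self hx)
  · split_ifs <;> simp
  · split_ifs <;> simp

/-- Integration by parts: because `v(R) = 0`, a step of height `β` at `a` pairs with `v̄'` to give
`-β v̄(a)`. The right side is thus what the weak equation prescribes for `∫ u' v̄'`. -/
lemma integral_jumpPrimitive_mul {g v : ℝ → ℂ} (hg : LocallyIntegrable g) {R : ℝ} (hR : 1 < R)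
    (hv : MemH1 v) (hl : v (-R) = 0) (hr : v R = 0) :
    ∫ x in Ioo (-R) R, jumpPrimitive g βp βm x * star (deriv v x) =
      (∫ x in Ioo (-R) R, g x * star (v x)) - βp * star (v 1) - βm * star (v (-1)) := by
  set P : ℝ → ℂ := fun x => ∫ t in (0 : ℝ)..x, g t with hP
  have hii : ∀ a b, IntervalIntegrable g volume a b := hg.intervalIntegrable_real
  have hPp : IsPrimitiveOn univ P g := fun x _ y _ =>
    ⟨hii x y, intervalIntegral.integral_interval_sub_left (hii 0 y) (hii 0 x)⟩
  have hPc : Continuous P := intervalIntegral.continuous_primitive hii 0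
  have hvi : ∀ a b, IntervalIntegrable (fun x => star (deriv v x)) volume a b := fun a b =>
    (hv.isPrimitiveOn.star a trivial b trivial).1
  have hstep : ∀ a, ∀ β : ℂ, -R < a → a < R →
      IntegrableOn (fun x => (if a < x then β else 0) * star (deriv v x)) (Ioo (-R) R) ∧
      ∫ x in Ioo (-R) R, (if a < x then β else 0) * star (deriv v x) = -(β * star (v a)) := by
    intro a β ha1 ha2
    have e : (fun x => (if a < x then β else 0) * star (deriv v x)) =
        (Ioi a).indicator (fun x => β * star (deriv v x)) := by
      funext x
      simp only [indicator, mem_Ioi]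
      split_ifs <;> simp
    have hii' : IntegrableOn (fun x => β * star (deriv v x)) (Ioo (-R) R) :=
      ((intervalIntegrable_iff_integrableOn_Ioo_of_le (by linarith)).1 (hvi (-R) R)).const_mul β
    rw [e]
    refine ⟨hii'.indicator measurableSet_Ioi, ?_⟩
    rw [setIntegral_indicator measurableSet_Ioi]
    have e2 : Ioo (-R) R ∩ Ioi a = Ioo a R := by
      ext x
      simp only [mem_inter_iff, mem_Ioo, mem_Ioi]
      constructor
      · rintro ⟨⟨_, h2⟩, h3⟩
        exact ⟨h3, h2⟩
      · rintro ⟨h1, h2⟩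
        exact ⟨⟨by linarith, h2⟩, h1⟩
    rw [e2, integral_const_mul, ← integral_Ioc_eq_integral_Ioo,
      ← intervalIntegral.integral_of_le ha2.le, ← (hv.isPrimitiveOn.star a trivial R trivial).2]
    simp [hr]
  obtain ⟨i1, e1⟩ := hstep 1 βp (by linarith) hR
  obtain ⟨i2, e2⟩ := hstep (-1) βm (by linarith) (by linarith)
  have hm := (hPp.mul hv.isPrimitiveOn.star) (-R) trivial R trivial
  have i3 : IntegrableOn (fun x => P x * star (deriv v x)) (Ioo (-R) R) :=
    (intervalIntegrable_iff_integrableOn_Ioo_of_le (by linarith)).1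
      ((hvi (-R) R).continuousOn_mul hPc.continuousOn)
  have i4 : IntegrableOn (fun x => g x * star (v x)) (Ioo (-R) R) :=
    (intervalIntegrable_iff_integrableOn_Ioo_of_le (by linarith)).1
      ((hii (-R) R).mul_continuousOn hv.continuous.star.continuousOn)
  have e3 : ∫ x in Ioo (-R) R, P x * star (deriv v x) = -∫ x in Ioo (-R) R, g x * star (v x) := by
    have h := hm.2
    rw [intervalIntegral.integral_of_le (by linarith), integral_Ioc_eq_integral_Ioo,
      integral_add i4 i3] at h
    simp only [hl, hr, star_zero, mul_zero, sub_zero] at h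
    linear_combination -h
  have e4 : ∀ x, jumpPrimitive g βp βm x * star (deriv v x) = -(P x * star (deriv v x)) +
      (if 1 < x then βp else 0) * star (deriv v x) +
      (if -1 < x then βm else 0) * star (deriv v x) := by
    intro x
    simp only [jumpPrimitive, hP]
    ring
  have i5 : IntegrableOn (fun x => -(P x * star (deriv v x)) +
      (if 1 < x then βp else 0) * star (deriv v x)) (Ioo (-R) R) := i3.neg.add i1
  have i6 : IntegrableOn (fun x => -(P x * star (deriv v x))) (Ioo (-R) R) := i3.neg
  simp_rw [e4]
  rw [integral_add i5 i2, integral_add i6 i1, integral_neg, e3, e1, e2]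
  ring

/-- `u` is a weak solution of `-u'' + r u + βp δ_1 + βm δ_{-1} = f`. -/
def IsWeakSolution (r : ℝ) (u f : ℝ → ℂ) (βp βm : ℂ) : Prop :=
  ∀ v, MemH1 v → (∫ x, (deriv u x * star (deriv v x) + (r : ℂ) * (u x * star (v x)))) +
    βp * star (v 1) + βm * star (v (-1)) = ∫ x, f x * star (v x)

/-- Du Bois-Reymond: `u'` minus the jump primitive is orthogonal to all derivatives of test
functions, so it is a constant `m`. The jump primitive is continuous off `±1`, hence `u` is
differentiable at every other point and not only almost everywhere, as the one-sided limits of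
`deriv u` require. -/
lemma IsWeakSolution.hasDerivAt (hu : MemH1 u) (hf : MemLp f 2 volume)
    (h : IsWeakSolution r u f βp βm) {R : ℝ} (hR : 1 < R) :
    ∃ m : ℂ, ∀ x ∈ Ioo (-R) R, x ≠ 1 → x ≠ -1 →
      HasDerivAt u (jumpPrimitive (fun x => f x - (r : ℂ) * u x) βp βm x + m) x := by
  set g : ℝ → ℂ := fun x => f x - (r : ℂ) * u x with hg
  have hgL : MemLp g 2 volume := hf.sub (hu.memLp.const_mul _)
  have hgl : LocallyIntegrable g := hgL.locallyIntegrable (by norm_num)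
  have hii : ∀ a b, IntervalIntegrable g volume a b := hgl.intervalIntegrable_real
  set G := jumpPrimitive g βp βm with hG
  have hGL : MemLp G 2 (volume.restrict (Ioo (-R) R)) := memLp_jumpPrimitive hgl R
  have hKL : MemLp (fun x => deriv u x - G x) 2 (volume.restrict (Ioo (-R) R)) :=
    (hu.memLp_deriv.mono_measure Measure.restrict_le_self).sub hGL
  obtain ⟨m, hm⟩ := exists_ae_eq_const_of_orthogonal (by linarith) hKL fun v hv hl hr => by
    have hvL : MemLp (deriv v) 2 (volume.restrict (Ioo (-R) R)) :=
      hv.memLp_deriv.mono_measure Measure.restrict_le_self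
    have e1 := h v hv
    have i1 := hu.memLp_deriv.integrable_mul_star hv.memLp_deriv
    have i2 := hu.memLp.integrable_mul_star hv.memLp
    have i3 := hf.integrable_mul_star hv.memLp
    have hout : ∀ x, x ∉ Ioo (-R) R → v x = 0 := by
      intro x hx
      rw [mem_Ioo, not_and_or, not_lt, not_lt] at hx
      exact hx.elim (hl x) (hr x)
    have hout' : ∀ᵐ x, x ∉ Ioo (-R) R → deriv v x = 0 := by
      have hz : ∀ J : Set ℝ, IsOpen J → (∀ x ∈ J, v x = 0) → ∀ x ∈ J, deriv v x = 0 := by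
        intro J hJ h0 x hx
        have : v =ᶠ[𝓝 x] fun _ => 0 := by
          filter_upwards [hJ.mem_nhds hx] with y hy using h0 y hy
        rw [this.deriv_eq]
        simp
      have n1 : ∀ᵐ x : ℝ, x ≠ -R := by simp [ae_iff, measure_singleton]
      have n2 : ∀ᵐ x : ℝ, x ≠ R := by simp [ae_iff, measure_singleton]
      filter_upwards [n1, n2] with x hx1 hx2 hx
      rw [mem_Ioo, not_and_or, not_lt, not_lt] at hx
      rcases hx with hx | hx
      · exact hz (Iio (-R)) isOpen_Iio (fun y hy => hl y (le_of_lt hy)) x (lt_of_le_of_ne hx hx1)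
      · exact hz (Ioi R) isOpen_Ioi (fun y hy => hr y (le_of_lt hy)) x
          (lt_of_le_of_ne hx (Ne.symm hx2))
    have e2 : ∫ x in Ioo (-R) R, g x * star (v x) = ∫ x, g x * star (v x) :=
      setIntegral_eq_integral_of_forall_compl_eq_zero fun x hx => by simp [hout x hx]
    have e3 : ∫ x in Ioo (-R) R, deriv u x * star (deriv v x) =
        ∫ x, deriv u x * star (deriv v x) :=
      setIntegral_eq_integral_of_ae_compl_eq_zero (by
        filter_upwards [hout'] with x hx hxR
        simp [hx hxR])
    have e4 : ∫ x, g x * star (v x) = (∫ x, f x * star (v x)) - (r : ℂ) * ∫ x, u x * star (v x) := by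
      rw [← integral_const_mul, ← integral_sub i3 (i2.const_mul _)]
      congr 1
      funext x
      simp only [hg]
      ring
    rw [integral_add i1 (i2.const_mul _), integral_const_mul] at e1
    have e5 := integral_jumpPrimitive_mul (βp := βp) (βm := βm) hgl hR hv (hl _ le_rfl) (hr _ le_rfl)
    have e6 : ∀ x, (deriv u x - G x) * star (deriv v x) =
        deriv u x * star (deriv v x) - G x * star (deriv v x) := fun x => by ring
    simp_rw [e6]
    rw [integral_sub i1.integrableOn (hGL.integrable_mul_star hvL), e3, e5, e2, e4]
    linear_combination e1
  refine ⟨m, fun x hx hx1 hx2 => ?_⟩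
  have hGc : ContinuousAt G x := by
    have hPc : Continuous fun x => ∫ t in (0 : ℝ)..x, g t :=
      intervalIntegral.continuous_primitive hii 0
    have hs : ∀ (a : ℝ) (β : ℂ), x ≠ a → ContinuousAt (fun y => if a < y then β else 0) x := by
      intro a β hxa
      rcases lt_or_gt_of_ne hxa with hlt | hlt
      · have : (fun y => if a < y then β else 0) =ᶠ[𝓝 x] fun _ => 0 := by
          filter_upwards [Iio_mem_nhds hlt] with y hy
          rw [if_neg (not_lt.2 (le_of_lt hy))]
        exact continuousAt_const.congr this.symm
      · have : (fun y => if a < y then β else 0) =ᶠ[𝓝 x] fun _ => β := by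
          filter_upwards [Ioi_mem_nhds hlt] with y hy
          rw [if_pos (mem_Ioi.1 hy)]
        exact continuousAt_const.congr this.symm
    exact (hPc.continuousAt.neg.add (hs 1 βp hx1)).add (hs (-1) βm hx2)
  have hGi : IntervalIntegrable (fun x => G x + m) volume (-R) R := by
    rw [intervalIntegrable_iff_integrableOn_Ioo_of_le (by linarith)]
    exact (hGL.add (memLp_const m)).integrable (by norm_num)
  have h0R : (0 : ℝ) ∈ Ioo (-R) R := ⟨by linarith, by linarith⟩
  have hsub : ∀ y ∈ Ioo (-R) R, IntervalIntegrable (fun x => G x + m) volume 0 y := by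
    intro y hy
    refine hGi.mono_set ?_
    rw [uIcc_of_le (show -R ≤ R by linarith)]
    exact (convex_Icc (-R) R).ordConnected.uIcc_subset (Ioo_subset_Icc_self h0R)
      (Ioo_subset_Icc_self hy)
  have heq : ∀ y ∈ Ioo (-R) R, u y = u 0 + ∫ t in (0 : ℝ)..y, (G t + m) := by
    intro y hy
    have e1 := (hu.isPrimitiveOn 0 trivial y trivial).2
    have e2 : ∫ t in (0 : ℝ)..y, deriv u t = ∫ t in (0 : ℝ)..y, (G t + m) := by
      refine intervalIntegral.integral_congr_ae ?_
      filter_upwards [hm] with t ht hty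
      have htR : t ∈ Ioo (-R) R :=
        (convex_Ioo (-R) R).ordConnected.uIcc_subset h0R hy (uIoc_subset_uIcc hty)
      rw [← ht htR]
      ring
    rw [← e2, ← e1]
    ring
  have hmeas : StronglyMeasurableAtFilter (fun x => G x + m) (𝓝 x) volume :=
    ⟨univ, univ_mem, ((measurable_jumpPrimitive hgl).add_const m).aestronglyMeasurable⟩
  have hd := intervalIntegral.integral_hasDerivAt_right (hsub x hx) hmeas
    (hGc.add continuousAt_const)
  refine (hd.const_add (u 0)).congr_of_eventuallyEq ?_
  filter_upwards [Ioo_mem_nhds hx.1 hx.2] with y hy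
  exact heq y hy

/-- Regularity of weak solutions. -/
theorem IsWeakSolution.regular (hu : MemH1 u) (hf : MemLp f 2 volume)
    (h : IsWeakSolution r u f βp βm) :
    MemH2On (Iio (-1)) u ∧ MemH2On (Ioo (-1) 1) u ∧ MemH2On (Ioi 1) u ∧
      HasDerivJump u 1 βp ∧ HasDerivJump u (-1) βm ∧
      f =ᵐ[volume] fun x => -deriv (deriv u) x + (r : ℂ) * u x := by
  set g : ℝ → ℂ := fun x => f x - (r : ℂ) * u x with hg
  have hgL : MemLp g 2 volume := hf.sub (hu.memLp.const_mul _)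
  have hgl : LocallyIntegrable g := hgL.locallyIntegrable (by norm_num)
  have hii : ∀ a b, IntervalIntegrable g volume a b := hgl.intervalIntegrable_real
  have key : ∀ I : Set ℝ, IsOpen I → OrdConnected I → (∀ x ∈ I, ∀ y ∈ I, (1 < x ↔ 1 < y)) →
      (∀ x ∈ I, ∀ y ∈ I, (-1 < x ↔ -1 < y)) → (∀ x ∈ I, x ≠ 1 ∧ x ≠ -1) →
      MemH2On I u ∧ ∀ᵐ x, x ∈ I → deriv (deriv u) x = -g x := by
    intro I hI hIc h1 h2 h3
    have hp : IsPrimitiveOn I (deriv u) (fun x => -g x) := by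
      intro x hx y hy
      obtain ⟨e0, e1⟩ := isPrimitiveOn_jumpPrimitive (βp := βp) (βm := βm) hgl h1 h2 x hx y hy
      refine ⟨e0, ?_⟩
      -- The constant `m` may depend on `R`, so one `R` is taken for both points and `m` cancels in
      -- the difference.
      obtain ⟨m, hm⟩ := h.hasDerivAt hu hf (R := 2 + |x| + |y|)
        (by linarith [abs_nonneg x, abs_nonneg y])
      have hxR : x ∈ Ioo (-(2 + |x| + |y|)) (2 + |x| + |y|) :=
        ⟨by linarith [neg_abs_le x, abs_nonneg y], by linarith [le_abs_self x, abs_nonneg y]⟩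
      have hyR : y ∈ Ioo (-(2 + |x| + |y|)) (2 + |x| + |y|) :=
        ⟨by linarith [neg_abs_le y, abs_nonneg x], by linarith [le_abs_self y, abs_nonneg x]⟩
      rw [(hm x hxR (h3 x hx).1 (h3 x hx).2).deriv, (hm y hyR (h3 y hy).1 (h3 y hy).2).deriv, ← e1]
      ring
    refine ⟨⟨hu.on I, hp.memH1On hI (hu.on I).2.1
      (hgL.neg.mono_measure Measure.restrict_le_self)⟩, ?_⟩
    exact (hp.ae_hasDerivAt hI).mono fun x hx hxI => (hx hxI).deriv
  obtain ⟨k1, a1⟩ := key (Iio (-1)) isOpen_Iio ordConnected_Iio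
    (fun x hx y hy => by rw [mem_Iio] at hx hy; constructor <;> intro <;> linarith)
    (fun x hx y hy => by rw [mem_Iio] at hx hy; constructor <;> intro <;> linarith)
    (fun x hx => by rw [mem_Iio] at hx; constructor <;> rintro rfl <;> linarith)
  obtain ⟨k2, a2⟩ := key (Ioo (-1) 1) isOpen_Ioo ordConnected_Ioo
    (fun x hx y hy => by rw [mem_Ioo] at hx hy; constructor <;> intro <;> linarith)
    (fun x hx y hy => by rw [mem_Ioo] at hx hy; constructor <;> intro <;> linarith)
    (fun x hx => by rw [mem_Ioo] at hx; constructor <;> rintro rfl <;> linarith)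
  obtain ⟨k3, a3⟩ := key (Ioi 1) isOpen_Ioi ordConnected_Ioi
    (fun x hx y hy => by rw [mem_Ioi] at hx hy; constructor <;> intro <;> linarith)
    (fun x hx y hy => by rw [mem_Ioi] at hx hy; constructor <;> intro <;> linarith)
    (fun x hx => by rw [mem_Ioi] at hx; constructor <;> rintro rfl <;> linarith)
  -- One interval around both `±1`, so that the same `m` occurs in all four one-sided limits.
  obtain ⟨m, hm⟩ := h.hasDerivAt hu hf (R := 3) (by norm_num)
  have hPc : Continuous fun x => ∫ t in (0 : ℝ)..x, g t :=
    intervalIntegral.continuous_primitive hii 0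
  have hside : ∀ (a : ℝ) (s : Set ℝ) (z : ℂ), (∀ᶠ x in 𝓝[s] a, x ∈ Ioo (-3 : ℝ) 3 ∧ x ≠ 1 ∧ x ≠ -1 ∧
      (if 1 < x then βp else 0) + (if -1 < x then βm else 0) = z) →
      Tendsto (deriv u) (𝓝[s] a) (𝓝 (-(∫ t in (0 : ℝ)..a, g t) + z + m)) := by
    intro a s z hs
    have h1 : Tendsto (fun x => -(∫ t in (0 : ℝ)..x, g t) + z + m) (𝓝[s] a)
        (𝓝 (-(∫ t in (0 : ℝ)..a, g t) + z + m)) :=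
      ((hPc.neg.add_const z).add_const m).continuousAt.continuousWithinAt
    refine h1.congr' ?_
    filter_upwards [hs] with x ⟨hx1, hx2, hx3, hx4⟩
    rw [(hm x hx1 hx2 hx3).deriv, jumpPrimitive, ← hx4]
    ring
  have s1 := hside 1 (Iio 1) βm (by
    filter_upwards [Ioo_mem_nhdsLT (show (0 : ℝ) < 1 by norm_num)] with x hx
    rw [if_neg (by linarith [hx.2]), if_pos (by linarith [hx.1])]
    exact ⟨⟨by linarith [hx.1], by linarith [hx.2]⟩, hx.2.ne, by linarith [hx.1], by simp⟩)
  have s2 := hside 1 (Ioi 1) (βp + βm) (by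
    filter_upwards [Ioo_mem_nhdsGT (show (1 : ℝ) < 2 by norm_num)] with x hx
    rw [if_pos (by linarith [hx.1]), if_pos (by linarith [hx.1])]
    exact ⟨⟨by linarith [hx.1], by linarith [hx.2]⟩, hx.1.ne', by linarith [hx.1], by simp⟩)
  have s3 := hside (-1) (Iio (-1)) 0 (by
    filter_upwards [Ioo_mem_nhdsLT (show (-2 : ℝ) < -1 by norm_num)] with x hx
    rw [if_neg (by linarith [hx.2]), if_neg (by linarith [hx.2])]
    exact ⟨⟨by linarith [hx.1], by linarith [hx.2]⟩, by linarith [hx.2], hx.2.ne, by simp⟩)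
  have s4 := hside (-1) (Ioi (-1)) βm (by
    filter_upwards [Ioo_mem_nhdsGT (show (-1 : ℝ) < 0 by norm_num)] with x hx
    rw [if_neg (by linarith [hx.2]), if_pos (by linarith [hx.1])]
    exact ⟨⟨by linarith [hx.1], by linarith [hx.2]⟩, by linarith [hx.2], hx.1.ne', by simp⟩)
  refine ⟨k1, k2, k3, ⟨_, _, s1, s2, by ring⟩, ⟨_, _, s3, s4, by ring⟩, ?_⟩
  have n1 : ∀ᵐ x : ℝ, x ≠ 1 := by simp [ae_iff, measure_singleton]
  have n2 : ∀ᵐ x : ℝ, x ≠ -1 := by simp [ae_iff, measure_singleton]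
  filter_upwards [a1, a2, a3, n1, n2] with x h1 h2 h3 hx1 hx2
  have : deriv (deriv u) x = -g x := by
    rcases lt_or_gt_of_ne hx2 with h | h
    · exact h1 h
    · rcases lt_or_gt_of_ne hx1 with h' | h'
      · exact h2 ⟨h, h'⟩
      · exact h3 h'
  rw [this]
  simp [hg]

end Weak

/-! ### Hermite functions: orthonormality and completeness -/

section Hermite

open Polynomial FourierTransform SchwartzMap

lemma integrable_eval_mul_exp (p : ℝ[X]) {b : ℝ} (hb : 0 < b) :
    Integrable fun x : ℝ => p.eval x * Real.exp (-b * x ^ 2) := by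
  induction p using Polynomial.induction_on' with
  | add p q hp hq =>
    simp only [eval_add, add_mul]
    exact hp.add hq
  | monomial n a =>
    have h := (integrable_rpow_mul_exp_neg_mul_sq hb (s := n)
      (by linarith [Nat.cast_nonneg (α := ℝ) n])).const_mul a
    simpa [eval_monomial, mul_assoc] using h

/-- The Gaussian integral of a polynomial. -/
noncomputable def gaussInt (p : ℝ[X]) : ℝ := ∫ x, p.eval x * Real.exp (-(1 / 2) * x ^ 2)

lemma gaussInt_add (p q : ℝ[X]) : gaussInt (p + q) = gaussInt p + gaussInt q := by
  simp only [gaussInt, eval_add, add_mul]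
  exact integral_add (integrable_eval_mul_exp p (by norm_num))
    (integrable_eval_mul_exp q (by norm_num))

/-- Integration by parts against the Gaussian, whose logarithmic derivative is `-x`. -/
lemma gaussInt_X_mul (p : ℝ[X]) : gaussInt (X * p) = gaussInt (derivative p) := by
  have hd : ∀ x : ℝ, HasDerivAt (fun x => p.eval x * Real.exp (-(1 / 2) * x ^ 2))
      ((derivative p).eval x * Real.exp (-(1 / 2) * x ^ 2) -
        (X * p).eval x * Real.exp (-(1 / 2) * x ^ 2)) x := by
    intro x
    have h1 : HasDerivAt (fun x : ℝ => -(1 / 2) * x ^ 2) (-x) x := by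
      refine ((hasDerivAt_pow 2 x).const_mul (-(1 / 2) : ℝ)).congr_deriv ?_
      norm_num
      ring
    refine ((p.hasDerivAt x).mul h1.exp).congr_deriv ?_
    simp only [eval_mul, eval_X]
    ring
  have i1 := integrable_eval_mul_exp (derivative p) (b := 1 / 2) (by norm_num)
  have i2 := integrable_eval_mul_exp (X * p) (b := 1 / 2) (by norm_num)
  have h := integral_eq_zero_of_hasDerivAt_of_integrable hd (i1.sub i2)
    (integrable_eval_mul_exp p (by norm_num))
  rw [integral_sub i1 i2] at h
  simp only [gaussInt]
  linarith

/-- The Hermite polynomials with real coefficients. -/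
noncomputable def hermiteReal (n : ℕ) : ℝ[X] := (hermite n).map (Int.castRingHom ℝ)

lemma aeval_hermite (n : ℕ) (x : ℝ) : aeval x (hermite n) = (hermiteReal n).eval x := by
  rw [hermiteReal, eval_map, aeval_def]
  rfl

lemma hermiteReal_succ (n : ℕ) :
    hermiteReal (n + 1) = X * hermiteReal n - derivative (hermiteReal n) := by
  simp [hermiteReal, hermite_succ, derivative_map]

lemma hermiteReal_monic (n : ℕ) : (hermiteReal n).Monic := (hermite_monic n).map _

lemma natDegree_hermiteReal (n : ℕ) : (hermiteReal n).natDegree = n := by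
  rw [hermiteReal, (hermite_monic n).natDegree_map, natDegree_hermite]

/-- Since `He_{n+1} = X He_n - He_n'`, the previous identity lets `He_{n+1} p` integrate like `He_n
p'`, so `n` derivatives move onto `p`. Orthogonality follows from counting degrees, and the norm
`n!` from monicity. -/
lemma gaussInt_hermite_mul (n : ℕ) (p : ℝ[X]) :
    gaussInt (hermiteReal n * p) = gaussInt (derivative^[n] p) := by
  induction n generalizing p with
  | zero => simp [hermiteReal]
  | succ n ih =>
    rw [Function.iterate_succ_apply, ← ih]
    have e : hermiteReal (n + 1) * p + derivative (hermiteReal n * p) =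
        X * (hermiteReal n * p) + hermiteReal n * derivative p := by
      rw [hermiteReal_succ, derivative_mul]
      ring
    have h := congrArg gaussInt e
    rw [gaussInt_add, gaussInt_add, gaussInt_X_mul] at h
    linarith

lemma gaussInt_C (c : ℝ) : gaussInt (C c) = c * √(2 * Real.pi) := by
  simp only [gaussInt, eval_C, integral_const_mul, integral_gaussian]
  congr 2
  field_simp

lemma gaussInt_hermite_mul_hermite (m n : ℕ) :
    gaussInt (hermiteReal m * hermiteReal n) = if m = n then (m.factorial : ℝ) * √(2 * Real.pi)
      else 0 := by
  have hlt : ∀ a b : ℕ, a < b → gaussInt (hermiteReal b * hermiteReal a) = 0 := by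
    intro a b hab
    rw [gaussInt_hermite_mul, iterate_derivative_eq_zero (by rwa [natDegree_hermiteReal])]
    simp [gaussInt]
  split_ifs with h
  · subst h
    rw [gaussInt_hermite_mul]
    have hdeg : (derivative^[m] (hermiteReal m)).natDegree = 0 := by
      have := natDegree_iterate_derivative (hermiteReal m) m
      rw [natDegree_hermiteReal] at this
      omega
    rw [eq_C_of_natDegree_eq_zero hdeg, gaussInt_C, coeff_iterate_derivative]
    have h1 : (hermiteReal m).coeff (0 + m) = 1 := by
      rw [zero_add]
      have h2 := hermiteReal_monic m
      rwa [Monic, leadingCoeff, natDegree_hermiteReal] at h2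
    rw [h1]
    simp [Nat.descFactorial_self]
  · rcases lt_or_gt_of_ne h with h | h
    · rw [mul_comm]
      exact hlt m n h
    · exact hlt n m h

lemma hermiteFun_eq (n : ℕ) (q : ℝ) : hermiteFun n q =
    (√((n.factorial : ℝ) * √Real.pi))⁻¹ *
      ((hermiteReal n).eval (√2 * q) * Real.exp (-(1 / 2) * q ^ 2)) := by
  rw [hermiteFun, aeval_hermite, div_eq_inv_mul]
  congr 3
  ring

lemma eval_comp_scale (p : ℝ[X]) (q : ℝ) : (p.comp (C √2 * X)).eval q = p.eval (√2 * q) := by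
  simp

lemma continuous_hermiteFun (n : ℕ) : Continuous (hermiteFun n) := by
  have e : hermiteFun n = fun q => (√((n.factorial : ℝ) * √Real.pi))⁻¹ *
      ((hermiteReal n).eval (√2 * q) * Real.exp (-(1 / 2) * q ^ 2)) := funext (hermiteFun_eq n)
  rw [e]
  fun_prop

lemma hermiteFun_mul (m n : ℕ) (q : ℝ) : hermiteFun m q * hermiteFun n q =
    (√((m.factorial : ℝ) * √Real.pi))⁻¹ * (√((n.factorial : ℝ) * √Real.pi))⁻¹ *
      ((hermiteReal m * hermiteReal n).eval (√2 * q) * Real.exp (-(1 / 2) * (√2 * q) ^ 2)) := by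
  rw [hermiteFun_eq, hermiteFun_eq, eval_mul]
  have e : Real.exp (-(1 / 2) * (√2 * q) ^ 2) =
      Real.exp (-(1 / 2) * q ^ 2) * Real.exp (-(1 / 2) * q ^ 2) := by
    rw [← Real.exp_add]
    congr 1
    rw [mul_pow, Real.sq_sqrt (by norm_num)]
    ring
  rw [e]
  ring

/-- The Hermite functions are orthonormal. -/
theorem integral_hermiteFun_mul (m n : ℕ) :
    ∫ q, hermiteFun m q * hermiteFun n q = if m = n then 1 else 0 := by
  simp_rw [hermiteFun_mul]
  have h := Measure.integral_comp_mul_left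
    (fun x : ℝ => (hermiteReal m * hermiteReal n).eval x * Real.exp (-(1 / 2) * x ^ 2)) (√2)
  rw [integral_const_mul, h]
  have h2 : ∫ x : ℝ, (hermiteReal m * hermiteReal n).eval x * Real.exp (-(1 / 2) * x ^ 2) =
      if m = n then (m.factorial : ℝ) * √(2 * Real.pi) else 0 := gaussInt_hermite_mul_hermite m n
  rw [h2]
  split_ifs with hmn
  · subst hmn
    have hpi := Real.pi_pos
    have e1 : √((m.factorial : ℝ) * √Real.pi) * √((m.factorial : ℝ) * √Real.pi) =
        (m.factorial : ℝ) * √Real.pi := Real.mul_self_sqrt (by positivity)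
    rw [← mul_inv, e1, Real.sqrt_mul (by norm_num : (0 : ℝ) ≤ 2), smul_eq_mul,
      abs_of_pos (by positivity)]
    have : (m.factorial : ℝ) ≠ 0 := by positivity
    field_simp
  · simp

lemma memLp_hermiteFun (n : ℕ) : MemLp (hermiteFun n) 2 := by
  rw [memLp_two_iff_integrable_sq (continuous_hermiteFun n).aestronglyMeasurable]
  -- If the square were not integrable, its integral would be zero by convention instead of one.
  by_contra h
  have h1 := integral_hermiteFun_mul n n
  rw [if_pos rfl] at h1
  have h2 : ∫ q, hermiteFun n q * hermiteFun n q = 0 :=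
    integral_undef (by simpa [pow_two] using h)
  linarith

/-- Half of the Gaussian absorbs the linear exponent: `2c|q| ≤ q²/2 + 2c²`. These functions dominate
the exponential series in the completeness proof. -/
lemma memLp_exp_neg_sq_add (c : ℝ) :
    MemLp (fun q : ℝ => Real.exp (-(1 / 2) * q ^ 2 + c * |q|)) 2 := by
  have hcont : Continuous fun q : ℝ => Real.exp (-(1 / 2) * q ^ 2 + c * |q|) := by fun_prop
  rw [memLp_two_iff_integrable_sq hcont.aestronglyMeasurable]
  refine ((integrable_exp_neg_mul_sq (b := 1 / 2) (by norm_num)).const_mul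
    (Real.exp (2 * c ^ 2))).mono' (hcont.pow 2).aestronglyMeasurable (ae_of_all _ fun q => ?_)
  rw [Real.norm_of_nonneg (by positivity), ← Real.exp_nat_mul, ← Real.exp_add, Real.exp_le_exp]
  have h := sq_nonneg (|q| - 2 * c)
  have h2 : |q| ^ 2 = q ^ 2 := sq_abs q
  push_cast
  nlinarith

/-- A function with vanishing Hermite coefficients has vanishing Gaussian moments. -/
lemma moment_eq_zero {f : ℝ → ℂ} (hf : MemLp f 2)
    (h : ∀ n, ∫ q, f q * (hermiteFun n q : ℂ) = 0) (k : ℕ) :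
    ∫ q, f q * ((q ^ k * Real.exp (-(1 / 2) * q ^ 2) : ℝ) : ℂ) = 0 := by
  have hint : ∀ p : ℝ[X], Integrable fun q =>
      f q * ((p.eval (√2 * q) * Real.exp (-(1 / 2) * q ^ 2) : ℝ) : ℂ) := by
    intro p
    have hL : MemLp (fun q : ℝ => p.eval (√2 * q) * Real.exp (-(1 / 2) * q ^ 2)) 2 := by
      rw [memLp_two_iff_integrable_sq (by fun_prop)]
      have := integrable_eval_mul_exp ((p.comp (C √2 * X)) ^ 2) (b := 1) (by norm_num)
      refine this.congr (ae_of_all _ fun q => ?_)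
      simp only [eval_pow, eval_comp_scale, mul_pow, ← Real.exp_nat_mul]
      congr 2
      push_cast
      ring
    exact hf.integrable_mul hL.ofReal
  -- The polynomials with vanishing weighted integral form a subspace. It contains the Hermite
  -- polynomials, monic and one in each degree, so it is everything.
  let S : Submodule ℝ ℝ[X] :=
    { carrier := {p | ∫ q, f q * ((p.eval (√2 * q) * Real.exp (-(1 / 2) * q ^ 2) : ℝ) : ℂ) = 0}
      zero_mem' := by simp
      add_mem' := by
        intro p r hp hr
        simp only [mem_ofPred_eq] at hp hr ⊢
        simp only [eval_add, add_mul, Complex.ofReal_add, mul_add]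
        rw [integral_add (hint p) (hint r), hp, hr, add_zero]
      smul_mem' := by
        intro c p hp
        simp only [mem_ofPred_eq] at hp ⊢
        have e : ∀ q : ℝ, f q * (((c • p).eval (√2 * q) * Real.exp (-(1 / 2) * q ^ 2) : ℝ) : ℂ) =
            (c : ℂ) * (f q * ((p.eval (√2 * q) * Real.exp (-(1 / 2) * q ^ 2) : ℝ) : ℂ)) := by
          intro q
          simp only [eval_smul, smul_eq_mul, Complex.ofReal_mul]
          ring
        simp_rw [e]
        rw [integral_const_mul, hp, mul_zero] }
  let T : Polynomial.Sequence ℝ :=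
    { elems' := hermiteReal
      degree_eq' := fun i => by
        rw [degree_eq_natDegree (hermiteReal_monic i).ne_zero, natDegree_hermiteReal] }
  have hS : S = ⊤ := by
    rw [eq_top_iff, ← T.span fun i => by
      rw [show (T i).leadingCoeff = 1 from hermiteReal_monic i]; exact isUnit_one]
    rw [Submodule.span_le]
    rintro _ ⟨n, rfl⟩
    change ∫ q, f q * (((hermiteReal n).eval (√2 * q) * Real.exp (-(1 / 2) * q ^ 2) : ℝ) : ℂ) = 0
    have h1 := h n
    simp_rw [hermiteFun_eq] at h1
    have e : ∀ q : ℝ, f q * (((√((n.factorial : ℝ) * √Real.pi))⁻¹ *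
        ((hermiteReal n).eval (√2 * q) * Real.exp (-(1 / 2) * q ^ 2)) : ℝ) : ℂ) =
        ((√((n.factorial : ℝ) * √Real.pi))⁻¹ : ℝ) *
        (f q * (((hermiteReal n).eval (√2 * q) * Real.exp (-(1 / 2) * q ^ 2) : ℝ) : ℂ)) := by
      intro q
      push_cast
      ring
    simp_rw [e] at h1
    rw [integral_const_mul] at h1
    refine (mul_eq_zero.1 h1).resolve_left ?_
    have hpi := Real.pi_pos
    have : (√((n.factorial : ℝ) * √Real.pi))⁻¹ ≠ 0 := by positivity
    exact_mod_cast this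
  have hk : (C ((√2)⁻¹ ^ k) * X ^ k : ℝ[X]) ∈ S := hS ▸ Submodule.mem_top
  have h2 : ∫ q, f q * (((C ((√2)⁻¹ ^ k) * X ^ k : ℝ[X]).eval (√2 * q) *
    Real.exp (-(1 / 2) * q ^ 2) : ℝ) : ℂ) = 0 := hk
  rw [← h2]
  congr 1
  funext q
  congr 3
  simp only [eval_mul, eval_C, eval_pow, eval_X]
  rw [mul_pow, ← mul_assoc, ← mul_pow, inv_mul_cancel₀ (by positivity), one_pow, one_mul]

/-- An integrable function whose Fourier transform vanishes is zero. -/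
lemma ae_eq_zero_of_fourier_eq_zero {g : ℝ → ℂ} (hg : Integrable g) (h : 𝓕 g = 0) :
    g =ᵐ[volume] 0 := by
  refine ae_eq_zero_of_integral_contDiff_smul_eq_zero hg.locallyIntegrable fun φ hφ hc => ?_
  have h1 : HasCompactSupport (Complex.ofRealCLM ∘ φ) := hc.comp_left rfl
  have h2 : ContDiff ℝ (⊤ : ℕ∞) (Complex.ofRealCLM ∘ φ) := by fun_prop
  -- The test function is the Fourier transform of a Schwartz function `Ψ`, and moving the transform
  -- across the integral gives `∫ φ g = ∫ Ψ 𝓕g = 0`.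
  set Φ : 𝓢(ℝ, ℂ) := h1.toSchwartzMap h2 with hΦ
  set Ψ : 𝓢(ℝ, ℂ) := 𝓕⁻ Φ with hΨ
  have e1 : 𝓕 (Ψ : ℝ → ℂ) = (Φ : ℝ → ℂ) := by
    rw [← SchwartzMap.fourier_coe, hΨ, FourierTransform.fourier_fourierInv_eq]
  have h3 := VectorFourier.integral_fourierIntegral_smul_eq_flip (L := innerₗ ℝ)
    Real.continuous_fourierChar continuous_inner (Ψ.integrable (μ := volume)) hg
  have e2 : ∀ x, VectorFourier.fourierIntegral Real.fourierChar volume (innerₗ ℝ) (Ψ : ℝ → ℂ) x =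
      (φ x : ℂ) := fun x => congrFun e1 x
  have e3 : VectorFourier.fourierIntegral Real.fourierChar volume (innerₗ ℝ).flip g = 0 := by
    rw [flip_innerₗ]
    exact h
  rw [e3] at h3
  simp only [e2, Pi.zero_apply, smul_zero, integral_zero] at h3
  simpa [Complex.real_smul] using h3

/-- The Hermite functions are complete in `L²(ℝ)`. -/
theorem ae_eq_zero_of_hermite {f : ℝ → ℂ} (hf : MemLp f 2)
    (h : ∀ n, ∫ q, f q * (hermiteFun n q : ℂ) = 0) : f =ᵐ[volume] 0 := by
  set E : ℝ → ℝ := fun q => Real.exp (-(1 / 2) * q ^ 2) with hE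
  have hEL : ∀ c : ℝ, Integrable fun q => ‖f q‖ * Real.exp (-(1 / 2) * q ^ 2 + c * |q|) :=
    fun c => hf.norm.integrable_mul (memLp_exp_neg_sq_add c)
  set g : ℝ → ℂ := fun q => f q * (E q : ℂ) with hg
  have hEc : Continuous E := by fun_prop
  have hgm : AEStronglyMeasurable g volume :=
    hf.1.mul (Complex.continuous_ofReal.comp hEc).aestronglyMeasurable
  have hgi : Integrable g := by
    refine (hEL 0).mono' hgm (ae_of_all _ fun q => ?_)
    simp only [hg, hE, norm_mul, Complex.norm_real, zero_mul, add_zero]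
    rw [Real.norm_of_nonneg (Real.exp_pos _).le]
  have hF : 𝓕 g = 0 := by
    funext t
    -- Expand `exp(-2πi t q)` in its power series under the integral. Every term is a Gaussian
    -- moment of `f`, hence zero.
    set z : ℂ := ((-2 * Real.pi * t : ℝ) : ℂ) * Complex.I with hz
    have hs := hasSum_integral_of_dominated_convergence (μ := (volume : Measure ℝ))
      (F := fun (k : ℕ) (q : ℝ) => ((k.factorial : ℂ))⁻¹ * (z * q) ^ k * g q)
      (f := fun q => Complex.exp (z * q) * g q)
      (fun k q => ((k.factorial : ℝ))⁻¹ * (‖z‖ * |q|) ^ k * ‖g q‖)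
      (fun k => (Continuous.aestronglyMeasurable (by fun_prop)).mul hgm)
      (fun k => ae_of_all _ fun q => by
        simp [norm_pow])
      (ae_of_all _ fun q => by
        refine Summable.mul_right _ ?_
        have := Real.summable_pow_div_factorial (‖z‖ * |q|)
        simpa [div_eq_inv_mul] using this)
      (by
        refine (hEL ‖z‖).congr (ae_of_all _ fun q => ?_)
        have h1 : ∑' n : ℕ, ((n.factorial : ℝ))⁻¹ * (‖z‖ * |q|) ^ n = Real.exp (‖z‖ * |q|) := by
          rw [Real.exp_eq_exp_ℝ, NormedSpace.exp_eq_tsum_div]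
          simp [div_eq_inv_mul]
        simp only
        rw [tsum_mul_right, h1]
        simp only [hg, hE, norm_mul, Complex.norm_real]
        rw [Real.norm_of_nonneg (Real.exp_pos _).le, Real.exp_add]
        ring)
      (ae_of_all _ fun q => by
        refine HasSum.mul_right _ ?_
        have := NormedSpace.expSeries_div_hasSum_exp (𝔸 := ℂ) (z * q)
        rw [← Complex.exp_eq_exp_ℂ] at this
        simpa [div_eq_inv_mul] using this)
    have h0 : ∀ k : ℕ, ∫ q : ℝ, ((k.factorial : ℂ))⁻¹ * (z * q) ^ k * g q = 0 := by
      intro k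
      have e : ∀ q : ℝ, ((k.factorial : ℂ))⁻¹ * (z * q) ^ k * g q =
          (((k.factorial : ℂ))⁻¹ * z ^ k) *
            (f q * ((q ^ k * Real.exp (-(1 / 2) * q ^ 2) : ℝ) : ℂ)) := by
        intro q
        simp only [hg, hE]
        push_cast
        ring
      simp_rw [e]
      rw [integral_const_mul, moment_eq_zero hf h k, mul_zero]
    simp_rw [h0] at hs
    have h2 := hs.unique hasSum_zero
    rw [Real.fourier_eq', Pi.zero_apply, ← h2]
    congr 1
    funext q
    rw [smul_eq_mul]
    congr 2
    simp only [hz, RCLike.inner_apply, conj_trivial]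
    push_cast
    ring
  filter_upwards [ae_eq_zero_of_fourier_eq_zero hgi hF] with q hq
  simp only [hg, Pi.zero_apply] at hq
  refine (mul_eq_zero.1 hq).resolve_right ?_
  exact_mod_cast (Real.exp_pos _).ne'

end Hermite

/-! ### The Hermite expansion as a Hilbert sum -/

section L2

variable {X Y : Type*} [MeasurableSpace X] [MeasurableSpace Y] {μ : Measure X} {ν : Measure Y}

lemma norm_sq_toLp {f : X → ℂ} (hf : MemLp f 2 μ) : ‖hf.toLp f‖ ^ 2 = ∫ x, ‖f x‖ ^ 2 ∂μ := by
  have h1 : (‖hf.toLp f‖ ^ 2 : ℝ) = (inner ℂ (hf.toLp f) (hf.toLp f)).re := by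
    rw [inner_self_eq_norm_sq_to_K]
    norm_cast
  rw [h1, L2.inner_def]
  have h2 : ∫ a, inner ℂ ((hf.toLp f) a) ((hf.toLp f) a) ∂μ = ((∫ x, ‖f x‖ ^ 2 ∂μ : ℝ) : ℂ) := by
    rw [← integral_complex_ofReal]
    refine integral_congr_ae ?_
    filter_upwards [hf.coeFn_toLp] with x hx
    rw [hx, inner_self_eq_norm_sq_to_K]
    norm_cast
  rw [h2, Complex.ofReal_re]

lemma inner_toLp {f g : X → ℂ} (hf : MemLp f 2 μ) (hg : MemLp g 2 μ) :
    inner ℂ (hf.toLp f) (hg.toLp g) = ∫ x, g x * star (f x) ∂μ := by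
  rw [L2.inner_def]
  refine integral_congr_ae ?_
  filter_upwards [hf.coeFn_toLp, hg.coeFn_toLp] with x h1 h2
  rw [h1, h2, RCLike.inner_apply]
  rfl

lemma norm_integral_mul_sq_le {f g : X → ℂ} (hf : MemLp f 2 μ) (hg : MemLp g 2 μ) :
    ‖∫ x, f x * g x ∂μ‖ ^ 2 ≤ (∫ x, ‖f x‖ ^ 2 ∂μ) * ∫ x, ‖g x‖ ^ 2 ∂μ := by
  have h1 := norm_inner_le_norm (𝕜 := ℂ) (hg.star.toLp _) (hf.toLp f)
  rw [inner_toLp] at h1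
  simp only [Pi.star_apply, star_star] at h1
  have h2 : ∫ x, ‖g x‖ ^ 2 ∂μ = ‖hg.star.toLp _‖ ^ 2 := by
    rw [norm_sq_toLp]
    simp
  rw [h2, ← norm_sq_toLp hf, ← mul_pow]
  gcongr
  rwa [mul_comm]

lemma memLp_mul_prod {f : X → ℂ} {g : Y → ℂ} (hf : MemLp f 2 μ)
    (hg : MemLp g 2 ν) : MemLp (fun z : X × Y => f z.1 * g z.2) 2 (μ.prod ν) := by
  have hm : AEStronglyMeasurable (fun z : X × Y => f z.1 * g z.2) (μ.prod ν) :=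
    hf.1.comp_fst.mul hg.1.comp_snd
  rw [memLp_two_iff_integrable_sq_norm hm]
  simp only [norm_mul, mul_pow]
  exact ((memLp_two_iff_integrable_sq_norm hf.1).1 hf).mul_prod
    ((memLp_two_iff_integrable_sq_norm hg.1).1 hg)

variable [SFinite μ] [SFinite ν]

lemma memLp_prodMk_left {F : X × Y → ℂ} (hF : MemLp F 2 (μ.prod ν)) :
    ∀ᵐ x ∂μ, MemLp (fun y => F (x, y)) 2 ν := by
  have h1 := hF.1.prodMk_left
  have h2 := ((memLp_two_iff_integrable_sq_norm hF.1).1 hF).prod_right_ae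
  filter_upwards [h1, h2] with x hx1 hx2
  exact (memLp_two_iff_integrable_sq_norm hx1).2 hx2

lemma memLp_integral_mul {F : X × Y → ℂ} (hF : MemLp F 2 (μ.prod ν)) {χ : Y → ℂ}
    (hχ : MemLp χ 2 ν) : MemLp (fun x => ∫ y, F (x, y) * χ y ∂ν) 2 μ := by
  have hm : AEStronglyMeasurable (fun x => ∫ y, F (x, y) * χ y ∂ν) μ :=
    (hF.1.mul hχ.1.comp_snd).integral_prod_right'
  rw [memLp_two_iff_integrable_sq_norm hm]
  have hi := ((memLp_two_iff_integrable_sq_norm hF.1).1 hF).integral_prod_left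
  refine (hi.mul_const (∫ y, ‖χ y‖ ^ 2 ∂ν)).mono' (hm.norm.pow 2) ?_
  filter_upwards [memLp_prodMk_left hF] with x hx
  rw [Real.norm_of_nonneg (by positivity)]
  exact norm_integral_mul_sq_le hx hχ

/-- A family of square integrable functions is complete. -/
def IsCompleteFamily {ι : Type*} (ν : Measure Y) (χ : ι → Y → ℂ) : Prop :=
  (∀ i, MemLp (χ i) 2 ν) ∧
    ∀ f, MemLp f 2 ν → (∀ i, ∫ y, f y * χ i y ∂ν = 0) → f =ᵐ[ν] 0

/-- As `ι` is countable, almost every slice `F(x, ·)` is orthogonal to all `χ i` at once and so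
vanishes. The strongly measurable representative `G` is needed to return from slices to the product
measure. -/
lemma ae_eq_zero_of_isCompleteFamily {ι : Type*} [Countable ι] {χ : ι → Y → ℂ}
    (hχ : IsCompleteFamily ν χ) {F : X × Y → ℂ} (hF : MemLp F 2 (μ.prod ν))
    (h : ∀ i, (fun x => ∫ y, F (x, y) * χ i y ∂ν) =ᵐ[μ] 0) : F =ᵐ[μ.prod ν] 0 := by
  obtain ⟨G, hG, hFG⟩ := hF.1
  have h1 : ∀ᵐ x ∂μ, ∀ᵐ y ∂ν, F (x, y) = G (x, y) := Measure.ae_ae_of_ae_prod hFG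
  have h2 : ∀ᵐ x ∂μ, ∀ᵐ y ∂ν, G (x, y) = 0 := by
    filter_upwards [h1, memLp_prodMk_left hF, ae_all_iff.2 h] with x hx1 hx2 hx3
    filter_upwards [hx1, hχ.2 _ hx2 hx3] with y hy1 hy2
    rw [← hy1, hy2, Pi.zero_apply]
  have hmeas : MeasurableSet {z : X × Y | G z = 0} := hG.measurable (measurableSet_singleton 0)
  have h3 := (Measure.ae_prod_iff_ae_ae hmeas).2 h2
  filter_upwards [hFG, h3] with z hz1 hz2
  rw [hz1, hz2, Pi.zero_apply]

lemma IsCompleteFamily.prod {ι κ : Type*} [Countable ι] [Countable κ] {χ : ι → X → ℂ}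
    {ψ : κ → Y → ℂ} (hχ : IsCompleteFamily μ χ) (hψ : IsCompleteFamily ν ψ) :
    IsCompleteFamily (μ.prod ν) (fun (p : ι × κ) (z : X × Y) => χ p.1 z.1 * ψ p.2 z.2) := by
  refine ⟨fun p => memLp_mul_prod (hχ.1 p.1) (hψ.1 p.2), fun F hF h => ?_⟩
  refine ae_eq_zero_of_isCompleteFamily hψ hF fun j => ?_
  refine hχ.2 _ (memLp_integral_mul hF (hψ.1 j)) fun i => ?_
  rw [← h (i, j)]
  have hi : Integrable (fun z : X × Y => F z * (χ i z.1 * ψ j z.2)) (μ.prod ν) :=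
    hF.integrable_mul (memLp_mul_prod (hχ.1 i) (hψ.1 j))
  rw [integral_prod _ hi]
  refine integral_congr_ae (ae_of_all _ fun x => ?_)
  simp only
  rw [← integral_mul_const]
  congr 1
  funext y
  ring

end L2

section HilbertSum

/-- The product of two Hermite functions. -/
noncomputable def hermiteProd (p : ℕ × ℕ) (q : ℝ × ℝ) : ℂ :=
  ((hermiteFun p.1 q.1 * hermiteFun p.2 q.2 : ℝ) : ℂ)

lemma isCompleteFamily_hermite :
    IsCompleteFamily volume (fun (n : ℕ) (q : ℝ) => (hermiteFun n q : ℂ)) :=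
  ⟨fun n => (memLp_hermiteFun n).ofReal, fun _ hf h => ae_eq_zero_of_hermite hf h⟩

lemma isCompleteFamily_hermiteProd : IsCompleteFamily volume hermiteProd := by
  have h := isCompleteFamily_hermite.prod isCompleteFamily_hermite
  rw [← Measure.volume_eq_prod] at h
  have e : hermiteProd = fun (p : ℕ × ℕ) (z : ℝ × ℝ) =>
      (hermiteFun p.1 z.1 : ℂ) * (hermiteFun p.2 z.2 : ℂ) := by
    funext p z
    simp [hermiteProd]
  rwa [e]

lemma star_hermiteProd (p : ℕ × ℕ) (q : ℝ × ℝ) : star (hermiteProd p q) = hermiteProd p q := by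
  simp [hermiteProd]

lemma integral_hermiteProd_mul (p p' : ℕ × ℕ) :
    ∫ q, hermiteProd p q * hermiteProd p' q = if p = p' then 1 else 0 := by
  have e : ∀ q : ℝ × ℝ, hermiteProd p q * hermiteProd p' q =
      (((hermiteFun p.1 q.1 * hermiteFun p'.1 q.1) *
        (hermiteFun p.2 q.2 * hermiteFun p'.2 q.2) : ℝ) : ℂ) := by
    intro q
    simp only [hermiteProd]
    push_cast
    ring
  simp_rw [e]
  rw [integral_complex_ofReal, Measure.volume_eq_prod,
    integral_prod_mul (fun x => hermiteFun p.1 x * hermiteFun p'.1 x)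
      (fun x => hermiteFun p.2 x * hermiteFun p'.2 x), integral_hermiteFun_mul,
    integral_hermiteFun_mul]
  by_cases h1 : p.1 = p'.1 <;> by_cases h2 : p.2 = p'.2 <;> simp [h1, h2, Prod.ext_iff]

lemma memLp_tensor {u : ℝ → ℂ} (hu : MemLp u 2) (p : ℕ × ℕ) :
    MemLp (fun z : ℝ × ℝ × ℝ => u z.1 * hermiteProd p z.2) 2 :=
  memLp_mul_prod hu (isCompleteFamily_hermiteProd.1 p)

lemma memLp_hermiteCoeff (U : GH) (p : ℕ × ℕ) : MemLp (hermiteCoeff U p.1 p.2) 2 :=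
  memLp_integral_mul (Lp.memLp U) (isCompleteFamily_hermiteProd.1 p)

/-- The Hermite coefficient as an element of `L²(ℝ)`. -/
noncomputable def coeffLp (U : GH) (p : ℕ × ℕ) : Lp ℂ 2 (volume : Measure ℝ) :=
  (memLp_hermiteCoeff U p).toLp _

/-- The function `u(x) χ_m(q₊) χ_n(q₋)`. -/
noncomputable def tensorFun (p : ℕ × ℕ) (u : Lp ℂ 2 (volume : Measure ℝ)) : GH :=
  (memLp_tensor (Lp.memLp u) p).toLp _

lemma tensorFun_coe (p : ℕ × ℕ) (u : Lp ℂ 2 (volume : Measure ℝ)) :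
    tensorFun p u =ᵐ[volume] fun z : ℝ × ℝ × ℝ => u z.1 * hermiteProd p z.2 :=
  (memLp_tensor (Lp.memLp u) p).coeFn_toLp

/-- By Fubini, taking a Hermite coefficient is the adjoint of `u ↦ u(x) χ_m(q₊) χ_n(q₋)`. -/
lemma inner_tensorFun (p : ℕ × ℕ) (u : Lp ℂ 2 (volume : Measure ℝ)) (U : GH) :
    inner ℂ (tensorFun p u) U = inner ℂ u (coeffLp U p) := by
  have hi : Integrable (fun z : ℝ × ℝ × ℝ => U z * star (u z.1 * hermiteProd p z.2)) :=
    (Lp.memLp U).integrable_mul (memLp_tensor (Lp.memLp u) p).star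
  calc inner ℂ (tensorFun p u) U
      = ∫ z : ℝ × ℝ × ℝ, U z * star (u z.1 * hermiteProd p z.2) := by
        rw [L2.inner_def]
        refine integral_congr_ae ?_
        filter_upwards [tensorFun_coe p u] with z hz
        rw [hz, RCLike.inner_apply]
        rfl
    _ = ∫ x, ∫ q, U (x, q) * star (u x * hermiteProd p q) := by
        exact integral_prod (μ := volume) (ν := volume) _ hi
    _ = ∫ x, hermiteCoeff U p.1 p.2 x * star (u x) := by
        congr 1
        funext x
        rw [hermiteCoeff, ← integral_mul_const]
        congr 1
        funext q
        rw [star_mul', star_hermiteProd, hermiteProd]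
        ring
    _ = inner ℂ u (coeffLp U p) := by
        rw [L2.inner_def]
        refine integral_congr_ae ?_
        filter_upwards [(memLp_hermiteCoeff U p).coeFn_toLp] with x hx
        rw [coeffLp, hx, RCLike.inner_apply]
        rfl

lemma coeffLp_tensorFun (p p' : ℕ × ℕ) (u : Lp ℂ 2 (volume : Measure ℝ)) :
    coeffLp (tensorFun p u) p' = if p = p' then u else 0 := by
  have h : hermiteCoeff (tensorFun p u) p'.1 p'.2 =ᵐ[volume]
      fun x => if p = p' then u x else 0 := by
    have h1 : ∀ᵐ z ∂(volume : Measure ℝ).prod (volume : Measure (ℝ × ℝ)),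
        tensorFun p u z = u z.1 * hermiteProd p z.2 := tensorFun_coe p u
    filter_upwards [Measure.ae_ae_of_ae_prod h1] with x hx
    calc hermiteCoeff (tensorFun p u) p'.1 p'.2 x
        = ∫ q, u x * (hermiteProd p q * hermiteProd p' q) := by
          refine integral_congr_ae ?_
          filter_upwards [hx] with q hq
          rw [hq, hermiteProd, hermiteProd]
          ring
      _ = if p = p' then u x else 0 := by
          rw [integral_const_mul, integral_hermiteProd_mul]
          split_ifs <;> simp
  split_ifs with hp
  · simp only [hp, if_true] at h
    refine Lp.ext ?_
    exact ((memLp_hermiteCoeff _ p').coeFn_toLp).trans (hp ▸ h)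
  · simp only [hp, if_false] at h
    refine Lp.ext ?_
    exact (((memLp_hermiteCoeff _ p').coeFn_toLp).trans h).trans (Lp.coeFn_zero ℂ 2 volume).symm

/-- The isometric embedding `u ↦ u(x) χ_m(q₊) χ_n(q₋)` of `L²(ℝ)` into `L²(ℝ³)`. -/
noncomputable def tensorIsometry (p : ℕ × ℕ) : Lp ℂ 2 (volume : Measure ℝ) →ₗᵢ[ℂ] GH where
  toFun := tensorFun p
  map_add' u v := by
    refine Lp.ext ?_
    have h : ∀ᵐ z : ℝ × ℝ × ℝ, (u + v) z.1 = u z.1 + v z.1 := by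
      rw [Measure.volume_eq_prod]
      exact Measure.quasiMeasurePreserving_fst.ae (Lp.coeFn_add u v)
    filter_upwards [tensorFun_coe p (u + v), tensorFun_coe p u, tensorFun_coe p v,
      Lp.coeFn_add (tensorFun p u) (tensorFun p v), h] with z h1 h2 h3 h4 h5
    rw [h1, h4, Pi.add_apply, h2, h3, h5]
    ring
  map_smul' c u := by
    refine Lp.ext ?_
    have h : ∀ᵐ z : ℝ × ℝ × ℝ, (c • u) z.1 = c * u z.1 := by
      rw [Measure.volume_eq_prod]
      exact Measure.quasiMeasurePreserving_fst.ae (Lp.coeFn_smul c u)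
    filter_upwards [tensorFun_coe p (c • u), tensorFun_coe p u,
      Lp.coeFn_smul c (tensorFun p u), h] with z h1 h2 h3 h4
    rw [h1, RingHom.id_apply, h3, Pi.smul_apply, h2, h4, smul_eq_mul]
    ring
  norm_map' u := by
    have h := inner_tensorFun p u (tensorFun p u)
    rw [coeffLp_tensorFun, if_pos rfl, inner_self_eq_norm_sq_to_K, inner_self_eq_norm_sq_to_K] at h
    have h2 : ‖tensorFun p u‖ ^ 2 = ‖u‖ ^ 2 := by exact_mod_cast h
    exact (sq_eq_sq₀ (norm_nonneg _) (norm_nonneg _)).1 h2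

lemma coeffLp_eq_zero {U : GH} (h : ∀ p, coeffLp U p = 0) : U = 0 := by
  have h1 : (U : ℝ × ℝ × ℝ → ℂ) =ᵐ[volume] 0 := by
    refine ae_eq_zero_of_isCompleteFamily (μ := volume) isCompleteFamily_hermiteProd
      (Lp.memLp U) fun p => ?_
    have h2 := (memLp_hermiteCoeff U p).coeFn_toLp
    have h3 := Lp.coeFn_zero ℂ 2 (volume : Measure ℝ)
    rw [← h p] at h3
    exact h2.symm.trans h3
  exact (Lp.eq_zero_iff_ae_eq_zero).2 h1

lemma isHilbertSum_tensor :
    IsHilbertSum ℂ (fun _ : ℕ × ℕ => Lp ℂ 2 (volume : Measure ℝ)) tensorIsometry := by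
  refine IsHilbertSum.mk ?_ ?_
  · intro p p' hp u v
    change inner ℂ (tensorFun p u) (tensorFun p' v) = 0
    rw [inner_tensorFun, coeffLp_tensorFun, if_neg hp.symm, inner_zero_right]
  · rw [top_le_iff, Submodule.topologicalClosure_eq_top_iff, Submodule.eq_bot_iff]
    intro U hU
    refine coeffLp_eq_zero fun p => ?_
    have h1 : ∀ u, inner ℂ u (coeffLp U p) = 0 := by
      intro u
      rw [← inner_tensorFun]
      exact (Submodule.mem_orthogonal _ _).1 hU _
        (Submodule.mem_iSup_of_mem p ⟨u, rfl⟩)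
    exact inner_self_eq_zero.1 (h1 _)

/-- The Hermite expansion as an isometric isomorphism. -/
noncomputable def hermiteEquiv : GH ≃ₗᵢ[ℂ] lp (fun _ : ℕ × ℕ => Lp ℂ 2 (volume : Measure ℝ)) 2 :=
  isHilbertSum_tensor.linearIsometryEquiv

/-- Identifies the coordinates of the abstract Hilbert sum with the Hermite coefficients, so that
Parseval's identity becomes available for `coeffLp`. -/
lemma hermiteEquiv_apply (U : GH) (p : ℕ × ℕ) : hermiteEquiv U p = coeffLp U p := by
  classical
  refine ext_inner_left ℂ fun u => ?_
  rw [← inner_tensorFun]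
  have h1 : tensorFun p u = hermiteEquiv.symm (lp.single 2 p u) :=
    (isHilbertSum_tensor.linearIsometryEquiv_symm_apply_single u).symm
  rw [h1, ← LinearIsometryEquiv.inner_map_map hermiteEquiv, LinearIsometryEquiv.apply_symm_apply,
    lp.inner_single_left]

lemma coeffLp_ae_eq (U : GH) (p : ℕ × ℕ) : coeffLp U p =ᵐ[volume] hermiteCoeff U p.1 p.2 :=
  (memLp_hermiteCoeff U p).coeFn_toLp

lemma coeffLp_add (U V : GH) (p : ℕ × ℕ) : coeffLp (U + V) p = coeffLp U p + coeffLp V p := by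
  simp only [← hermiteEquiv_apply, map_add]
  rfl

lemma coeffLp_smul (c : ℂ) (U : GH) (p : ℕ × ℕ) : coeffLp (c • U) p = c • coeffLp U p := by
  simp only [← hermiteEquiv_apply, map_smul]
  rfl

lemma hasSum_inner_coeffLp (U V : GH) :
    HasSum (fun p => inner ℂ (coeffLp U p) (coeffLp V p)) (inner ℂ U V) := by
  have h := lp.hasSum_inner (𝕜 := ℂ) (hermiteEquiv U) (hermiteEquiv V)
  simp only [hermiteEquiv_apply, LinearIsometryEquiv.inner_map_map] at h
  exact h

lemma hasSum_norm_sq_coeffLp (U : GH) : HasSum (fun p => ‖coeffLp U p‖ ^ 2) (‖U‖ ^ 2) := by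
  have h := (hasSum_inner_coeffLp U U).mapL Complex.reCLM
  simp only [inner_self_eq_norm_sq_to_K] at h
  convert h using 1
  · funext p
    simp [← Complex.ofReal_pow]
  · simp [← Complex.ofReal_pow]

lemma norm_coeffLp_le (U : GH) (p : ℕ × ℕ) : ‖coeffLp U p‖ ≤ ‖U‖ := by
  have h := le_hasSum (hasSum_norm_sq_coeffLp U) p fun _ _ => by positivity
  exact le_of_sq_le_sq h (norm_nonneg _)

lemma exists_coeffLp_eq (u : ℕ × ℕ → Lp ℂ 2 (volume : Measure ℝ))
    (hu : Summable fun p => ‖u p‖ ^ 2) : ∃ U : GH, ∀ p, coeffLp U p = u p := by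
  have hm : Memℓp u 2 := by
    rw [memℓp_gen_iff (by norm_num)]
    simpa using hu
  refine ⟨hermiteEquiv.symm ⟨u, hm⟩, fun p => ?_⟩
  rw [← hermiteEquiv_apply, LinearIsometryEquiv.apply_symm_apply]

end HilbertSum

/-! ### Components and the energy space -/

section Comp

variable {U V : GH} {p : ℕ × ℕ} {u v w : ℝ → ℂ}

lemma memH1_of_contDiff {g : ℝ → ℝ} (hg : ContDiff ℝ 1 g) (hc : HasCompactSupport g) :
    MemH1 (fun x => (g x : ℂ)) := by
  have hd : Continuous (deriv g) := hg.continuous_deriv le_rfl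
  have h1 : IsPrimitiveOn univ (fun x => (g x : ℂ)) (fun x => ((deriv g x : ℝ) : ℂ)) :=
    IsPrimitiveOn.of_hasDerivAt
      (fun x _ => ((hg.differentiable (by norm_num)) x).hasDerivAt.ofReal_comp)
      (Complex.continuous_ofReal.comp hd).continuousOn
  exact MemH1.of_isPrimitiveOn h1 (hg.continuous.memLp_of_hasCompactSupport hc).ofReal
    (hd.memLp_of_hasCompactSupport hc.deriv).ofReal

lemma comp_ae_eq (U : GH) (m n : ℕ) : comp U m n =ᵐ[volume] hermiteCoeff U m n := by
  by_cases h : ∃ u : ℝ → ℂ, MemH1 u ∧ u =ᵐ[volume] hermiteCoeff U m n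
  · rw [comp, dif_pos h]
    exact h.choose_spec.2
  · rw [comp, dif_neg h]

lemma comp_ae_eq_coeffLp (U : GH) (p : ℕ × ℕ) : comp U p.1 p.2 =ᵐ[volume] coeffLp U p :=
  (comp_ae_eq U p.1 p.2).trans (coeffLp_ae_eq U p).symm

/-- The choice made in `comp` is immaterial: two `H¹` functions, being continuous, coincide as soon
as they agree almost everywhere. -/
lemma comp_eq_of_ae_eq (hu : MemH1 u) (h : u =ᵐ[volume] coeffLp U p) : comp U p.1 p.2 = u := by
  have h0 : ∃ u : ℝ → ℂ, MemH1 u ∧ u =ᵐ[volume] hermiteCoeff U p.1 p.2 :=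
    ⟨u, hu, h.trans (coeffLp_ae_eq U p)⟩
  have h1 : MemH1 (comp U p.1 p.2) := by
    rw [comp, dif_pos h0]
    exact h0.choose_spec.1
  exact h1.eq_of_ae_eq hu ((comp_ae_eq_coeffLp U p).trans h.symm)

lemma memLp_comp (U : GH) (p : ℕ × ℕ) : MemLp (comp U p.1 p.2) 2 :=
  (memLp_congr_ae (comp_ae_eq_coeffLp U p)).2 (Lp.memLp _)

lemma integral_norm_sq_comp (U : GH) (p : ℕ × ℕ) :
    ∫ x, ‖comp U p.1 p.2 x‖ ^ 2 = ‖coeffLp U p‖ ^ 2 := by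
  rw [← Lp.toLp_coeFn (coeffLp U p) (Lp.memLp _), norm_sq_toLp]
  refine integral_congr_ae ?_
  filter_upwards [comp_ae_eq_coeffLp U p] with x hx
  rw [hx]

lemma comp_add (hU : MemH1 (comp U p.1 p.2)) (hV : MemH1 (comp V p.1 p.2)) :
    comp (U + V) p.1 p.2 = fun x => comp U p.1 p.2 x + comp V p.1 p.2 x := by
  refine comp_eq_of_ae_eq (hU.add hV) ?_
  rw [coeffLp_add]
  filter_upwards [comp_ae_eq_coeffLp U p, comp_ae_eq_coeffLp V p,
    Lp.coeFn_add (coeffLp U p) (coeffLp V p)] with x h1 h2 h3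
  rw [h1, h2, h3, Pi.add_apply]

lemma comp_smul (c : ℂ) (hU : MemH1 (comp U p.1 p.2)) :
    comp (c • U) p.1 p.2 = fun x => c * comp U p.1 p.2 x := by
  refine comp_eq_of_ae_eq (hU.const_mul c) ?_
  rw [coeffLp_smul]
  filter_upwards [comp_ae_eq_coeffLp U p, Lp.coeFn_smul c (coeffLp U p)] with x h1 h2
  rw [h1, h2, Pi.smul_apply, smul_eq_mul]

lemma coeffLp_zero (p : ℕ × ℕ) : coeffLp 0 p = 0 := by
  simpa using coeffLp_smul 0 0 p

lemma comp_zero (m n : ℕ) : comp 0 m n = fun _ => 0 := by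
  refine comp_eq_of_ae_eq (p := (m, n)) memH1_zero ?_
  rw [coeffLp_zero]
  exact (Lp.coeFn_zero ℂ 2 volume).symm

open Classical in
lemma comp_tensorFun (p : ℕ × ℕ) (hv : MemH1 v) (m n : ℕ) :
    comp (tensorFun p (hv.memLp.toLp v)) m n = if p = (m, n) then v else fun _ => 0 := by
  have h := coeffLp_tensorFun p (m, n) (hv.memLp.toLp v)
  split_ifs with hp
  · refine comp_eq_of_ae_eq (p := (m, n)) hv ?_
    rw [h, if_pos hp]
    exact hv.memLp.coeFn_toLp.symm
  · refine comp_eq_of_ae_eq (p := (m, n)) memH1_zero ?_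
    rw [h, if_neg hp]
    exact (Lp.coeFn_zero ℂ 2 volume).symm

/-- The sesquilinear form of `-d²/dx² + r`. -/
noncomputable def lineForm (r : ℝ) (u v : ℝ → ℂ) : ℂ :=
  ∫ x, (deriv u x * star (deriv v x) + (r : ℂ) * (u x * star (v x)))

lemma integrable_lineForm (r : ℝ) (hu : MemH1 u) (hv : MemH1 v) :
    Integrable (fun x => deriv u x * star (deriv v x) + (r : ℂ) * (u x * star (v x))) :=
  (hu.memLp_deriv.integrable_mul_star hv.memLp_deriv).add
    ((hu.memLp.integrable_mul_star hv.memLp).const_mul _)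

lemma lineForm_add (r : ℝ) (hu : MemH1 u) (hw : MemH1 w) (hv : MemH1 v) :
    lineForm r (fun x => u x + w x) v = lineForm r u v + lineForm r w v := by
  rw [lineForm, lineForm, lineForm, ← integral_add (integrable_lineForm r hu hv)
    (integrable_lineForm r hw hv)]
  refine integral_congr_ae ?_
  filter_upwards [hu.deriv_add hw] with x hx
  rw [hx]
  ring

lemma lineForm_const_mul (r : ℝ) (c : ℂ) (u v : ℝ → ℂ) :
    lineForm r (fun x => c * u x) v = c * lineForm r u v := by
  rw [lineForm, lineForm, deriv_const_mul_fun, ← integral_const_mul]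
  congr 1
  funext x
  ring

lemma lineForm_star (r : ℝ) (u v : ℝ → ℂ) : star (lineForm r u v) = lineForm r v u := by
  rw [lineForm, lineForm, Complex.star_def, ← integral_conj]
  congr 1
  funext x
  simp only [map_add, map_mul, Complex.conj_conj, Complex.conj_ofReal]
  ring

lemma lineForm_zero_right (r : ℝ) (u : ℝ → ℂ) : lineForm r u (fun _ => 0) = 0 := by
  simp [lineForm]

lemma lineForm_self (r : ℝ) (u : ℝ → ℂ) :
    lineForm r u u = ((∫ x, (‖deriv u x‖ ^ 2 + r * ‖u x‖ ^ 2) : ℝ) : ℂ) := by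
  rw [lineForm, ← integral_complex_ofReal]
  congr 1
  funext x
  simp only [Complex.star_def, Complex.mul_conj, Complex.normSq_eq_norm_sq]
  push_cast
  ring

end Comp

section Energy

variable {νp νm : ℝ} {U V : GH}

lemma rCoef_nonneg (νp νm : ℝ) (m n : ℕ) : 0 ≤ rCoef νp νm m n := by
  rw [rCoef]; positivity

lemma lineForm_comp_self (U : GH) (p : ℕ × ℕ) :
    lineForm (rCoef νp νm p.1 p.2) (comp U p.1 p.2) (comp U p.1 p.2) = (aTerm νp νm U p : ℂ) :=
  lineForm_self _ _

lemma aTerm_nonneg (νp νm : ℝ) (U : GH) (p : ℕ × ℕ) : 0 ≤ aTerm νp νm U p :=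
  integral_nonneg fun x => by have := rCoef_nonneg νp νm p.1 p.2; positivity

lemma aTerm_smul (c : ℂ) {p : ℕ × ℕ} (hU : MemH1 (comp U p.1 p.2)) :
    aTerm νp νm (c • U) p = ‖c‖ ^ 2 * aTerm νp νm U p := by
  rw [aTerm, aTerm, comp_smul c hU, ← integral_const_mul, deriv_const_mul_fun]
  congr 1
  funext x
  rw [norm_mul, norm_mul]
  ring

lemma integrable_aTerm {p : ℕ × ℕ} (hU : MemH1 (comp U p.1 p.2)) :
    Integrable (fun x => ‖deriv (comp U p.1 p.2) x‖ ^ 2 +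
      rCoef νp νm p.1 p.2 * ‖comp U p.1 p.2 x‖ ^ 2) :=
  hU.integrable_norm_sq_deriv.add (hU.integrable_norm_sq.const_mul _)

lemma norm_add_sq_le_two (a b : ℂ) : ‖a + b‖ ^ 2 ≤ 2 * ‖a‖ ^ 2 + 2 * ‖b‖ ^ 2 := by
  have h := norm_add_le a b
  nlinarith [sq_nonneg (‖a‖ - ‖b‖), norm_nonneg (a + b), norm_nonneg a, norm_nonneg b]

lemma aTerm_add_le {p : ℕ × ℕ} (hU : MemH1 (comp U p.1 p.2)) (hV : MemH1 (comp V p.1 p.2)) :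
    aTerm νp νm (U + V) p ≤ 2 * aTerm νp νm U p + 2 * aTerm νp νm V p := by
  rw [aTerm, aTerm, aTerm, comp_add hU hV, ← integral_const_mul, ← integral_const_mul,
    ← integral_add ((integrable_aTerm hU).const_mul 2) ((integrable_aTerm hV).const_mul 2)]
  refine integral_mono_ae ?_ (((integrable_aTerm hU).const_mul 2).add
    ((integrable_aTerm hV).const_mul 2)) ?_
  · exact (hU.add hV).integrable_norm_sq_deriv.add ((hU.add hV).integrable_norm_sq.const_mul _)
  · filter_upwards [hU.deriv_add hV] with x hx
    simp only [hx]
    have h1 := norm_add_sq_le_two (deriv (comp U p.1 p.2) x) (deriv (comp V p.1 p.2) x)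
    have h2 := mul_le_mul_of_nonneg_left
      (norm_add_sq_le_two (comp U p.1 p.2 x) (comp V p.1 p.2 x)) (rCoef_nonneg νp νm p.1 p.2)
    linarith

/-- The energy space as a subspace of `L²(ℝ³)`. -/
noncomputable def energySubmodule (νp νm : ℝ) : Submodule ℂ GH where
  carrier := energySpace νp νm
  zero_mem' := by
    refine ⟨fun m n => by rw [comp_zero]; exact memH1_zero, ?_⟩
    have h : aTerm νp νm (0 : GH) = fun _ => 0 := by
      funext p
      simp [aTerm, comp_zero]
    rw [h]
    exact summable_zero
  add_mem' {U V} hU hV := by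
    refine ⟨fun m n => ?_, ?_⟩
    · rw [comp_add (p := (m, n)) (hU.1 m n) (hV.1 m n)]
      exact (hU.1 m n).add (hV.1 m n)
    · exact Summable.of_nonneg_of_le (aTerm_nonneg _ _ _)
        (fun p => aTerm_add_le (hU.1 p.1 p.2) (hV.1 p.1 p.2))
        ((hU.2.mul_left 2).add (hV.2.mul_left 2))
  smul_mem' c U hU := by
    refine ⟨fun m n => ?_, ?_⟩
    · rw [comp_smul (p := (m, n)) c (hU.1 m n)]
      exact (hU.1 m n).const_mul c
    · refine (hU.2.mul_left (‖c‖ ^ 2)).congr fun p => ?_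
      rw [aTerm_smul c (hU.1 p.1 p.2)]

lemma tensorFun_mem_energySpace (p : ℕ × ℕ) {v : ℝ → ℂ} (hv : MemH1 v) :
    tensorFun p (hv.memLp.toLp v) ∈ energySpace νp νm := by
  classical
  refine ⟨fun m n => ?_, ?_⟩
  · rw [comp_tensorFun p hv]
    split_ifs
    exacts [hv, memH1_zero]
  · refine summable_of_ne_finset_zero (s := {p}) fun p' hp' => ?_
    have h : p ≠ (p'.1, p'.2) := fun h => hp' (by simp [h])
    simp [aTerm, comp_tensorFun p hv, h]

lemma ae_eq_zero_of_memH1 {f : ℝ → ℂ} (hf : MemLp f 2 volume)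
    (h : ∀ v, MemH1 v → ∫ x, f x * star (v x) = 0) : f =ᵐ[volume] 0 := by
  refine ae_eq_zero_of_integral_contDiff_smul_eq_zero (hf.locallyIntegrable (by norm_num))
    fun g hg hc => ?_
  rw [← h _ (memH1_of_contDiff (hg.of_le (by exact_mod_cast le_top)) hc)]
  congr 1
  funext x
  simp [mul_comm]

lemma eq_zero_of_orthogonal_energySpace {F : GH}
    (h : ∀ V ∈ energySpace νp νm, inner ℂ V F = 0) : F = 0 := by
  refine coeffLp_eq_zero fun p => (Lp.eq_zero_iff_ae_eq_zero).2 ?_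
  refine ae_eq_zero_of_memH1 (Lp.memLp _) fun v hv => ?_
  rw [← inner_toLp hv.memLp (Lp.memLp _), Lp.toLp_coeFn, ← inner_tensorFun]
  exact h _ (tensorFun_mem_energySpace p hv)

lemma dense_energySpace (νp νm : ℝ) : Dense (energySpace νp νm) := by
  have h : (energySubmodule νp νm).topologicalClosure = ⊤ := by
    rw [Submodule.topologicalClosure_eq_top_iff, Submodule.eq_bot_iff]
    intro F hF
    exact eq_zero_of_orthogonal_energySpace fun V hV => (Submodule.mem_orthogonal _ _).1 hF V hV
  exact (Submodule.dense_iff_topologicalClosure_eq_top).2 h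

end Energy

/-! ### The quadratic forms on the energy space -/

section Mu

variable {ν α : ℝ}

/-- The quantity `α/(ν√2)` is `1/μ`; in this form the case `α = 0`, `μ = ∞` needs no separate
treatment later. -/
lemma le_of_one_le_mu (hν : 0 < ν) (hα : 0 ≤ α) (h : 1 ≤ mu ν α) : α / (ν * √2) ≤ 1 := by
  rcases hα.eq_or_lt with rfl | hα
  · simp
  · rw [mu, ← ENNReal.ofReal_div_of_pos hα, ENNReal.one_le_ofReal, one_le_div hα] at h
    exact (div_le_one (by positivity)).2 h

lemma lt_of_one_lt_mu (hν : 0 < ν) (hα : 0 ≤ α) (h : 1 < mu ν α) : α / (ν * √2) < 1 := by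
  rcases hα.eq_or_lt with rfl | hα
  · simp
  · rw [mu, ← ENNReal.ofReal_div_of_pos hα, ENNReal.one_lt_ofReal, one_lt_div hα] at h
    exact (div_lt_one (by positivity)).2 h

end Mu

/-! ### Weighted sums of products of neighbouring terms -/

section Neighbour

/-- Concavity of the square root at the midpoint of `k` and `k + 1`. It matches the `1/2` in
`r_{m,n}`, which is why the threshold is exactly `μ = 1`. -/
lemma sqrt_add_sqrt_succ_le (k : ℕ) : √(k : ℝ) + √((k : ℝ) + 1) ≤ 2 * √((k : ℝ) + 1 / 2) := by
  have hk : (0 : ℝ) ≤ k := k.cast_nonneg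
  have h1 := Real.sq_sqrt hk
  have h2 := Real.sq_sqrt (show (0 : ℝ) ≤ (k : ℝ) + 1 by linarith)
  have h3 := Real.sq_sqrt (show (0 : ℝ) ≤ (k : ℝ) + 1 / 2 by linarith)
  have h4 := sq_nonneg (√(k : ℝ) - √((k : ℝ) + 1))
  refine abs_le_of_sq_le_sq' ?_ (by positivity) |>.2
  nlinarith

variable {ι : Type*} {k : ι → ℕ} {pred succ : ι → ι} {c y : ι → ℝ} {ν : ℝ}

/-- The weighted products of neighbouring values are dominated by the sum of squares. -/
lemma summable_neighbour (hν : 0 < ν) (hs : Function.Injective succ)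
    (hk : ∀ p, k (succ p) = k p + 1) (hps : ∀ p, pred (succ p) = p)
    (hr : ∀ p, k p ≠ 0 → p ∈ range succ) (hc : ∀ p, ν * √((k p : ℝ) + 1 / 2) ≤ c p)
    (hy : ∀ p, 0 ≤ y p) (h : Summable fun p => c p * y p ^ 2) :
    Summable (fun p => √(2 * (k p : ℝ)) * y p * y (pred p)) ∧
      ∑' p, √(2 * (k p : ℝ)) * y p * y (pred p) ≤ √2 / ν * ∑' p, c p * y p ^ 2 := by
  have hb : ∀ p, (√2 / 2) * ((√(k p : ℝ) + √((k p : ℝ) + 1)) * y p ^ 2) ≤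
      √2 / ν * (c p * y p ^ 2) := by
    intro p
    have h1 : √(k p : ℝ) + √((k p : ℝ) + 1) ≤ 2 / ν * c p := by
      refine (sqrt_add_sqrt_succ_le _).trans ?_
      rw [div_mul_eq_mul_div, le_div_iff₀ hν]
      linarith [hc p]
    calc (√2 / 2) * ((√(k p : ℝ) + √((k p : ℝ) + 1)) * y p ^ 2)
        ≤ (√2 / 2) * ((2 / ν * c p) * y p ^ 2) := by gcongr
      _ = √2 / ν * (c p * y p ^ 2) := by ring
  have h0 := (h.mul_left (√2 / ν))
  have h1 : Summable fun p => (√2 / 2) * (√(k p : ℝ) * y p ^ 2) :=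
    Summable.of_nonneg_of_le (fun p => by positivity) (fun p => (hb p).trans' (by
      gcongr; linarith [Real.sqrt_nonneg ((k p : ℝ) + 1)])) h0
  have h2 : Summable fun p => (√2 / 2) * (√((k p : ℝ) + 1) * y p ^ 2) :=
    Summable.of_nonneg_of_le (fun p => by positivity) (fun p => (hb p).trans' (by
      gcongr; linarith [Real.sqrt_nonneg (k p : ℝ)])) h0
  -- Reindexing by `succ` turns `√k y(pred)²` into `√(k+1) y²`. Indices outside the range of `succ`
  -- have `k = 0` and contribute nothing, whatever `pred` is there.
  have h3 : HasSum (fun p => (√2 / 2) * (√(k p : ℝ) * y (pred p) ^ 2))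
      (∑' p, (√2 / 2) * (√((k p : ℝ) + 1) * y p ^ 2)) := by
    rw [← hs.hasSum_iff]
    · convert h2.hasSum using 1
      funext p
      simp [hk, hps]
    · intro p hp
      have : k p = 0 := by
        by_contra hne
        exact hp (hr p hne)
      simp [this]
  have hle : ∀ p, √(2 * (k p : ℝ)) * y p * y (pred p) ≤
      (√2 / 2) * (√(k p : ℝ) * y p ^ 2) + (√2 / 2) * (√(k p : ℝ) * y (pred p) ^ 2) := by
    intro p
    rw [Real.sqrt_mul (by norm_num)]
    have := mul_nonneg (mul_nonneg (Real.sqrt_nonneg 2) (Real.sqrt_nonneg (k p : ℝ)))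
      (sq_nonneg (y p - y (pred p)))
    nlinarith
  have hS := h1.add h3.summable
  have hS' : Summable (fun p => √(2 * (k p : ℝ)) * y p * y (pred p)) :=
    Summable.of_nonneg_of_le
      (fun p => mul_nonneg (mul_nonneg (Real.sqrt_nonneg _) (hy _)) (hy _)) hle hS
  refine ⟨hS', ?_⟩
  calc ∑' p, √(2 * (k p : ℝ)) * y p * y (pred p)
      ≤ ∑' p, ((√2 / 2) * (√(k p : ℝ) * y p ^ 2) + (√2 / 2) * (√(k p : ℝ) * y (pred p) ^ 2)) :=
        hS'.tsum_le_tsum hle hS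
    _ = ∑' p, ((√2 / 2) * (√(k p : ℝ) * y p ^ 2) + (√2 / 2) * (√((k p : ℝ) + 1) * y p ^ 2)) := by
        rw [h1.tsum_add h3.summable, h3.tsum_eq, h1.tsum_add h2]
    _ ≤ ∑' p, √2 / ν * (c p * y p ^ 2) := by
        refine (h1.add h2).tsum_le_tsum (fun p => ?_) h0
        rw [← mul_add, ← add_mul]
        exact hb p
    _ = √2 / ν * ∑' p, c p * y p ^ 2 := tsum_mul_left

end Neighbour

section Forms

variable {νp νm αp αm θ : ℝ} {U V W : GH}

lemma mul_sqrt_le_sqrt_rCoef_left (hνp : 0 < νp) (p : ℕ × ℕ) :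
    νp * √((p.1 : ℝ) + 1 / 2) ≤ √(rCoef νp νm p.1 p.2) := by
  rw [← Real.sqrt_sq hνp.le, ← Real.sqrt_mul (sq_nonneg _), Real.sqrt_sq hνp.le]
  refine Real.sqrt_le_sqrt ?_
  rw [rCoef]
  have : 0 ≤ νm ^ 2 * ((p.2 : ℝ) + 1 / 2) := by positivity
  linarith

lemma mul_sqrt_le_sqrt_rCoef_right (hνm : 0 < νm) (p : ℕ × ℕ) :
    νm * √((p.2 : ℝ) + 1 / 2) ≤ √(rCoef νp νm p.1 p.2) := by
  rw [← Real.sqrt_sq hνm.le, ← Real.sqrt_mul (sq_nonneg _), Real.sqrt_sq hνm.le]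
  refine Real.sqrt_le_sqrt ?_
  rw [rCoef]
  have : 0 ≤ νp ^ 2 * ((p.1 : ℝ) + 1 / 2) := by positivity
  linarith

lemma aTerm_trace {p : ℕ × ℕ} (hU : MemH1 (comp U p.1 p.2)) :
    2 * (√(rCoef νp νm p.1 p.2) * ‖comp U p.1 p.2 1‖ ^ 2) +
      2 * (√(rCoef νp νm p.1 p.2) * ‖comp U p.1 p.2 (-1)‖ ^ 2) ≤
      aTerm νp νm U p + ‖coeffLp U p‖ ^ 2 := by
  have h := hU.trace (rCoef_nonneg νp νm p.1 p.2)
  rw [integral_norm_sq_comp] at h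
  rw [aTerm]
  linarith

lemma summable_trace_left (hU : U ∈ energySpace νp νm) :
    Summable fun p : ℕ × ℕ => √(rCoef νp νm p.1 p.2) * ‖comp U p.1 p.2 1‖ ^ 2 :=
  Summable.of_nonneg_of_le (fun p => by positivity) (fun p => by
    have h := aTerm_trace (νp := νp) (νm := νm) (hU.1 p.1 p.2)
    have h1 : 0 ≤ √(rCoef νp νm p.1 p.2) * ‖comp U p.1 p.2 (-1)‖ ^ 2 := by positivity
    have h2 : 0 ≤ √(rCoef νp νm p.1 p.2) * ‖comp U p.1 p.2 1‖ ^ 2 := by positivity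
    linarith) (hU.2.add (hasSum_norm_sq_coeffLp U).summable)

lemma summable_trace_right (hU : U ∈ energySpace νp νm) :
    Summable fun p : ℕ × ℕ => √(rCoef νp νm p.1 p.2) * ‖comp U p.1 p.2 (-1)‖ ^ 2 :=
  Summable.of_nonneg_of_le (fun p => by positivity) (fun p => by
    have h := aTerm_trace (νp := νp) (νm := νm) (hU.1 p.1 p.2)
    have h1 : 0 ≤ √(rCoef νp νm p.1 p.2) * ‖comp U p.1 p.2 (-1)‖ ^ 2 := by positivity
    have h2 : 0 ≤ √(rCoef νp νm p.1 p.2) * ‖comp U p.1 p.2 1‖ ^ 2 := by positivity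
    linarith) (hU.2.add (hasSum_norm_sq_coeffLp U).summable)

lemma norm_bPlusTerm (U : GH) (p : ℕ × ℕ) : ‖bPlusTerm U p‖ =
    √(2 * (p.1 : ℝ)) * ‖comp U p.1 p.2 1‖ * ‖comp U (p.1 - 1) p.2 1‖ := by
  rw [bPlusTerm, norm_mul, norm_mul, norm_star, Complex.norm_real,
    Real.norm_of_nonneg (Real.sqrt_nonneg _)]

lemma norm_bMinusTerm (U : GH) (p : ℕ × ℕ) : ‖bMinusTerm U p‖ =
    √(2 * (p.2 : ℝ)) * ‖comp U p.1 p.2 (-1)‖ * ‖comp U p.1 (p.2 - 1) (-1)‖ := by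
  rw [bMinusTerm, norm_mul, norm_mul, norm_star, Complex.norm_real,
    Real.norm_of_nonneg (Real.sqrt_nonneg _)]

lemma summable_norm_bPlusTerm (hνp : 0 < νp) (hU : U ∈ energySpace νp νm) :
    Summable (fun p => ‖bPlusTerm U p‖) ∧ ∑' p, ‖bPlusTerm U p‖ ≤
      √2 / νp * ∑' p : ℕ × ℕ, √(rCoef νp νm p.1 p.2) * ‖comp U p.1 p.2 1‖ ^ 2 := by
  simp only [norm_bPlusTerm]
  exact summable_neighbour (k := Prod.fst) (pred := fun p => (p.1 - 1, p.2))
    (succ := fun p => (p.1 + 1, p.2)) (y := fun p : ℕ × ℕ => ‖comp U p.1 p.2 1‖)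
    hνp (fun p q h => by simpa [Prod.ext_iff] using h)
    (fun _ => rfl) (fun p => by simp)
    (fun p hp => ⟨(p.1 - 1, p.2), by simp [Nat.sub_add_cancel (Nat.one_le_iff_ne_zero.2 hp)]⟩)
    (mul_sqrt_le_sqrt_rCoef_left hνp) (fun p => norm_nonneg _) (summable_trace_left hU)

lemma summable_norm_bMinusTerm (hνm : 0 < νm) (hU : U ∈ energySpace νp νm) :
    Summable (fun p => ‖bMinusTerm U p‖) ∧ ∑' p, ‖bMinusTerm U p‖ ≤
      √2 / νm * ∑' p : ℕ × ℕ, √(rCoef νp νm p.1 p.2) * ‖comp U p.1 p.2 (-1)‖ ^ 2 := by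
  simp only [norm_bMinusTerm]
  exact summable_neighbour (k := Prod.snd) (pred := fun p => (p.1, p.2 - 1))
    (succ := fun p => (p.1, p.2 + 1)) (y := fun p : ℕ × ℕ => ‖comp U p.1 p.2 (-1)‖)
    hνm (fun p q h => by simpa [Prod.ext_iff] using h)
    (fun _ => rfl) (fun p => by simp)
    (fun p hp => ⟨(p.1, p.2 - 1), by simp [Nat.sub_add_cancel (Nat.one_le_iff_ne_zero.2 hp)]⟩)
    (mul_sqrt_le_sqrt_rCoef_right hνm) (fun p => norm_nonneg _) (summable_trace_right hU)

lemma formA_nonneg (νp νm : ℝ) (U : GH) : 0 ≤ formA νp νm U :=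
  tsum_nonneg fun _ => aTerm_nonneg _ _ _ _

/-- The identity `α √2/ν = 2 α/(ν√2)` produces the factor `2` that stands in the trace inequality.
-/
lemma mul_formB_le {α ν θ S : ℝ} (hν : 0 < ν) (hα : 0 ≤ α) (hθ : α / (ν * √2) ≤ θ)
    {b : ℕ × ℕ → ℂ} (hb : Summable fun p => ‖b p‖) (hS : 0 ≤ S) (h : ∑' p, ‖b p‖ ≤ √2 / ν * S) :
    |α * (∑' p, b p).re| ≤ θ * (2 * S) := by
  rw [abs_mul, abs_of_nonneg hα]
  calc α * |(∑' p, b p).re| ≤ α * (√2 / ν * S) := by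
        gcongr
        exact (Complex.abs_re_le_norm _).trans ((norm_tsum_le_tsum_norm hb).trans h)
    _ = α / (ν * √2) * (2 * S) := by
        have h2 : √2 * √2 = 2 := Real.mul_self_sqrt (by norm_num)
        field_simp
        linear_combination α * S * h2
    _ ≤ θ * (2 * S) := by gcongr

/-- The perturbation of the form `a` is form bounded. -/
lemma abs_form_sub_formA_le (hνp : 0 < νp) (hνm : 0 < νm) (hαp : 0 ≤ αp) (hαm : 0 ≤ αm)
    (hθp : αp / (νp * √2) ≤ θ) (hθm : αm / (νm * √2) ≤ θ) (hU : U ∈ energySpace νp νm) :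
    |form νp νm αp αm U - formA νp νm U| ≤ θ * (formA νp νm U + ‖U‖ ^ 2) := by
  have hθ : 0 ≤ θ := le_trans (by positivity) hθp
  have h1 := summable_norm_bPlusTerm hνp hU
  have h2 := summable_norm_bMinusTerm hνm hU
  have s1 := summable_trace_left hU
  have s2 := summable_trace_right hU
  have b1 := mul_formB_le hνp hαp hθp h1.1 (tsum_nonneg fun p => by positivity) h1.2
  have b2 := mul_formB_le hνm hαm hθm h2.1 (tsum_nonneg fun p => by positivity) h2.2
  -- Both traces are bounded jointly by one copy of `a[U] + ‖U‖²`. Separate global bounds obtained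
  -- by dropping one trace would use this copy twice and lose a factor `2` in `θ`.
  have h3 : 2 * (∑' p : ℕ × ℕ, √(rCoef νp νm p.1 p.2) * ‖comp U p.1 p.2 1‖ ^ 2) +
      2 * (∑' p : ℕ × ℕ, √(rCoef νp νm p.1 p.2) * ‖comp U p.1 p.2 (-1)‖ ^ 2) ≤
      formA νp νm U + ‖U‖ ^ 2 := by
    rw [formA, ← (hasSum_norm_sq_coeffLp U).tsum_eq,
      ← hU.2.tsum_add (hasSum_norm_sq_coeffLp U).summable, ← tsum_mul_left, ← tsum_mul_left,
      ← (s1.mul_left 2).tsum_add (s2.mul_left 2)]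
    exact ((s1.mul_left 2).add (s2.mul_left 2)).tsum_le_tsum
      (fun p => aTerm_trace (hU.1 p.1 p.2)) (hU.2.add (hasSum_norm_sq_coeffLp U).summable)
  calc |form νp νm αp αm U - formA νp νm U| = |αp * formBPlus U + αm * formBMinus U| := by
        rw [form]; congr 1; ring
    _ ≤ _ := (abs_add_le _ _).trans (add_le_add b1 b2)
    _ ≤ θ * (formA νp νm U + ‖U‖ ^ 2) := by rw [← mul_add]; gcongr

lemma neg_norm_sq_le_form (hνp : 0 < νp) (hνm : 0 < νm) (hαp : 0 ≤ αp) (hαm : 0 ≤ αm)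
    (hθp : αp / (νp * √2) ≤ 1) (hθm : αm / (νm * √2) ≤ 1) (hU : U ∈ energySpace νp νm) :
    -1 * ‖U‖ ^ 2 ≤ form νp νm αp αm U := by
  have h := abs_le.1 (abs_form_sub_formA_le hνp hνm hαp hαm hθp hθm hU)
  linarith [h.1]

end Forms

/-! ### Hermitian forms and polarization -/

section Polar

variable {H : Type*} [NormedAddCommGroup H] [InnerProductSpace ℂ H]

/-- `B` is a Hermitian sesquilinear form on the subspace `d`. -/
structure IsHermitianOn (d : Submodule ℂ H) (B : H → H → ℂ) : Prop where
  add_left : ∀ U ∈ d, ∀ W ∈ d, ∀ V ∈ d, B (U + W) V = B U V + B W V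
  smul_left : ∀ c : ℂ, ∀ U ∈ d, ∀ V ∈ d, B (c • U) V = c * B U V
  star_symm : ∀ U ∈ d, ∀ V ∈ d, star (B U V) = B V U

namespace IsHermitianOn

variable {d : Submodule ℂ H} {B : H → H → ℂ} {U V W : H}

lemma add_right (h : IsHermitianOn d B) (hU : U ∈ d) (hV : V ∈ d) (hW : W ∈ d) :
    B U (V + W) = B U V + B U W := by
  rw [← h.star_symm _ (d.add_mem hV hW) _ hU, h.add_left _ hV _ hW _ hU, star_add,
    h.star_symm _ hV _ hU, h.star_symm _ hW _ hU]

lemma smul_right (h : IsHermitianOn d B) (c : ℂ) (hU : U ∈ d) (hV : V ∈ d) :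
    B U (c • V) = star c * B U V := by
  rw [← h.star_symm _ (d.smul_mem c hV) _ hU, h.smul_left _ _ hV _ hU, star_mul',
    h.star_symm _ hV _ hU]

lemma im_self (h : IsHermitianOn d B) (hU : U ∈ d) : (B U U).im = 0 :=
  Complex.conj_eq_iff_im.1 (h.star_symm U hU U hU)

lemma ofReal_re_self (h : IsHermitianOn d B) (hU : U ∈ d) : ((B U U).re : ℂ) = B U U :=
  Complex.ext rfl (h.im_self hU).symm

/-- The polarization identity. -/
lemma polarForm_eq (h : IsHermitianOn d B) {q : H → ℝ} (hq : ∀ U ∈ d, q U = (B U U).re)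
    (hU : U ∈ d) (hV : V ∈ d) : polarForm q U V = B U V := by
  have e : ∀ c : ℂ, ((q (U + c • V) : ℝ) : ℂ) =
      B U U + c * B V U + star c * B U V + c * star c * B V V := by
    intro c
    have hcV := d.smul_mem c hV
    rw [hq _ (d.add_mem hU hcV), h.ofReal_re_self (d.add_mem hU hcV),
      h.add_left _ hU _ hcV _ (d.add_mem hU hcV), h.add_right hU hU hcV,
      h.add_right hcV hU hcV, h.smul_left _ _ hV _ hU, h.smul_left _ _ hV _ hcV,
      h.smul_right _ hU hV, h.smul_right _ hV hV]
    ring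
  have e1 := e 1
  have e2 := e (-1)
  have e3 := e Complex.I
  have e4 := e (-Complex.I)
  rw [one_smul] at e1
  rw [neg_one_smul, ← sub_eq_add_neg] at e2
  rw [neg_smul, ← sub_eq_add_neg] at e4
  rw [polarForm, e1, e2, e3, e4]
  simp only [star_one, star_neg, Complex.star_def, Complex.conj_I]
  linear_combination (-1 / 2 * B V U + 1 / 2 * B U V) * -Complex.I_sq

end IsHermitianOn

lemma hasSum_polarForm {ι : Type*} {q : ι → H → ℝ} {Q : H → ℝ} {d : Submodule ℂ H}
    (h : ∀ U ∈ d, HasSum (fun i => q i U) (Q U)) {U V : H} (hU : U ∈ d) (hV : V ∈ d) :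
    HasSum (fun i => polarForm (q i) U V) (polarForm Q U V) := by
  have key : ∀ W ∈ d, HasSum (fun i => ((q i W : ℝ) : ℂ)) ((Q W : ℝ) : ℂ) := fun W hW =>
    Complex.hasSum_ofReal.2 (h W hW)
  have hI := d.smul_mem Complex.I hV
  exact (((key _ (d.add_mem hU hV)).sub (key _ (d.sub_mem hU hV))).add
    ((key _ (d.add_mem hU hI)).mul_left Complex.I)).sub
    ((key _ (d.sub_mem hU hI)).mul_left Complex.I) |>.div_const 4

/-- A sum of Hermitian forms is Hermitian. -/
lemma isHermitianOn_polarForm {ι : Type*} {B : ι → H → H → ℂ} {Q : H → ℝ} {d : Submodule ℂ H}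
    (hB : ∀ i, IsHermitianOn d (B i)) (h : ∀ U ∈ d, HasSum (fun i => (B i U U).re) (Q U)) :
    (∀ U ∈ d, ∀ V ∈ d, HasSum (fun i => B i U V) (polarForm Q U V)) ∧
      IsHermitianOn d (polarForm Q) ∧ ∀ U ∈ d, polarForm Q U U = (Q U : ℂ) := by
  -- Polarization is a finite linear combination of values of the quadratic form, hence commutes
  -- with the sum. Sesquilinearity of the total is then inherited from the terms.
  have key : ∀ U ∈ d, ∀ V ∈ d, HasSum (fun i => B i U V) (polarForm Q U V) := by
    intro U hU V hV
    convert hasSum_polarForm (q := fun i U => (B i U U).re) h hU hV using 1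
    funext i
    exact ((hB i).polarForm_eq (fun _ _ => rfl) hU hV).symm
  refine ⟨key, ⟨fun U hU W hW V hV => ?_, fun c U hU V hV => ?_, fun U hU V hV => ?_⟩,
    fun U hU => ?_⟩
  · refine (key _ (d.add_mem hU hW) _ hV).unique ?_
    simp only [(hB _).add_left _ hU _ hW _ hV]
    exact (key _ hU _ hV).add (key _ hW _ hV)
  · refine (key _ (d.smul_mem c hU) _ hV).unique ?_
    simp only [(hB _).smul_left _ _ hU _ hV]
    exact (key _ hU _ hV).mul_left c
  · refine HasSum.unique (f := fun i => star (B i U V)) (key _ hU _ hV).star ?_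
    simp only [(hB _).star_symm _ hU _ hV]
    exact key _ hV _ hU
  · refine (key _ hU _ hU).unique ?_
    simpa only [(hB _).ofReal_re_self hU] using Complex.hasSum_ofReal.2 (h U hU)

end Polar

/-! ### The sesquilinear form of `a_{α,ν}` -/

section Sesq

variable {νp νm αp αm θ : ℝ} {U V W : GH}

/-- The sesquilinear form of the contribution of a single component to `a_{α,ν}`. -/
noncomputable def sesqTerm (νp νm αp αm : ℝ) (p : ℕ × ℕ) (U V : GH) : ℂ :=
  lineForm (rCoef νp νm p.1 p.2) (comp U p.1 p.2) (comp V p.1 p.2)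
    + ((αp / 2 * √(2 * (p.1 : ℝ)) : ℝ) : ℂ) * (comp U p.1 p.2 1 * star (comp V (p.1 - 1) p.2 1)
      + comp U (p.1 - 1) p.2 1 * star (comp V p.1 p.2 1))
    + ((αm / 2 * √(2 * (p.2 : ℝ)) : ℝ) : ℂ) *
      (comp U p.1 p.2 (-1) * star (comp V p.1 (p.2 - 1) (-1))
      + comp U p.1 (p.2 - 1) (-1) * star (comp V p.1 p.2 (-1)))

lemma isHermitianOn_sesqTerm (p : ℕ × ℕ) :
    IsHermitianOn (energySubmodule νp νm) (sesqTerm νp νm αp αm p) := by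
  refine ⟨fun U hU W hW V hV => ?_, fun c U hU V hV => ?_, fun U hU V hV => ?_⟩
  · have e : ∀ m n, comp (U + W) m n = fun x => comp U m n x + comp W m n x :=
      fun m n => comp_add (p := (m, n)) (hU.1 m n) (hW.1 m n)
    simp only [sesqTerm, e]
    rw [lineForm_add _ (hU.1 _ _) (hW.1 _ _) (hV.1 _ _)]
    ring
  · have e : ∀ m n, comp (c • U) m n = fun x => c * comp U m n x :=
      fun m n => comp_smul (p := (m, n)) c (hU.1 m n)
    simp only [sesqTerm, e]
    rw [lineForm_const_mul]
    ring
  · simp only [sesqTerm, star_add, star_mul', lineForm_star, star_star]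
    simp only [Complex.star_def, Complex.conj_ofReal]
    ring

lemma re_sesqTerm_self (p : ℕ × ℕ) (U : GH) : (sesqTerm νp νm αp αm p U U).re =
    aTerm νp νm U p + αp * (bPlusTerm U p).re + αm * (bMinusTerm U p).re := by
  have key : ∀ z w : ℂ, (z * star w + w * star z).re = 2 * (z * star w).re := by
    intro z w
    simp only [Complex.star_def, Complex.add_re, Complex.mul_re, Complex.conj_re, Complex.conj_im]
    ring
  rw [sesqTerm, lineForm_comp_self, bPlusTerm, bMinusTerm, Complex.add_re, Complex.add_re,
    Complex.re_ofReal_mul, Complex.re_ofReal_mul, key, key, mul_assoc (Complex.ofReal _),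
    mul_assoc (Complex.ofReal _), Complex.re_ofReal_mul, Complex.re_ofReal_mul, Complex.ofReal_re]
  ring

lemma hasSum_re_sesqTerm (hνp : 0 < νp) (hνm : 0 < νm) (hU : U ∈ energySpace νp νm) :
    HasSum (fun p => (sesqTerm νp νm αp αm p U U).re) (form νp νm αp αm U) := by
  simp only [re_sesqTerm_self]
  exact (hU.2.hasSum.add ((Complex.reCLM.hasSum
    (summable_norm_bPlusTerm hνp hU).1.of_norm.hasSum).mul_left αp)).add
    ((Complex.reCLM.hasSum (summable_norm_bMinusTerm hνm hU).1.of_norm.hasSum).mul_left αm)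

lemma polarForm_form (hνp : 0 < νp) (hνm : 0 < νm) (αp αm : ℝ) :
    (∀ U ∈ energySubmodule νp νm, ∀ V ∈ energySubmodule νp νm,
      HasSum (fun p => sesqTerm νp νm αp αm p U V) (polarForm (form νp νm αp αm) U V)) ∧
    IsHermitianOn (energySubmodule νp νm) (polarForm (form νp νm αp αm)) ∧
    ∀ U ∈ energySubmodule νp νm,
      polarForm (form νp νm αp αm) U U = (form νp νm αp αm U : ℂ) :=
  isHermitianOn_polarForm (fun p => isHermitianOn_sesqTerm p)
    fun _ hU => hasSum_re_sesqTerm hνp hνm hU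

/-- The coefficient of the jump of the derivative at `1`. -/
noncomputable def jumpPlus (αp : ℝ) (U : GH) (m n : ℕ) : ℂ :=
  ((αp / √2 : ℝ) : ℂ) * (((√((m : ℝ) + 1) : ℝ) : ℂ) * comp U (m + 1) n 1
    + ((√(m : ℝ) : ℝ) : ℂ) * comp U (m - 1) n 1)

/-- The coefficient of the jump of the derivative at `-1`. -/
noncomputable def jumpMinus (αm : ℝ) (U : GH) (m n : ℕ) : ℂ :=
  ((αm / √2 : ℝ) : ℂ) * (((√((n : ℝ) + 1) : ℝ) : ℂ) * comp U m (n + 1) (-1)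
    + ((√(n : ℝ) : ℝ) : ℂ) * comp U m (n - 1) (-1))

lemma half_mul_sqrt_two_mul (α x : ℝ) : α / 2 * √(2 * x) = α / √2 * √x := by
  rw [Real.sqrt_mul (by norm_num)]
  have h2 : √2 * √2 = 2 := Real.mul_self_sqrt (by norm_num)
  field_simp
  linear_combination α * √x * h2

/-- The sesquilinear form on a vector with a single nonzero component. -/
lemma polarForm_form_tensorFun (hνp : 0 < νp) (hνm : 0 < νm) (hU : U ∈ energySpace νp νm)
    (p : ℕ × ℕ) {v : ℝ → ℂ} (hv : MemH1 v) :
    polarForm (form νp νm αp αm) U (tensorFun p (hv.memLp.toLp v)) =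
      lineForm (rCoef νp νm p.1 p.2) (comp U p.1 p.2) v
        + jumpPlus αp U p.1 p.2 * star (v 1) + jumpMinus αm U p.1 p.2 * star (v (-1)) := by
  classical
  obtain ⟨m, n⟩ := p
  have hs := (polarForm_form hνp hνm αp αm).1 U hU _ (tensorFun_mem_energySpace (m, n) hv)
  have n1 : ((m, n) : ℕ × ℕ) ∉ ({(m + 1, n), (m, n + 1)} : Finset (ℕ × ℕ)) := by simp
  have n2 : ((m + 1, n) : ℕ × ℕ) ∉ ({(m, n + 1)} : Finset (ℕ × ℕ)) := by simp
  -- The term of index `p` couples `p` with its lower neighbours only, so component `(m, n)` enters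
  -- its own term and those of its two upper neighbours. Where the truncated subtraction returns `0
  -- - 1 = 0`, the factor `√0` removes the spurious coupling.
  have hz : ∀ p' ∉ ({(m, n), (m + 1, n), (m, n + 1)} : Finset (ℕ × ℕ)),
      sesqTerm νp νm αp αm p' U (tensorFun (m, n) (hv.memLp.toLp v)) = 0 := by
    rintro ⟨m', n'⟩ hp
    simp only [Finset.mem_insert, Finset.mem_singleton, not_or, Prod.mk.injEq] at hp
    have h1 : ¬((m, n) : ℕ × ℕ) = (m', n') := by
      rw [Prod.mk.injEq]; omega
    have h2 : ((√(2 * (m' : ℝ)) : ℝ) : ℂ) *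
        star (comp (tensorFun (m, n) (hv.memLp.toLp v)) (m' - 1) n' 1) = 0 := by
      rcases Nat.eq_zero_or_pos m' with rfl | hm
      · simp
      · have : ¬((m, n) : ℕ × ℕ) = (m' - 1, n') := by rw [Prod.mk.injEq]; omega
        rw [comp_tensorFun _ hv, if_neg this, star_zero, mul_zero]
    have h3 : ((√(2 * (n' : ℝ)) : ℝ) : ℂ) *
        star (comp (tensorFun (m, n) (hv.memLp.toLp v)) m' (n' - 1) (-1)) = 0 := by
      rcases Nat.eq_zero_or_pos n' with rfl | hm
      · simp
      · have : ¬((m, n) : ℕ × ℕ) = (m', n' - 1) := by rw [Prod.mk.injEq]; omega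
        rw [comp_tensorFun _ hv, if_neg this, star_zero, mul_zero]
    simp only [sesqTerm]
    rw [comp_tensorFun _ hv m' n', if_neg h1, lineForm_zero_right]
    push_cast at h2 h3 ⊢
    simp only [star_zero, mul_zero, add_zero, zero_add]
    linear_combination (αp / 2 : ℂ) * comp U m' n' 1 * h2 + (αm / 2 : ℂ) * comp U m' n' (-1) * h3
  rw [← (hasSum_sum_of_ne_finset_zero hz).unique hs, Finset.sum_insert n1, Finset.sum_insert n2,
    Finset.sum_singleton]
  have e1 : sesqTerm νp νm αp αm (m, n) U (tensorFun (m, n) (hv.memLp.toLp v)) =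
      lineForm (rCoef νp νm m n) (comp U m n) v +
        ((αp / √2 * √(m : ℝ) : ℝ) : ℂ) * (comp U (m - 1) n 1 * star (v 1)) +
        ((αm / √2 * √(n : ℝ) : ℝ) : ℂ) * (comp U m (n - 1) (-1) * star (v (-1))) := by
    have h2 : ((√(m : ℝ) : ℝ) : ℂ) *
        star (comp (tensorFun (m, n) (hv.memLp.toLp v)) (m - 1) n 1) = 0 := by
      rcases Nat.eq_zero_or_pos m with rfl | hm
      · simp
      · have : ¬((m, n) : ℕ × ℕ) = (m - 1, n) := by rw [Prod.mk.injEq]; omega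
        rw [comp_tensorFun _ hv, if_neg this, star_zero, mul_zero]
    have h3 : ((√(n : ℝ) : ℝ) : ℂ) *
        star (comp (tensorFun (m, n) (hv.memLp.toLp v)) m (n - 1) (-1)) = 0 := by
      rcases Nat.eq_zero_or_pos n with rfl | hm
      · simp
      · have : ¬((m, n) : ℕ × ℕ) = (m, n - 1) := by rw [Prod.mk.injEq]; omega
        rw [comp_tensorFun _ hv, if_neg this, star_zero, mul_zero]
    simp only [sesqTerm, half_mul_sqrt_two_mul]
    rw [comp_tensorFun _ hv m n, if_pos rfl]
    push_cast at h2 h3 ⊢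
    linear_combination (αp / (√2 : ℝ) : ℂ) * comp U m n 1 * h2
      + (αm / (√2 : ℝ) : ℂ) * comp U m n (-1) * h3
  have e2 : sesqTerm νp νm αp αm (m + 1, n) U (tensorFun (m, n) (hv.memLp.toLp v)) =
      ((αp / √2 * √((m : ℝ) + 1) : ℝ) : ℂ) * (comp U (m + 1) n 1 * star (v 1)) := by
    have a1 : ¬((m, n) : ℕ × ℕ) = (m + 1, n) := by simp
    have a2 : ¬((m, n) : ℕ × ℕ) = (m + 1, n - 1) := by simp
    simp only [sesqTerm, half_mul_sqrt_two_mul, comp_tensorFun _ hv, add_tsub_cancel_right, if_neg a1,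
      if_neg a2, lineForm_zero_right, if_true]
    push_cast
    simp
  have e3 : sesqTerm νp νm αp αm (m, n + 1) U (tensorFun (m, n) (hv.memLp.toLp v)) =
      ((αm / √2 * √((n : ℝ) + 1) : ℝ) : ℂ) * (comp U m (n + 1) (-1) * star (v (-1))) := by
    have a1 : ¬((m, n) : ℕ × ℕ) = (m, n + 1) := by simp
    have a2 : ¬((m, n) : ℕ × ℕ) = (m - 1, n + 1) := by simp
    simp only [sesqTerm, half_mul_sqrt_two_mul, comp_tensorFun _ hv, add_tsub_cancel_right, if_neg a1,
      if_neg a2, lineForm_zero_right, if_true]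
    push_cast
    simp
  rw [e1, e2, e3, jumpPlus, jumpMinus]
  push_cast
  ring

end Sesq

/-! ### Closedness of the form -/

section Limit

/-- An integral over a bounded interval is, up to sign, an inner product with an indicator function,
hence continuous in `L²`. -/
lemma tendsto_intervalIntegral_of_tendsto_Lp {g : ℕ → Lp ℂ 2 (volume : Measure ℝ)}
    {w : Lp ℂ 2 (volume : Measure ℝ)} (h : Tendsto g atTop (𝓝 w)) (a b : ℝ) :
    Tendsto (fun j => ∫ x in a..b, g j x) atTop (𝓝 (∫ x in a..b, w x)) := by
  have hs : MeasurableSet (uIoc a b) := measurableSet_uIoc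
  have hμ : volume (uIoc a b) ≠ ⊤ := by simp [uIoc]
  have e : ∀ f : Lp ℂ 2 (volume : Measure ℝ), ∫ x in a..b, f x =
      (if a ≤ b then 1 else -1 : ℝ) • inner ℂ (indicatorConstLp 2 hs hμ (1 : ℂ)) f := by
    intro f
    rw [intervalIntegral.intervalIntegral_eq_integral_uIoc, L2.inner_indicatorConstLp_one]
  simp only [e]
  exact (tendsto_const_nhds.inner h).const_smul _

/-- The derivative is a closed operator in `L²(ℝ)`. -/
lemma exists_memH1_of_tendsto {u : ℕ → ℝ → ℂ} {f w : Lp ℂ 2 (volume : Measure ℝ)}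
    {F G : ℕ → Lp ℂ 2 (volume : Measure ℝ)} (hu : ∀ j, MemH1 (u j))
    (hF : ∀ j, F j =ᵐ[volume] u j) (hG : ∀ j, G j =ᵐ[volume] deriv (u j))
    (h1 : Tendsto F atTop (𝓝 f)) (h2 : Tendsto G atTop (𝓝 w)) :
    ∃ v, MemH1 v ∧ v =ᵐ[volume] f ∧ deriv v =ᵐ[volume] w := by
  obtain ⟨ns, hmono, hns⟩ := (tendstoInMeasure_of_tendsto_Lp h1).exists_seq_tendsto_ae
  have hae : ∀ᵐ x, ∀ j, F j x = u j x := ae_all_iff.2 hF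
  have hns' : ∀ᵐ x, Tendsto (fun i => u (ns i) x) atTop (𝓝 (f x)) := by
    filter_upwards [hns, hae] with x hx hx'
    simpa only [hx'] using hx
  -- A point where a subsequence converges serves as base point: the limit function is `f(a)` plus
  -- the primitive of the limit `w` of the derivatives.
  obtain ⟨a, ha⟩ := hns'.exists
  have hwl : LocallyIntegrable w := (Lp.memLp w).locallyIntegrable (by norm_num)
  have hii : ∀ x y, IntervalIntegrable w volume x y := hwl.intervalIntegrable_real
  set v : ℝ → ℂ := fun x => f a + ∫ t in a..x, w t with hv
  have hvp : IsPrimitiveOn univ v w := fun x _ y _ => ⟨hii x y, by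
    rw [hv, ← intervalIntegral.integral_interval_sub_left (hii a y) (hii a x)]
    ring⟩
  have hlim : ∀ x, Tendsto (fun i => u (ns i) x) atTop (𝓝 (v x)) := by
    intro x
    have h3 := (tendsto_intervalIntegral_of_tendsto_Lp h2 a x).comp hmono.tendsto_atTop
    refine (ha.add h3).congr fun i => ?_
    have h4 : ∫ t in a..x, G (ns i) t = ∫ t in a..x, deriv (u (ns i)) t :=
      intervalIntegral.integral_congr_ae ((hG (ns i)).mono fun _ h _ => h)
    rw [Function.comp_apply, h4, ← ((hu (ns i)).isPrimitiveOn a trivial x trivial).2]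
    ring
  have hvf : v =ᵐ[volume] f := by
    filter_upwards [hns'] with x hx
    exact tendsto_nhds_unique (hlim x) hx
  exact ⟨v, MemH1.of_isPrimitiveOn hvp ((memLp_congr_ae hvf).2 (Lp.memLp f)) (Lp.memLp w), hvf,
    hvp.deriv_ae_eq_univ⟩

end Limit

section Closed

variable {νp νm αp αm θ : ℝ} {U V W : GH} {p : ℕ × ℕ}

lemma coeffLp_sub (U V : GH) (p : ℕ × ℕ) : coeffLp (U - V) p = coeffLp U p - coeffLp V p := by
  rw [sub_eq_add_neg, coeffLp_add, ← neg_one_smul ℂ V, coeffLp_smul, neg_one_smul, sub_eq_add_neg]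

lemma comp_sub (hU : MemH1 (comp U p.1 p.2)) (hV : MemH1 (comp V p.1 p.2)) :
    comp (U - V) p.1 p.2 = fun x => comp U p.1 p.2 x + -1 * comp V p.1 p.2 x := by
  have h := comp_smul (-1) hV
  have hW : MemH1 (comp ((-1 : ℂ) • V) p.1 p.2) := by
    rw [h]; exact hV.const_mul _
  rw [sub_eq_add_neg, ← neg_one_smul ℂ V, comp_add hU hW, h]

lemma memH1_comp_sub (hU : MemH1 (comp U p.1 p.2)) (hV : MemH1 (comp V p.1 p.2)) :
    MemH1 (comp (U - V) p.1 p.2) := by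
  rw [comp_sub hU hV]
  exact hU.add (hV.const_mul _)

open Classical in
/-- The derivative of a component, as an element of `L²(ℝ)`. -/
noncomputable def derivLp (U : GH) (p : ℕ × ℕ) : Lp ℂ 2 (volume : Measure ℝ) :=
  if h : MemLp (deriv (comp U p.1 p.2)) 2 volume then h.toLp _ else 0

lemma derivLp_ae_eq (hU : MemH1 (comp U p.1 p.2)) :
    derivLp U p =ᵐ[volume] deriv (comp U p.1 p.2) := by
  rw [derivLp, dif_pos hU.memLp_deriv]
  exact hU.memLp_deriv.coeFn_toLp

lemma derivLp_sub (hU : MemH1 (comp U p.1 p.2)) (hV : MemH1 (comp V p.1 p.2)) :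
    derivLp (U - V) p = derivLp U p - derivLp V p := by
  refine Lp.ext ?_
  have h := hU.deriv_add (hV.const_mul (-1))
  rw [← comp_sub hU hV, deriv_const_mul_fun] at h
  filter_upwards [derivLp_ae_eq (memH1_comp_sub hU hV), derivLp_ae_eq hU, derivLp_ae_eq hV, h,
    Lp.coeFn_sub (derivLp U p) (derivLp V p)] with x h1 h2 h3 h4 h5
  rw [h1, h4, h5, Pi.sub_apply, h2, h3]
  ring

lemma aTerm_eq (hU : MemH1 (comp U p.1 p.2)) :
    aTerm νp νm U p = ‖derivLp U p‖ ^ 2 + rCoef νp νm p.1 p.2 * ‖coeffLp U p‖ ^ 2 := by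
  rw [aTerm, integral_add hU.integrable_norm_sq_deriv (hU.integrable_norm_sq.const_mul _),
    integral_const_mul, integral_norm_sq_comp, derivLp, dif_pos hU.memLp_deriv, norm_sq_toLp]

lemma tendsto_coeffLp {V : ℕ → GH} (h : Tendsto V atTop (𝓝 U)) (p : ℕ × ℕ) :
    Tendsto (fun j => coeffLp (V j) p) atTop (𝓝 (coeffLp U p)) := by
  rw [tendsto_iff_norm_sub_tendsto_zero] at h ⊢
  refine squeeze_zero (fun _ => norm_nonneg _) (fun j => ?_) h
  rw [← coeffLp_sub]
  exact norm_coeffLp_le _ _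

/-- Closedness of the form of a single component. -/
lemma tendsto_aTerm {V : ℕ → GH} (hV : ∀ j, MemH1 (comp (V j) p.1 p.2))
    (hVU : Tendsto V atTop (𝓝 U))
    (hc : ∀ ε > 0, ∃ N, ∀ j ≥ N, ∀ l ≥ N, aTerm νp νm (V j - V l) p < ε) :
    MemH1 (comp U p.1 p.2) ∧
      ∀ l, Tendsto (fun j => aTerm νp νm (V l - V j) p) atTop (𝓝 (aTerm νp νm (V l - U) p)) := by
  have hC : CauchySeq fun j => derivLp (V j) p := by
    rw [Metric.cauchySeq_iff]
    intro ε hε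
    obtain ⟨N, hN⟩ := hc (ε ^ 2) (by positivity)
    refine ⟨N, fun j hj l hl => ?_⟩
    rw [dist_eq_norm, ← derivLp_sub (hV j) (hV l)]
    have h1 := hN j hj l hl
    rw [aTerm_eq (memH1_comp_sub (hV j) (hV l))] at h1
    have h2 : 0 ≤ rCoef νp νm p.1 p.2 * ‖coeffLp (V j - V l) p‖ ^ 2 :=
      mul_nonneg (rCoef_nonneg _ _ _ _) (by positivity)
    exact lt_of_pow_lt_pow_left₀ 2 hε.le (by linarith)
  obtain ⟨w, hw⟩ := cauchySeq_tendsto_of_complete hC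
  have ht := tendsto_coeffLp hVU p
  obtain ⟨v, hv1, hv2, hv3⟩ := exists_memH1_of_tendsto hV
    (fun j => (comp_ae_eq_coeffLp (V j) p).symm) (fun j => derivLp_ae_eq (hV j)) ht hw
  have hcU := comp_eq_of_ae_eq hv1 hv2
  have hU : MemH1 (comp U p.1 p.2) := hcU ▸ hv1
  have hwU : derivLp U p = w := Lp.ext ((derivLp_ae_eq hU).trans (hcU ▸ hv3))
  refine ⟨hU, fun l => ?_⟩
  rw [← hwU] at hw
  have e : ∀ j, aTerm νp νm (V l - V j) p = ‖derivLp (V l) p - derivLp (V j) p‖ ^ 2 +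
      rCoef νp νm p.1 p.2 * ‖coeffLp (V l) p - coeffLp (V j) p‖ ^ 2 := fun j => by
    rw [aTerm_eq (memH1_comp_sub (hV l) (hV j)), derivLp_sub (hV l) (hV j), coeffLp_sub]
  simp only [e]
  rw [aTerm_eq (memH1_comp_sub (hV l) hU), derivLp_sub (hV l) hU, coeffLp_sub]
  exact ((tendsto_const_nhds.sub hw).norm.pow 2).add
    (((tendsto_const_nhds.sub ht).norm.pow 2).const_mul _)

lemma aTerm_le_formA (hU : U ∈ energySpace νp νm) (p : ℕ × ℕ) :
    aTerm νp νm U p ≤ formA νp νm U :=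
  hU.2.le_tsum p fun _ _ => aTerm_nonneg _ _ _ _

/-- Completeness of a Hilbert sum: each component converges by `tendsto_aTerm`, and the Cauchy bound
passes to the limit on finite partial sums, which bounds the whole series. -/
lemma formClosed_formA {V : ℕ → GH} (hV : ∀ j, V j ∈ energySpace νp νm)
    (hVU : Tendsto V atTop (𝓝 U))
    (hc : ∀ ε > 0, ∃ N, ∀ j ≥ N, ∀ l ≥ N, formA νp νm (V j - V l) < ε) :
    U ∈ energySpace νp νm ∧ Tendsto (fun j => formA νp νm (V j - U)) atTop (𝓝 0) := by
  have hVV : ∀ j l, V j - V l ∈ energySpace νp νm := fun j l =>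
    (energySubmodule νp νm).sub_mem (hV j) (hV l)
  have key : ∀ p : ℕ × ℕ, MemH1 (comp U p.1 p.2) ∧ ∀ l,
      Tendsto (fun j => aTerm νp νm (V l - V j) p) atTop (𝓝 (aTerm νp νm (V l - U) p)) := by
    intro p
    refine tendsto_aTerm (fun j => (hV j).1 _ _) hVU fun ε hε => ?_
    obtain ⟨N, hN⟩ := hc ε hε
    exact ⟨N, fun j hj l hl => (aTerm_le_formA (hVV j l) p).trans_lt (hN j hj l hl)⟩
  have hs : ∀ ε > 0, ∃ N, ∀ l ≥ N, ∀ s : Finset (ℕ × ℕ), ∑ p ∈ s, aTerm νp νm (V l - U) p ≤ ε := by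
    intro ε hε
    obtain ⟨N, hN⟩ := hc ε hε
    refine ⟨N, fun l hl s => le_of_tendsto (tendsto_finsetSum s fun p _ => (key p).2 l) ?_⟩
    filter_upwards [eventually_ge_atTop N] with j hj
    exact ((hVV l j).2.sum_le_tsum s fun _ _ => aTerm_nonneg _ _ _ _).trans (hN l hl j hj).le
  have hd : ∀ ε > 0, ∃ N, ∀ l ≥ N, V l - U ∈ energySpace νp νm ∧ formA νp νm (V l - U) ≤ ε := by
    intro ε hε
    obtain ⟨N, hN⟩ := hs ε hε
    refine ⟨N, fun l hl => ?_⟩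
    have h1 : Summable (aTerm νp νm (V l - U)) :=
      summable_of_sum_le (fun p => aTerm_nonneg _ _ _ _) (hN l hl)
    exact ⟨⟨fun m n => memH1_comp_sub (p := (m, n)) ((hV l).1 m n) (key (m, n)).1, h1⟩,
      h1.tsum_le_of_sum_le (hN l hl)⟩
  constructor
  · obtain ⟨N, hN⟩ := hd 1 one_pos
    have h := (energySubmodule νp νm).sub_mem (hV N) (hN N le_rfl).1
    rwa [sub_sub_cancel] at h
  · rw [Metric.tendsto_atTop]
    intro ε hε
    obtain ⟨N, hN⟩ := hd (ε / 2) (by positivity)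
    refine ⟨N, fun l hl => ?_⟩
    rw [Real.dist_0_eq_abs, abs_of_nonneg (formA_nonneg _ _ _)]
    linarith [(hN l hl).2]

/-- For `θ < 1` one has `(1 - θ) a[W] ≤ a_{α,ν}[W] + θ‖W‖²`, so a sequence Cauchy for `a_{α,ν}` and
in `H` is Cauchy for `a`. Convergence for `a` gives convergence for `a_{α,ν}` by the same relative
bound. -/
lemma formClosed_form (hνp : 0 < νp) (hνm : 0 < νm) (hαp : 0 ≤ αp) (hαm : 0 ≤ αm)
    (hθp : αp / (νp * √2) < 1) (hθm : αm / (νm * √2) < 1) :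
    FormClosed (energySpace νp νm) (form νp νm αp αm) := by
  intro V U hV hVU hq
  set θ := max (αp / (νp * √2)) (αm / (νm * √2)) with hθ
  have hθ1 : 0 < 1 - θ := sub_pos.2 (max_lt hθp hθm)
  have hb : ∀ W ∈ energySpace νp νm, |form νp νm αp αm W - formA νp νm W| ≤
      θ * (formA νp νm W + ‖W‖ ^ 2) := fun W hW =>
    abs_form_sub_formA_le hνp hνm hαp hαm (le_max_left _ _) (le_max_right _ _) hW
  have hn : Tendsto (fun p : ℕ × ℕ => ‖V p.1 - V p.2‖ ^ 2) atTop (𝓝 0) := by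
    rw [← prod_atTop_atTop_eq]
    simpa using (((hVU.comp tendsto_fst).sub (hVU.comp tendsto_snd)).norm.pow 2 :
      Tendsto (fun p : ℕ × ℕ => ‖V p.1 - V p.2‖ ^ 2) (atTop ×ˢ atTop) _)
  have hA : Tendsto (fun p : ℕ × ℕ => formA νp νm (V p.1 - V p.2)) atTop (𝓝 0) := by
    have h0 : Tendsto (fun p : ℕ × ℕ => (form νp νm αp αm (V p.1 - V p.2) +
        θ * ‖V p.1 - V p.2‖ ^ 2) / (1 - θ)) atTop (𝓝 0) := by
      simpa using (hq.add (hn.const_mul θ)).div_const (1 - θ)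
    refine squeeze_zero (fun _ => formA_nonneg _ _ _) (fun p => ?_) h0
    rw [le_div_iff₀ hθ1]
    have h := (abs_le.1 (hb _ ((energySubmodule νp νm).sub_mem (hV p.1) (hV p.2)))).1
    linarith
  obtain ⟨hU, hlim⟩ := formClosed_formA hV hVU fun ε hε => by
    obtain ⟨N, hN⟩ := Metric.tendsto_atTop.1 hA ε hε
    refine ⟨max N.1 N.2, fun j hj l hl => ?_⟩
    have h := hN (j, l) ⟨(le_max_left _ _).trans hj, (le_max_right _ _).trans hl⟩
    rwa [Real.dist_0_eq_abs, abs_of_nonneg (formA_nonneg _ _ _)] at h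
  refine ⟨hU, ?_⟩
  have hn' : Tendsto (fun j => ‖V j - U‖ ^ 2) atTop (𝓝 0) := by
    simpa using ((hVU.sub_const U).norm.pow 2)
  have h0 : Tendsto (fun j => θ * (formA νp νm (V j - U) + ‖V j - U‖ ^ 2)) atTop (𝓝 0) := by
    simpa using (hlim.add hn').const_mul θ
  have h1 : Tendsto (fun j => form νp νm αp αm (V j - U) - formA νp νm (V j - U)) atTop (𝓝 0) :=
    squeeze_zero_norm (fun j => hb _ ((energySubmodule νp νm).sub_mem (hV j) hU)) h0
  simpa using h1.add hlim

end Closed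

/-! ### The operator defined by a closed semibounded form -/

section Abstract

variable {H : Type*} [NormedAddCommGroup H] [InnerProductSpace ℂ H]

lemma inner_self_complex (x : H) : inner ℂ x x = ((‖x‖ ^ 2 : ℝ) : ℂ) := by
  rw [inner_self_eq_norm_sq_to_K]
  simp

/-- A copy of a subspace, to carry the norm of a quadratic form. -/
def FormDomain (d : Submodule ℂ H) : Type _ := d

instance (d : Submodule ℂ H) : AddCommGroup (FormDomain d) := inferInstanceAs (AddCommGroup d)

instance (d : Submodule ℂ H) : Module ℂ (FormDomain d) := inferInstanceAs (Module ℂ d)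

/-- The inclusion of the form domain. -/
def FormDomain.incl (d : Submodule ℂ H) : FormDomain d →ₗ[ℂ] H := d.subtype

variable {d : Submodule ℂ H} {q : H → ℝ} {r : ℝ}

lemma FormDomain.incl_mem (U : FormDomain d) : incl d U ∈ d := Subtype.property (p := (· ∈ d)) U

lemma FormDomain.incl_eq_zero {U : FormDomain d} (h : incl d U = 0) : U = 0 := Subtype.ext h

lemma FormDomain.exists_incl {U : H} (h : U ∈ d) : ∃ W : FormDomain d, incl d W = U :=
  ⟨⟨U, h⟩, rfl⟩

open FormDomain in
/-- The inner product `q(U, V) + r (U, V)`. -/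
@[reducible] noncomputable def formCore (hB : IsHermitianOn d (polarForm q))
    (hq : ∀ U ∈ d, polarForm q U U = (q U : ℂ)) (hr : ∀ U ∈ d, ‖U‖ ^ 2 ≤ q U + r * ‖U‖ ^ 2) :
    InnerProductSpace.Core ℂ (FormDomain d) where
  -- The arguments are exchanged because `polarForm` is antilinear in its second argument and
  -- `inner` in its first.
  inner U V := polarForm q (incl d V) (incl d U) + (r : ℂ) * inner ℂ (incl d U) (incl d V)
  conj_inner_symm U V := by
    rw [map_add, map_mul, Complex.conj_ofReal, inner_conj_symm]
    rw [← hB.star_symm _ V.incl_mem _ U.incl_mem]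
    simp
  re_inner_nonneg U := by
    rw [hq _ U.incl_mem, inner_self_complex, ← Complex.ofReal_mul, ← Complex.ofReal_add]
    exact (sq_nonneg ‖incl d U‖).trans (hr _ U.incl_mem)
  add_left U V W := by
    rw [map_add, hB.add_right W.incl_mem U.incl_mem V.incl_mem, inner_add_left]
    ring
  smul_left U V c := by
    rw [map_smul, hB.smul_right _ V.incl_mem U.incl_mem, inner_smul_left, Complex.star_def]
    ring
  definite U h := by
    rw [hq _ U.incl_mem, inner_self_complex] at h
    have h1 := hr _ U.incl_mem
    have h3 : q (incl d U) + r * ‖incl d U‖ ^ 2 = 0 := by exact_mod_cast h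
    refine FormDomain.incl_eq_zero (norm_eq_zero.1 (pow_eq_zero_iff two_ne_zero |>.1 ?_))
    exact le_antisymm (h3 ▸ h1) (by positivity)


/-- The norm `(q[U] + r ‖U‖²)^{1/2}`. -/
@[reducible] noncomputable def formNormedAddCommGroup (hB : IsHermitianOn d (polarForm q))
    (hq : ∀ U ∈ d, polarForm q U U = (q U : ℂ)) (hr : ∀ U ∈ d, ‖U‖ ^ 2 ≤ q U + r * ‖U‖ ^ 2) : NormedAddCommGroup (FormDomain d) :=
  (formCore hB hq hr).toNormedAddCommGroup

/-- The inner product space structure on the form domain. -/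
@[reducible] noncomputable def formInnerProductSpace (hB : IsHermitianOn d (polarForm q))
    (hq : ∀ U ∈ d, polarForm q U U = (q U : ℂ)) (hr : ∀ U ∈ d, ‖U‖ ^ 2 ≤ q U + r * ‖U‖ ^ 2) :
    @InnerProductSpace ℂ (FormDomain d) _
      (formNormedAddCommGroup hB hq hr).toSeminormedAddCommGroup :=
  letI := formNormedAddCommGroup hB hq hr
  InnerProductSpace.ofCore (formCore hB hq hr).toCore

open FormDomain in
lemma form_norm_sq (hB : IsHermitianOn d (polarForm q))
    (hq : ∀ U ∈ d, polarForm q U U = (q U : ℂ)) (hr : ∀ U ∈ d, ‖U‖ ^ 2 ≤ q U + r * ‖U‖ ^ 2) (U : FormDomain d) :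
    letI := formNormedAddCommGroup hB hq hr
    ‖U‖ ^ 2 = q (incl d U) + r * ‖incl d U‖ ^ 2 := by
  let := formNormedAddCommGroup hB hq hr
  let := formInnerProductSpace hB hq hr
  have h := inner_self_complex U
  change polarForm q (incl d U) (incl d U) + (r : ℂ) * inner ℂ (incl d U) (incl d U) = _ at h
  rw [hq _ U.incl_mem, inner_self_complex] at h
  exact_mod_cast h.symm

open FormDomain in
lemma norm_incl_le (hB : IsHermitianOn d (polarForm q))
    (hq : ∀ U ∈ d, polarForm q U U = (q U : ℂ)) (hr : ∀ U ∈ d, ‖U‖ ^ 2 ≤ q U + r * ‖U‖ ^ 2) (U : FormDomain d) :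
    letI := formNormedAddCommGroup hB hq hr
    ‖incl d U‖ ≤ ‖U‖ := by
  let := formNormedAddCommGroup hB hq hr
  exact le_of_sq_le_sq ((hr _ U.incl_mem).trans (form_norm_sq hB hq hr U).ge) (norm_nonneg _)

open FormDomain in
/-- The domain of a closed form is complete. -/
lemma completeSpace_formDomain [CompleteSpace H] (hB : IsHermitianOn d (polarForm q))
    (hq : ∀ U ∈ d, polarForm q U U = (q U : ℂ)) (hr : ∀ U ∈ d, ‖U‖ ^ 2 ≤ q U + r * ‖U‖ ^ 2) (hc : FormClosed (d : Set H) q) :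
    letI := formNormedAddCommGroup hB hq hr
    CompleteSpace (FormDomain d) := by
  let := formNormedAddCommGroup hB hq hr
  have hnorm := form_norm_sq hB hq hr
  have hle := norm_incl_le hB hq hr
  refine Metric.complete_of_cauchySeq_tendsto fun V hV => ?_
  have hV0 : Tendsto (fun p : ℕ × ℕ => ‖V p.1 - V p.2‖ ^ 2) atTop (𝓝 0) := by
    have h := (cauchySeq_iff_tendsto_dist_atTop_0.1 hV).pow 2
    simpa [dist_eq_norm] using h
  have hi : CauchySeq fun j => incl d (V j) := by
    rw [Metric.cauchySeq_iff] at hV ⊢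
    intro ε hε
    obtain ⟨N, hN⟩ := hV ε hε
    refine ⟨N, fun j hj l hl => ?_⟩
    have h := hN j hj l hl
    rw [dist_eq_norm] at h ⊢
    rw [← map_sub]
    exact (hle _).trans_lt h
  obtain ⟨U, hU⟩ := cauchySeq_tendsto_of_complete hi
  have hn0 : Tendsto (fun p : ℕ × ℕ => ‖incl d (V p.1) - incl d (V p.2)‖ ^ 2) atTop (𝓝 0) := by
    have h := (cauchySeq_iff_tendsto_dist_atTop_0.1 hi).pow 2
    simpa [dist_eq_norm] using h
  have hq0 : Tendsto (fun p : ℕ × ℕ => q (incl d (V p.1) - incl d (V p.2))) atTop (𝓝 0) := by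
    have h := hV0.sub (hn0.const_mul r)
    simp only [mul_zero, sub_zero] at h
    refine h.congr fun p => ?_
    rw [hnorm, map_sub]
    ring
  obtain ⟨hUd, hlim⟩ := hc _ U (fun j => (V j).incl_mem) hU hq0
  obtain ⟨W, rfl⟩ := exists_incl hUd
  refine ⟨W, ?_⟩
  rw [tendsto_iff_norm_sub_tendsto_zero]
  have h1 : Tendsto (fun j => ‖V j - W‖ ^ 2) atTop (𝓝 0) := by
    have h2 := hlim.add (((hU.sub_const (incl d W)).norm.pow 2).const_mul r)
    simp only [sub_self, norm_zero, ne_eq, OfNat.ofNat_ne_zero, not_false_eq_true, zero_pow,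
      mul_zero, add_zero] at h2
    refine h2.congr fun j => ?_
    rw [hnorm, map_sub]
  have h3 := h1.sqrt
  simpa [Real.sqrt_sq] using h3

open FormDomain in
/-- The Riesz representation theorem for the inner product given by a closed form. -/
lemma exists_formSolution [CompleteSpace H] (hB : IsHermitianOn d (polarForm q))
    (hq : ∀ U ∈ d, polarForm q U U = (q U : ℂ)) (hr : ∀ U ∈ d, ‖U‖ ^ 2 ≤ q U + r * ‖U‖ ^ 2)
    (hc : FormClosed (d : Set H) q) (F : H) :
    ∃ U ∈ d, ∀ V ∈ d, polarForm q U V + (r : ℂ) * inner ℂ V U = inner ℂ V F := by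
  let := formNormedAddCommGroup hB hq hr
  let := formInnerProductSpace hB hq hr
  have := completeSpace_formDomain hB hq hr hc
  have hinner : ∀ U V : FormDomain d, inner ℂ U V =
      polarForm q (incl d V) (incl d U) + (r : ℂ) * inner ℂ (incl d U) (incl d V) :=
    fun _ _ => rfl
  let ℓ : FormDomain d →L[ℂ] ℂ :=
    ((innerSL ℂ F).toLinearMap ∘ₗ incl d).mkContinuous ‖F‖ fun V =>
      (norm_inner_le_norm _ _).trans (mul_le_mul_of_nonneg_left (norm_incl_le hB hq hr V) (norm_nonneg F))
  obtain ⟨U, hU⟩ := (InnerProductSpace.toDual ℂ (FormDomain d)).surjective ℓ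
  refine ⟨incl d U, U.incl_mem, fun V hV => ?_⟩
  obtain ⟨V, rfl⟩ := exists_incl hV
  have h1 : inner ℂ U V = inner ℂ F (incl d V) := by
    rw [← InnerProductSpace.toDual_apply_apply, hU]
    rfl
  rw [hinner] at h1
  have h2 := congrArg star h1
  rw [star_add, star_mul', hB.star_symm _ V.incl_mem _ U.incl_mem] at h2
  simp only [Complex.star_def, Complex.conj_ofReal, inner_conj_symm] at h2
  exact h2

open FormDomain in
/-- A subspace with trivial orthogonal complement is dense in the form norm. -/
lemma exists_form_sub_lt [CompleteSpace H] (hB : IsHermitianOn d (polarForm q))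
    (hq : ∀ U ∈ d, polarForm q U U = (q U : ℂ)) (hr : ∀ U ∈ d, ‖U‖ ^ 2 ≤ q U + r * ‖U‖ ^ 2)
    (hc : FormClosed (d : Set H) q) {D : Submodule ℂ H}
    (hD : D ≤ d) (h0 : ∀ U ∈ d, (∀ V ∈ D, polarForm q U V + (r : ℂ) * inner ℂ V U = 0) → U = 0)
    {U : H} (hU : U ∈ d) {ε : ℝ} (hε : 0 < ε) :
    ∃ V ∈ D, q (U - V) + r * ‖U - V‖ ^ 2 < ε := by
  let := formNormedAddCommGroup hB hq hr
  let := formInnerProductSpace hB hq hr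
  have := completeSpace_formDomain hB hq hr hc
  have hdense : Dense ((D.comap (incl d) : Submodule ℂ (FormDomain d)) : Set (FormDomain d)) := by
    rw [Submodule.dense_iff_topologicalClosure_eq_top, Submodule.topologicalClosure_eq_top_iff,
      Submodule.eq_bot_iff]
    intro W hW
    refine FormDomain.incl_eq_zero (h0 _ W.incl_mem fun V hV => ?_)
    obtain ⟨V, rfl⟩ := exists_incl (hD hV)
    exact (Submodule.mem_orthogonal _ _).1 hW V hV
  obtain ⟨U, rfl⟩ := exists_incl hU
  obtain ⟨V, hV, hUV⟩ := hdense.exists_dist_lt U (Real.sqrt_pos.2 hε)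
  refine ⟨incl d V, hV, ?_⟩
  rw [← map_sub, ← form_norm_sq hB hq hr, ← Real.sq_sqrt hε.le]
  rw [dist_eq_norm] at hUV
  gcongr

/-- The graph of the operator defined by a form. -/
def formGraph (hB : IsHermitianOn d (polarForm q)) : Submodule ℂ (H × H) where
  carrier := {z | z.1 ∈ d ∧ ∀ V ∈ d, polarForm q z.1 V = inner ℂ V z.2}
  zero_mem' := ⟨d.zero_mem, fun V hV => by
    have h := hB.smul_left 0 0 d.zero_mem V hV
    simpa using h⟩
  add_mem' {z w} hz hw := ⟨d.add_mem hz.1 hw.1, fun V hV => by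
    rw [Prod.fst_add, Prod.snd_add, hB.add_left _ hz.1 _ hw.1 _ hV, hz.2 V hV, hw.2 V hV,
      inner_add_right]⟩
  smul_mem' c z hz := ⟨d.smul_mem c hz.1, fun V hV => by
    rw [Prod.smul_fst, Prod.smul_snd, hB.smul_left _ _ hz.1 _ hV, hz.2 V hV, inner_smul_right]⟩

/-- A closed semibounded form defines a self-adjoint operator, and `T + r` is surjective for
large `r`. -/
theorem exists_formOperator [CompleteSpace H] (hd : Dense (d : Set H))
    (hB : IsHermitianOn d (polarForm q))
    (hq : ∀ U ∈ d, polarForm q U U = (q U : ℂ)) (hr : ∀ U ∈ d, ‖U‖ ^ 2 ≤ q U + r * ‖U‖ ^ 2)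
    (hc : FormClosed (d : Set H) q) :
    ∃ T : H →ₗ.[ℂ] H, IsSelfAdjoint T ∧ IsFormOperator (d : Set H) q T ∧
      ∀ F, ∃ U, (U, F - (r : ℂ) • U) ∈ T.graph := by
  have hz : ∀ F : H, (∀ V ∈ d, inner ℂ V F = 0) → F = 0 := fun F hF =>
    hd.eq_zero_of_inner_right ℂ fun V hV => hF V hV
  have hg : ∀ z ∈ formGraph hB, z.1 = 0 → z.2 = 0 := by
    rintro ⟨U, F⟩ hz' rfl
    refine hz F fun V hV => ?_
    rw [← hz'.2 V hV]
    simpa using hB.smul_left 0 0 d.zero_mem V hV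
  set T := (formGraph hB).toLinearPMap with hT
  have hTg : T.graph = formGraph hB := Submodule.toLinearPMap_graph_eq _ hg
  -- This membership says `(T + r)U = F`.
  have hsurj : ∀ F, ∃ U, (U, F - (r : ℂ) • U) ∈ T.graph := by
    intro F
    obtain ⟨U, hU, h⟩ := exists_formSolution hB hq hr hc F
    refine ⟨U, ?_⟩
    rw [hTg]
    refine ⟨hU, fun V hV => ?_⟩
    rw [inner_sub_right, inner_smul_right, ← h V hV]
    ring
  have hsymm : ∀ U F V G, (U, F) ∈ T.graph → (V, G) ∈ T.graph → inner ℂ F V = inner ℂ U G := by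
    intro U F V G h1 h2
    rw [hTg] at h1 h2
    rw [← h2.2 U h1.1, ← hB.star_symm _ h1.1 _ h2.1, h1.2 V h2.1, Complex.star_def,
      inner_conj_symm]
  have hdense : Dense (T.domain : Set H) := by
    rw [Submodule.dense_iff_topologicalClosure_eq_top, Submodule.topologicalClosure_eq_top_iff,
      Submodule.eq_bot_iff]
    intro W hW
    -- For `W` orthogonal to the domain and `(T + r)U = W`, pairing with `U` gives `q[U] + r‖U‖² =
    -- 0`, so `U = 0` and then `W = 0`.
    obtain ⟨U, hU⟩ := hsurj W
    have h1 := (Submodule.mem_orthogonal _ _).1 hW U (LinearPMap.mem_domain_of_mem_graph hU)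
    rw [hTg] at hU
    have h2 := hU.2 U hU.1
    rw [hq U hU.1, inner_sub_right, h1, inner_smul_right, inner_self_complex] at h2
    have h3 : q U = 0 - r * ‖U‖ ^ 2 := by exact_mod_cast h2
    have h4 : U = 0 := by
      refine norm_eq_zero.1 (pow_eq_zero_iff two_ne_zero |>.1 ?_)
      exact le_antisymm ((hr U hU.1).trans (by rw [h3]; linarith)) (by positivity)
    have h5 := hg _ hU h4
    simpa [h4] using h5
  refine ⟨T, ?_, ?_, hsurj⟩
  · rw [LinearPMap.isSelfAdjoint_def]
    refine LinearPMap.eq_of_eq_graph ?_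
    rw [LinearPMap.adjoint_graph_eq_graph_adjoint hdense]
    ext ⟨V, G⟩
    rw [Submodule.mem_adjoint_iff]
    constructor
    · intro h
      -- A symmetric operator with `T + r` surjective is self-adjoint: if `(T + r)W = (T* + r)V`,
      -- then `V - W` is orthogonal to the range of `T + r`, to which it belongs by the choice of
      -- `X`, so `V = W`.
      obtain ⟨W, hW⟩ := hsurj (G + (r : ℂ) • V)
      obtain ⟨X, hX⟩ := hsurj (V - W)
      have h1 := h _ _ hX
      have h2 := hsymm _ _ _ _ hX hW
      have h3 : V - W = 0 := by
        refine (inner_self_eq_zero (𝕜 := ℂ)).1 ?_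
        have e : inner ℂ (V - W) (V - W) =
            inner ℂ (V - W - (r : ℂ) • X) V - inner ℂ (V - W - (r : ℂ) • X) W +
              (r : ℂ) * (inner ℂ X V - inner ℂ X W) := by
          simp only [inner_sub_left, inner_sub_right, inner_smul_left, Complex.conj_ofReal]
          ring
        rw [e, sub_eq_zero.1 h1, h2]
        simp only [inner_sub_right, inner_add_right, inner_smul_right]
        ring
      rw [← sub_eq_zero.1 h3, add_sub_cancel_right] at hW
      exact hW
    · intro h U F hU
      exact sub_eq_zero.2 (hsymm _ _ _ _ hU h)
  · intro U F
    rw [hTg]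
    exact Iff.rfl

end Abstract

/-! ### Comparison of the two operators -/

section Weak

variable {νp νm αp αm : ℝ} {U W F G : GH}

lemma isWeakSolution_iff {r : ℝ} {u f : ℝ → ℂ} {βp βm : ℂ} :
    IsWeakSolution r u f βp βm ↔ ∀ v, MemH1 v →
      lineForm r u v + βp * star (v 1) + βm * star (v (-1)) = ∫ x, f x * star (v x) := Iff.rfl

/-- The components of `U` solve the equations `L_{m,n} u_{m,n} = f_{m,n}` with the matching
conditions of `A_{α,ν}` in the weak sense. -/
def IsWeakOpSolution (νp νm αp αm : ℝ) (U F : GH) : Prop :=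
  (∀ p : ℕ × ℕ, MemH1 (comp U p.1 p.2)) ∧ ∀ p : ℕ × ℕ,
    IsWeakSolution (rCoef νp νm p.1 p.2) (comp U p.1 p.2) (coeffLp F p)
      (jumpPlus αp U p.1 p.2) (jumpMinus αm U p.1 p.2)

lemma integral_coeffLp_mul_star (F : GH) (p : ℕ × ℕ) {v : ℝ → ℂ} (hv : MemH1 v) :
    ∫ x, coeffLp F p x * star (v x) = inner ℂ (tensorFun p (hv.memLp.toLp v)) F := by
  rw [inner_tensorFun, ← Lp.toLp_coeFn (coeffLp F p) (Lp.memLp _), inner_toLp, Lp.toLp_coeFn]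

/-- Regularity is applied component by component. The summability required in the domain is
Parseval's identity for `F`, and no energy bound on `U` enters. -/
lemma IsWeakOpSolution.mem_opDomain (h : IsWeakOpSolution νp νm αp αm U F) :
    U ∈ opDomain νp νm αp αm ∧ OpAction νp νm U F := by
  have hreg := fun p : ℕ × ℕ => (h.2 p).regular (h.1 p) (Lp.memLp _)
  refine ⟨⟨fun m n => h.1 (m, n), fun m n => ?_, ?_, fun m n => (hreg (m, n)).2.2.2.1,
    fun m n => (hreg (m, n)).2.2.2.2.1⟩, fun m n => ?_⟩
  · exact ⟨(hreg (m, n)).1, (hreg (m, n)).2.1, (hreg (m, n)).2.2.1⟩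
  · refine (hasSum_norm_sq_coeffLp F).summable.congr fun p => ?_
    rw [← Lp.toLp_coeFn (coeffLp F p) (Lp.memLp _), norm_sq_toLp]
    refine integral_congr_ae ?_
    filter_upwards [(hreg p).2.2.2.2.2] with x hx
    rw [hx, Lop]
  · exact (coeffLp_ae_eq F (m, n)).symm.trans (hreg (m, n)).2.2.2.2.2

/-- The form equation is tested with vectors having a single nonzero component. -/
lemma isWeakOpSolution_of_form (hνp : 0 < νp) (hνm : 0 < νm) (hU : U ∈ energySpace νp νm)
    (h : ∀ V ∈ energySpace νp νm, polarForm (form νp νm αp αm) U V = inner ℂ V F) :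
    IsWeakOpSolution νp νm αp αm U F := by
  refine ⟨fun p => hU.1 p.1 p.2, fun p v hv => ?_⟩
  rw [integral_coeffLp_mul_star F p hv, ← h _ (tensorFun_mem_energySpace p hv),
    polarForm_form_tensorFun hνp hνm hU p hv, lineForm]

/-- Green's formula in each component; the prescribed jumps of `u'` become the point terms at `±1`.
-/
lemma isWeakOpSolution_of_mem_opDomain (hU : U ∈ opDomain νp νm αp αm)
    (hF : OpAction νp νm U F) : IsWeakOpSolution νp νm αp αm U F := by
  refine ⟨fun p => hU.1 p.1 p.2, fun p v hv => ?_⟩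
  obtain ⟨hi, he⟩ := integral_deriv_deriv_mul_star (hU.2.1 p.1 p.2).1 (hU.2.1 p.1 p.2).2.1
    (hU.2.1 p.1 p.2).2.2 (hU.2.2.2.1 p.1 p.2) (hU.2.2.2.2 p.1 p.2) hv
  have h1 : ∫ x, coeffLp F p x * star (v x) =
      (∫ x, (deriv (comp U p.1 p.2) x * star (deriv v x) +
        (rCoef νp νm p.1 p.2 : ℂ) * (comp U p.1 p.2 x * star (v x)))) -
      ∫ x, (deriv (deriv (comp U p.1 p.2)) x * star (v x) +
        deriv (comp U p.1 p.2) x * star (deriv v x)) := by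
    rw [← integral_sub (integrable_lineForm _ (hU.1 p.1 p.2) hv) hi]
    refine integral_congr_ae ?_
    filter_upwards [coeffLp_ae_eq F p, hF p.1 p.2] with x h1 h2
    rw [h1, h2, Lop]
    ring
  rw [h1, he, jumpPlus, jumpMinus]
  ring

/-- Linearity of the domain and of the action is obtained in the weak formulation, which avoids
handling second derivatives and one-sided limits of a difference. -/
lemma IsWeakOpSolution.sub (hU : IsWeakOpSolution νp νm αp αm U F)
    (hW : IsWeakOpSolution νp νm αp αm W G) : IsWeakOpSolution νp νm αp αm (U - W) (F - G) := by
  refine ⟨fun p => memH1_comp_sub (hU.1 p) (hW.1 p), fun p v hv => ?_⟩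
  have e : ∀ m n, comp (U - W) m n = fun x => comp U m n x + -1 * comp W m n x :=
    fun m n => comp_sub (p := (m, n)) (hU.1 (m, n)) (hW.1 (m, n))
  have hp : jumpPlus αp (U - W) p.1 p.2 = jumpPlus αp U p.1 p.2 - jumpPlus αp W p.1 p.2 := by
    simp only [jumpPlus, e]
    ring
  have hm : jumpMinus αm (U - W) p.1 p.2 = jumpMinus αm U p.1 p.2 - jumpMinus αm W p.1 p.2 := by
    simp only [jumpMinus, e]
    ring
  have hl : lineForm (rCoef νp νm p.1 p.2) (comp (U - W) p.1 p.2) v =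
      lineForm (rCoef νp νm p.1 p.2) (comp U p.1 p.2) v -
        lineForm (rCoef νp νm p.1 p.2) (comp W p.1 p.2) v := by
    rw [e, lineForm_add _ (hU.1 p) ((hW.1 p).const_mul _) hv, lineForm_const_mul]
    ring
  have h1 := (isWeakSolution_iff.1 (hU.2 p)) v hv
  have h2 := (isWeakSolution_iff.1 (hW.2 p)) v hv
  rw [integral_coeffLp_mul_star _ p hv] at h1 h2
  change lineForm _ _ _ + _ + _ = _
  rw [integral_coeffLp_mul_star _ p hv, inner_sub_right, ← h1, ← h2, hp, hm, hl]
  ring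

/-- Green's formula for a component. -/
lemma inner_coeffLp_eq (hU : IsWeakOpSolution νp νm αp αm U F) (p : ℕ × ℕ) :
    inner ℂ (coeffLp U p) (coeffLp F p) = (aTerm νp νm U p : ℂ) +
      jumpPlus αp U p.1 p.2 * star (comp U p.1 p.2 1) +
      jumpMinus αm U p.1 p.2 * star (comp U p.1 p.2 (-1)) := by
  have h := hU.2 p _ (hU.1 p)
  rw [← lineForm, lineForm_comp_self] at h
  rw [h, L2.inner_def]
  refine integral_congr_ae ?_
  filter_upwards [comp_ae_eq_coeffLp U p] with x h3
  rw [← h3, RCLike.inner_apply]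
  rfl

end Weak

/-! ### Finite sections: edge terms and boundary sums of squares -/

section Sequences

/-- Apply `2xy ≤ x² + y²` to the truncated Jacobi matrix with off-diagonal entries `√m`. The only
excess over the diagonal sits at the edge `N`; the negative edge term on the right is what lets the
induction close. -/
lemma sum_neighbour_le (y : ℕ → ℝ) (N : ℕ) :
    ∑ m ∈ Finset.range N, (√((m : ℝ) + 1) * y (m + 1) * y m + √(m : ℝ) * y (m - 1) * y m) ≤
      ∑ m ∈ Finset.range N, (√(m : ℝ) + √((m : ℝ) + 1)) * y m ^ 2 + √(N : ℝ) / 2 * y N ^ 2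
        - √(N : ℝ) / 2 * y (N - 1) ^ 2 := by
  induction N with
  | zero => simp
  | succ N ih =>
    rw [Finset.sum_range_succ, Finset.sum_range_succ, add_tsub_cancel_right]
    push_cast
    have h1 := mul_nonneg (Real.sqrt_nonneg ((N : ℝ) + 1)) (sq_nonneg (y (N + 1) - y N))
    have h2 := mul_nonneg (Real.sqrt_nonneg (N : ℝ)) (sq_nonneg (y (N - 1) - y N))
    nlinarith

lemma re_jump_ge (a b z : ℂ) (s t : ℝ) (hs : 0 ≤ s) (ht : 0 ≤ t) :
    -(s * ‖a‖ * ‖z‖ + t * ‖b‖ * ‖z‖) ≤ (((s : ℂ) * a + (t : ℂ) * b) * star z).re := by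
  have h : ‖((s : ℂ) * a + (t : ℂ) * b) * star z‖ ≤ s * ‖a‖ * ‖z‖ + t * ‖b‖ * ‖z‖ := by
    rw [norm_mul, norm_star, ← add_mul]
    gcongr
    refine (norm_add_le _ _).trans ?_
    rw [norm_mul, norm_mul, Complex.norm_real, Complex.norm_real, Real.norm_of_nonneg hs,
      Real.norm_of_nonneg ht]
  exact (neg_le_neg h).trans (abs_le.1 (Complex.abs_re_le_norm _)).1

/-- The interaction terms of a finite section. -/
lemma sum_re_jump_ge {α ν : ℝ} (hα : 0 ≤ α) (hν : 0 < ν) (h : α / (ν * √2) ≤ 1) (y : ℕ → ℂ)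
    (N : ℕ) :
    -(∑ m ∈ Finset.range N, 2 * (ν * √((m : ℝ) + 1 / 2)) * ‖y m‖ ^ 2 +
      ν / 2 * √(N : ℝ) * ‖y N‖ ^ 2) ≤
      ∑ m ∈ Finset.range N, ((((α / √2 : ℝ) : ℂ) * (((√((m : ℝ) + 1) : ℝ) : ℂ) * y (m + 1)
        + ((√(m : ℝ) : ℝ) : ℂ) * y (m - 1))) * star (y m)).re := by
  have hβ : α / √2 ≤ ν := by
    rw [div_le_one (by positivity)] at h
    rwa [div_le_iff₀ (by positivity)]
  have hβ0 : 0 ≤ α / √2 := by positivity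
  have h1 := sum_neighbour_le (fun m => ‖y m‖) N
  have h2 : ∑ m ∈ Finset.range N, (√(m : ℝ) + √((m : ℝ) + 1)) * ‖y m‖ ^ 2 ≤
      ∑ m ∈ Finset.range N, 2 * √((m : ℝ) + 1 / 2) * ‖y m‖ ^ 2 :=
    Finset.sum_le_sum fun m _ => by gcongr; exact sqrt_add_sqrt_succ_le m
  have h3 : 0 ≤ √(N : ℝ) / 2 * ‖y (N - 1)‖ ^ 2 := by positivity
  have h4 : -(α / √2 * ∑ m ∈ Finset.range N, (√((m : ℝ) + 1) * ‖y (m + 1)‖ * ‖y m‖ +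
      √(m : ℝ) * ‖y (m - 1)‖ * ‖y m‖)) ≤
      ∑ m ∈ Finset.range N, ((((α / √2 : ℝ) : ℂ) * (((√((m : ℝ) + 1) : ℝ) : ℂ) * y (m + 1)
        + ((√(m : ℝ) : ℝ) : ℂ) * y (m - 1))) * star (y m)).re := by
    rw [Finset.mul_sum, ← Finset.sum_neg_distrib]
    refine Finset.sum_le_sum fun m _ => ?_
    rw [mul_assoc (Complex.ofReal _), Complex.re_ofReal_mul, ← mul_neg]
    exact mul_le_mul_of_nonneg_left (re_jump_ge _ _ _ _ _ (Real.sqrt_nonneg _)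
      (Real.sqrt_nonneg _)) hβ0
  refine le_trans (neg_le_neg ?_) h4
  calc α / √2 * ∑ m ∈ Finset.range N, (√((m : ℝ) + 1) * ‖y (m + 1)‖ * ‖y m‖ +
        √(m : ℝ) * ‖y (m - 1)‖ * ‖y m‖)
      ≤ α / √2 * (∑ m ∈ Finset.range N, 2 * √((m : ℝ) + 1 / 2) * ‖y m‖ ^ 2 +
          √(N : ℝ) / 2 * ‖y N‖ ^ 2) := by
        gcongr
        linarith
    _ ≤ ν * (∑ m ∈ Finset.range N, 2 * √((m : ℝ) + 1 / 2) * ‖y m‖ ^ 2 +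
          √(N : ℝ) / 2 * ‖y N‖ ^ 2) := by gcongr
    _ = _ := by
        rw [mul_add, Finset.mul_sum]
        congr 1
        · exact Finset.sum_congr rfl fun m _ => by ring
        · ring

/-- Otherwise `G N ≥ ε/N` for all large `N`, and the harmonic series would converge. -/
lemma frequently_nat_mul_lt {G : ℕ → ℝ} (hG : Summable G) (ε : ℝ) (hε : 0 < ε) :
    ∃ᶠ N : ℕ in atTop, (N : ℝ) * G N < ε := by
  intro h
  refine Real.not_summable_natCast_inv ?_
  refine Summable.of_norm_bounded_eventually_nat (hG.mul_left ε⁻¹) ?_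
  filter_upwards [h, eventually_gt_atTop 0] with N hN hN0
  have hN0' : (0 : ℝ) < N := by exact_mod_cast hN0
  rw [not_lt] at hN
  rw [Real.norm_of_nonneg (by positivity), inv_eq_one_div, div_le_iff₀ hN0', ← div_eq_inv_mul,
    div_mul_eq_mul_div, le_div_iff₀ hε]
  linarith

lemma sum_square_succ (g : ℕ × ℕ → ℝ) (N : ℕ) :
    ∑ p ∈ Finset.range (N + 1) ×ˢ Finset.range (N + 1), g p =
      ∑ p ∈ Finset.range N ×ˢ Finset.range N, g p +
        (∑ n ∈ Finset.range N, g (N, n) + ∑ m ∈ Finset.range N, g (m, N)) + g (N, N) := by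
  rw [Finset.sum_product, Finset.sum_product, Finset.sum_range_succ]
  simp only [Finset.sum_range_succ, Finset.sum_add_distrib]
  ring

/-- The sums over the boundaries of the squares of a summable family are summable. -/
lemma summable_boundary {g : ℕ × ℕ → ℝ} (hg : Summable g) (h0 : ∀ p, 0 ≤ g p) :
    Summable fun N => ∑ n ∈ Finset.range N, g (N, n) + ∑ m ∈ Finset.range N, g (m, N) := by
  refine summable_of_sum_range_le (c := ∑' p, g p) (fun N => ?_) fun N => ?_
  · exact add_nonneg (Finset.sum_nonneg fun _ _ => h0 _) (Finset.sum_nonneg fun _ _ => h0 _)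
  · refine le_trans ?_ (hg.sum_le_tsum (Finset.range N ×ˢ Finset.range N) fun p _ => h0 p)
    induction N with
    | zero => simp
    | succ N ih =>
      rw [Finset.sum_range_succ, sum_square_succ]
      linarith [h0 (N, N)]

lemma tendsto_square :
    Tendsto (fun N => Finset.range N ×ˢ Finset.range N : ℕ → Finset (ℕ × ℕ)) atTop atTop := by
  refine tendsto_atTop_finset_of_monotone (fun M N h => ?_) fun p => ?_
  · exact Finset.product_subset_product (Finset.range_mono h) (Finset.range_mono h)
  · refine ⟨max p.1 p.2 + 1, ?_⟩
    simp only [Finset.mem_product, Finset.mem_range]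
    omega

end Sequences

/-! ### The lower bound on the operator domain -/

section LowerBound

variable {νp νm αp αm : ℝ} {U F : GH}

/-- The local graph norm of a component. -/
noncomputable def graphTerm (νp νm : ℝ) (U : GH) (p : ℕ × ℕ) : ℝ :=
  ∫ x, (‖comp U p.1 p.2 x‖ ^ 2 + ‖Lop νp νm p.1 p.2 (comp U p.1 p.2) x‖ ^ 2)

lemma graphTerm_nonneg (νp νm : ℝ) (U : GH) (p : ℕ × ℕ) : 0 ≤ graphTerm νp νm U p :=
  integral_nonneg fun x => by positivity

lemma Lop_ae_eq (hF : OpAction νp νm U F) (p : ℕ × ℕ) :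
    coeffLp F p =ᵐ[volume] Lop νp νm p.1 p.2 (comp U p.1 p.2) :=
  (coeffLp_ae_eq F p).trans (hF p.1 p.2)

lemma memLp_Lop (hF : OpAction νp νm U F) (p : ℕ × ℕ) :
    MemLp (Lop νp νm p.1 p.2 (comp U p.1 p.2)) 2 :=
  (memLp_congr_ae (Lop_ae_eq hF p)).1 (Lp.memLp _)

lemma integrable_graphTerm (hF : OpAction νp νm U F) (p : ℕ × ℕ) :
    Integrable (fun x => ‖comp U p.1 p.2 x‖ ^ 2 + ‖Lop νp νm p.1 p.2 (comp U p.1 p.2) x‖ ^ 2) :=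
  ((memLp_comp U p).integrable_norm_pow (by norm_num)).add
    ((memLp_Lop hF p).integrable_norm_pow (by norm_num))

lemma summable_graphTerm (hF : OpAction νp νm U F) : Summable (graphTerm νp νm U) := by
  refine ((hasSum_norm_sq_coeffLp U).summable.add (hasSum_norm_sq_coeffLp F).summable).congr
    fun p => ?_
  rw [graphTerm, integral_add ((memLp_comp U p).integrable_norm_pow (by norm_num))
    ((memLp_Lop hF p).integrable_norm_pow (by norm_num)), integral_norm_sq_comp]
  congr 1
  rw [← Lp.toLp_coeFn (coeffLp F p) (Lp.memLp _), norm_sq_toLp]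
  refine integral_congr_ae ?_
  filter_upwards [Lop_ae_eq hF p] with x hx
  rw [hx]

/-- The point bound is used to the right of `1`, on `(1, 3)`; at `-1` the interval `(-1, 1)` serves.
Both are longer than the unit length that the bound requires. -/
lemma norm_sq_one_le (hU : U ∈ opDomain νp νm αp αm) (hF : OpAction νp νm U F) (p : ℕ × ℕ) :
    ‖comp U p.1 p.2 1‖ ^ 2 ≤ 50 * √(1 + rCoef νp νm p.1 p.2) * graphTerm νp νm U p := by
  obtain ⟨l, r, -, hr, -⟩ := hU.2.2.2.1 p.1 p.2
  have hsub : Ioo (1 : ℝ) 3 ⊆ Ioi 1 := fun x hx => hx.1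
  have h := (hU.2.1 p.1 p.2).2.2
  refine (norm_sq_le_of_memH2On (b := 3) (rCoef_nonneg νp νm p.1 p.2) (by norm_num)
    ⟨h.1.mono hsub, h.2.mono hsub⟩ (hU.1 p.1 p.2).continuous.continuousAt hr).trans ?_
  gcongr
  exact setIntegral_le_integral (integrable_graphTerm hF p) (ae_of_all _ fun x => by positivity)

lemma norm_sq_neg_one_le (hU : U ∈ opDomain νp νm αp αm) (hF : OpAction νp νm U F) (p : ℕ × ℕ) :
    ‖comp U p.1 p.2 (-1)‖ ^ 2 ≤ 50 * √(1 + rCoef νp νm p.1 p.2) * graphTerm νp νm U p := by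
  obtain ⟨l, r, -, hr, -⟩ := hU.2.2.2.2 p.1 p.2
  refine (norm_sq_le_of_memH2On (b := 1) (rCoef_nonneg νp νm p.1 p.2) (by norm_num)
    (hU.2.1 p.1 p.2).2.1 (hU.1 p.1 p.2).continuous.continuousAt hr).trans ?_
  gcongr
  exact setIntegral_le_integral (integrable_graphTerm hF p) (ae_of_all _ fun x => by positivity)

/-- The lower bound for a finite section of `(A_{α,ν} U, U)`. -/
lemma sum_re_inner_ge (hνp : 0 < νp) (hνm : 0 < νm) (hαp : 0 ≤ αp) (hαm : 0 ≤ αm)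
    (hθp : αp / (νp * √2) ≤ 1) (hθm : αm / (νm * √2) ≤ 1)
    (hU : U ∈ opDomain νp νm αp αm) (hF : OpAction νp νm U F) (N : ℕ) :
    -‖U‖ ^ 2 - (νp / 2 * √(N : ℝ) * ∑ n ∈ Finset.range N, ‖comp U N n 1‖ ^ 2 +
      νm / 2 * √(N : ℝ) * ∑ m ∈ Finset.range N, ‖comp U m N (-1)‖ ^ 2) ≤
      ∑ p ∈ Finset.range N ×ˢ Finset.range N, (inner ℂ (coeffLp U p) (coeffLp F p)).re := by
  set S := Finset.range N ×ˢ Finset.range N with hS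
  have e : ∑ p ∈ S, (inner ℂ (coeffLp U p) (coeffLp F p)).re = ∑ p ∈ S, aTerm νp νm U p +
      ∑ p ∈ S, (jumpPlus αp U p.1 p.2 * star (comp U p.1 p.2 1)).re +
      ∑ p ∈ S, (jumpMinus αm U p.1 p.2 * star (comp U p.1 p.2 (-1))).re := by
    rw [← Finset.sum_add_distrib, ← Finset.sum_add_distrib]
    refine Finset.sum_congr rfl fun p _ => ?_
    rw [inner_coeffLp_eq (isWeakOpSolution_of_mem_opDomain hU hF), Complex.add_re, Complex.add_re, Complex.ofReal_re]
  -- The jump at `1` couples only in `m`, so for each fixed `n` this is the one-dimensional finite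
  -- section, leaking through `m = N` alone.
  have hp : -(∑ p ∈ S, 2 * (√(rCoef νp νm p.1 p.2) * ‖comp U p.1 p.2 1‖ ^ 2) +
      νp / 2 * √(N : ℝ) * ∑ n ∈ Finset.range N, ‖comp U N n 1‖ ^ 2) ≤
      ∑ p ∈ S, (jumpPlus αp U p.1 p.2 * star (comp U p.1 p.2 1)).re := by
    rw [hS, Finset.sum_product_right, Finset.sum_product_right, Finset.mul_sum,
      ← Finset.sum_add_distrib, ← Finset.sum_neg_distrib]
    refine Finset.sum_le_sum fun n _ => ?_
    refine le_trans (neg_le_neg ?_) (sum_re_jump_ge hαp hνp hθp (fun m => comp U m n 1) N)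
    refine add_le_add (Finset.sum_le_sum fun m _ => ?_) le_rfl
    have h1 := mul_le_mul_of_nonneg_right
      (mul_sqrt_le_sqrt_rCoef_left (νp := νp) (νm := νm) hνp (m, n)) (sq_nonneg ‖comp U m n 1‖)
    linarith
  have hm : -(∑ p ∈ S, 2 * (√(rCoef νp νm p.1 p.2) * ‖comp U p.1 p.2 (-1)‖ ^ 2) +
      νm / 2 * √(N : ℝ) * ∑ m ∈ Finset.range N, ‖comp U m N (-1)‖ ^ 2) ≤
      ∑ p ∈ S, (jumpMinus αm U p.1 p.2 * star (comp U p.1 p.2 (-1))).re := by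
    rw [hS, Finset.sum_product, Finset.sum_product, Finset.mul_sum,
      ← Finset.sum_add_distrib, ← Finset.sum_neg_distrib]
    refine Finset.sum_le_sum fun m _ => ?_
    refine le_trans (neg_le_neg ?_) (sum_re_jump_ge hαm hνm hθm (fun n => comp U m n (-1)) N)
    refine add_le_add (Finset.sum_le_sum fun n _ => ?_) le_rfl
    have h1 := mul_le_mul_of_nonneg_right
      (mul_sqrt_le_sqrt_rCoef_right (νp := νp) (νm := νm) hνm (m, n)) (sq_nonneg ‖comp U m n (-1)‖)
    linarith
  -- The trace inequality lets the energy of the section compensate the diagonal part of both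
  -- interactions, at the cost of `‖U‖²`.
  have ht : ∑ p ∈ S, 2 * (√(rCoef νp νm p.1 p.2) * ‖comp U p.1 p.2 1‖ ^ 2) +
      ∑ p ∈ S, 2 * (√(rCoef νp νm p.1 p.2) * ‖comp U p.1 p.2 (-1)‖ ^ 2) ≤
      ∑ p ∈ S, aTerm νp νm U p + ‖U‖ ^ 2 := by
    have h1 := sum_le_hasSum S (fun p _ => sq_nonneg ‖coeffLp U p‖) (hasSum_norm_sq_coeffLp U)
    refine le_trans ?_ (add_le_add_right h1 _)
    rw [← Finset.sum_add_distrib, ← Finset.sum_add_distrib]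
    exact Finset.sum_le_sum fun p _ => aTerm_trace (hU.1 p.1 p.2)
  rw [e]
  linarith

/-- On the closed square of side `N` the numbers `1 + r_{m,n}` grow at most linearly in `N`. -/
lemma sqrt_mul_sqrt_rCoef_le (νp νm : ℝ) {N : ℕ} {p : ℕ × ℕ} (hN : 1 ≤ N) (h1 : p.1 ≤ N)
    (h2 : p.2 ≤ N) : √(N : ℝ) * √(1 + rCoef νp νm p.1 p.2) ≤
      √(1 + 2 * νp ^ 2 + 2 * νm ^ 2) * N := by
  have hN' : (1 : ℝ) ≤ N := by exact_mod_cast hN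
  have h1' : (p.1 : ℝ) ≤ N := by exact_mod_cast h1
  have h2' : (p.2 : ℝ) ≤ N := by exact_mod_cast h2
  have hr : 1 + rCoef νp νm p.1 p.2 ≤ (1 + 2 * νp ^ 2 + 2 * νm ^ 2) * N := by
    rw [rCoef]
    nlinarith [mul_le_mul_of_nonneg_left (show (p.1 : ℝ) + 1 / 2 ≤ 2 * N by linarith)
        (sq_nonneg νp), mul_le_mul_of_nonneg_left (show (p.2 : ℝ) + 1 / 2 ≤ 2 * N by linarith)
        (sq_nonneg νm)]
  calc √(N : ℝ) * √(1 + rCoef νp νm p.1 p.2)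
      ≤ √(N : ℝ) * √((1 + 2 * νp ^ 2 + 2 * νm ^ 2) * N) := by gcongr
    _ = √(1 + 2 * νp ^ 2 + 2 * νm ^ 2) * (√(N : ℝ) * √(N : ℝ)) := by
        rw [Real.sqrt_mul (by positivity)]
        ring
    _ = _ := by rw [Real.mul_self_sqrt (by positivity)]

/-- The operator `A_{α,ν}` is bounded below. -/
lemma neg_norm_sq_le_re_inner (hνp : 0 < νp) (hνm : 0 < νm) (hαp : 0 ≤ αp) (hαm : 0 ≤ αm)
    (hθp : αp / (νp * √2) ≤ 1) (hθm : αm / (νm * √2) ≤ 1)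
    (hU : U ∈ opDomain νp νm αp αm) (hF : OpAction νp νm U F) :
    -1 * ‖U‖ ^ 2 ≤ (inner ℂ U F).re := by
  have hlim := (Complex.reCLM.hasSum (hasSum_inner_coeffLp U F)).comp tendsto_square
  simp only [Complex.reCLM_apply] at hlim
  set G : ℕ → ℝ := fun N => ∑ n ∈ Finset.range N, graphTerm νp νm U (N, n) +
    ∑ m ∈ Finset.range N, graphTerm νp νm U (m, N) with hG
  have hGs : Summable G := summable_boundary (summable_graphTerm hF) (graphTerm_nonneg νp νm U)
  set K := √(1 + 2 * νp ^ 2 + 2 * νm ^ 2) with hK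
  -- The edge factor `ν/2` times `50 K` gives `25 ν K` for each direction. The added `1` only
  -- provides room and positivity.
  set C := 25 * (νp + νm) * K + 1 with hC
  have hC0 : 0 < C := by positivity
  have hb : ∀ N : ℕ, 1 ≤ N → νp / 2 * √(N : ℝ) * ∑ n ∈ Finset.range N, ‖comp U N n 1‖ ^ 2 +
      νm / 2 * √(N : ℝ) * ∑ m ∈ Finset.range N, ‖comp U m N (-1)‖ ^ 2 ≤ C * (N * G N) := by
    intro N hN
    have key : ∀ p : ℕ × ℕ, p.1 ≤ N → p.2 ≤ N → ∀ y : ℝ,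
        y ≤ 50 * √(1 + rCoef νp νm p.1 p.2) * graphTerm νp νm U p →
        √(N : ℝ) * y ≤ 50 * K * N * graphTerm νp νm U p := by
      intro p h1 h2 y hy
      calc √(N : ℝ) * y ≤ √(N : ℝ) * (50 * √(1 + rCoef νp νm p.1 p.2) * graphTerm νp νm U p) := by
            gcongr
        _ = 50 * (√(N : ℝ) * √(1 + rCoef νp νm p.1 p.2)) * graphTerm νp νm U p := by ring
        _ ≤ 50 * (K * N) * graphTerm νp νm U p := by
            have h3 := sqrt_mul_sqrt_rCoef_le νp νm hN h1 h2
            exact mul_le_mul_of_nonneg_right (by linarith) (graphTerm_nonneg νp νm U p)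
        _ = _ := by ring
    have h1 : √(N : ℝ) * ∑ n ∈ Finset.range N, ‖comp U N n 1‖ ^ 2 ≤
        50 * K * N * ∑ n ∈ Finset.range N, graphTerm νp νm U (N, n) := by
      rw [Finset.mul_sum, Finset.mul_sum]
      exact Finset.sum_le_sum fun n hn => key (N, n) le_rfl (Finset.mem_range.1 hn).le _
        (norm_sq_one_le hU hF (N, n))
    have h2 : √(N : ℝ) * ∑ m ∈ Finset.range N, ‖comp U m N (-1)‖ ^ 2 ≤
        50 * K * N * ∑ m ∈ Finset.range N, graphTerm νp νm U (m, N) := by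
      rw [Finset.mul_sum, Finset.mul_sum]
      exact Finset.sum_le_sum fun m hm => key (m, N) (Finset.mem_range.1 hm).le le_rfl _
        (norm_sq_neg_one_le hU hF (m, N))
    set A := ∑ n ∈ Finset.range N, graphTerm νp νm U (N, n) with hA
    set B := ∑ m ∈ Finset.range N, graphTerm νp νm U (m, N) with hB
    have hA0 : 0 ≤ A := Finset.sum_nonneg fun _ _ => graphTerm_nonneg _ _ _ _
    have hB0 : 0 ≤ B := Finset.sum_nonneg fun _ _ => graphTerm_nonneg _ _ _ _
    calc _ = νp / 2 * (√(N : ℝ) * ∑ n ∈ Finset.range N, ‖comp U N n 1‖ ^ 2) +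
          νm / 2 * (√(N : ℝ) * ∑ m ∈ Finset.range N, ‖comp U m N (-1)‖ ^ 2) := by ring
      _ ≤ νp / 2 * (50 * K * N * (A + B)) + νm / 2 * (50 * K * N * (A + B)) := by
          have h0 : 0 ≤ 50 * K * N := by positivity
          have h3 := h1.trans (mul_le_mul_of_nonneg_left (show A ≤ A + B by linarith) h0)
          have h4 := h2.trans (mul_le_mul_of_nonneg_left (show B ≤ A + B by linarith) h0)
          exact add_le_add (mul_le_mul_of_nonneg_left h3 (by positivity))
            (mul_le_mul_of_nonneg_left h4 (by positivity))
      _ = (C - 1) * (N * (A + B)) := by rw [hC]; ring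
      _ ≤ C * (N * (A + B)) := by gcongr; linarith
  refine le_of_forall_pos_sub_le fun ε hε => ?_
  -- The partial sums over squares converge to `Re (F, U)`, so it suffices that the lower bound
  -- holds for arbitrarily large `N`, namely those with `N G_N < ε/C`.
  refine ge_of_tendsto_of_frequently hlim ?_
  have hf := (frequently_nat_mul_lt hGs (ε / C) (by positivity)).and_eventually
    (eventually_ge_atTop 1)
  refine hf.mono fun N hN => ?_
  have h1 := sum_re_inner_ge hνp hνm hαp hαm hθp hθm hU hF N
  have h2 := hb N hN.2
  have h3 : C * (N * G N) < ε := by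
    have := hN.1
    rw [lt_div_iff₀ hC0] at this
    linarith
  simp only [Function.comp_apply]
  linarith

end LowerBound

/-! ### Self-adjointness of `A_{α,ν}` -/

section SelfAdjoint

variable {νp νm αp αm : ℝ} {U F : GH}

lemma memLp_Lop_of_mem_opDomain (hU : U ∈ opDomain νp νm αp αm) (p : ℕ × ℕ) :
    MemLp (Lop νp νm p.1 p.2 (comp U p.1 p.2)) 2 := by
  have h := hU.2.1 p.1 p.2
  have hm : AEStronglyMeasurable (deriv (deriv (comp U p.1 p.2))) volume :=
    (measurable_deriv _).aestronglyMeasurable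
  have hd : MemLp (deriv (deriv (comp U p.1 p.2))) 2 := by
    rw [memLp_two_iff_integrable_sq_norm hm]
    exact (integral_three (h.1.2.2.1.integrable_norm_pow (by norm_num))
      (h.2.1.2.2.1.integrable_norm_pow (by norm_num))
      (h.2.2.2.2.1.integrable_norm_pow (by norm_num))).1
  exact hd.neg.add ((memLp_comp U p).const_mul _)

/-- The summability condition in the domain is exactly what allows the functions `L_{m,n} u_{m,n}`
to be assembled into an element of `L²(ℝ³)`. -/
lemma exists_opAction (hU : U ∈ opDomain νp νm αp αm) : ∃ F, OpAction νp νm U F := by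
  have hs : Summable fun p => ‖(memLp_Lop_of_mem_opDomain hU p).toLp _‖ ^ 2 :=
    hU.2.2.1.congr fun p => (norm_sq_toLp _).symm
  obtain ⟨F, hF⟩ := exists_coeffLp_eq _ hs
  refine ⟨F, fun m n => ?_⟩
  refine (coeffLp_ae_eq F (m, n)).symm.trans ?_
  rw [hF]
  exact (memLp_Lop_of_mem_opDomain hU (m, n)).coeFn_toLp

/-- The lower bound is `-1`, so the shift by `2` makes the form norm dominate the norm of `L²(ℝ³)`.
-/
lemma norm_sq_le_form_add (hνp : 0 < νp) (hνm : 0 < νm) (hαp : 0 ≤ αp) (hαm : 0 ≤ αm)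
    (hθp : αp / (νp * √2) ≤ 1) (hθm : αm / (νm * √2) ≤ 1) :
    ∀ U ∈ energySubmodule νp νm, ‖U‖ ^ 2 ≤ form νp νm αp αm U + 2 * ‖U‖ ^ 2 := fun U hU => by
  linarith [neg_norm_sq_le_form hνp hνm hαp hαm hθp hθm hU]

/-- The self-adjoint operator of the form is `A_{α,ν}`. -/
theorem exists_smilanskyOp (hνp : 0 < νp) (hνm : 0 < νm) (hαp : 0 ≤ αp) (hαm : 0 ≤ αm)
    (hθp : αp / (νp * √2) < 1) (hθm : αm / (νm * √2) < 1) :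
    ∃ T : GH →ₗ.[ℂ] GH, IsSelfAdjoint T ∧
      IsFormOperator (energySpace νp νm) (form νp νm αp αm) T ∧
      IsSmilanskyOp νp νm αp αm T ∧ ∀ F, ∃ U, (U, F - ((2 : ℝ) : ℂ) • U) ∈ T.graph := by
  obtain ⟨-, hB, hq⟩ := polarForm_form hνp hνm αp αm
  obtain ⟨T, hT, hform, hsurj⟩ := exists_formOperator (dense_energySpace νp νm) hB hq
    (norm_sq_le_form_add hνp hνm hαp hαm hθp.le hθm.le)
    (formClosed_form hνp hνm hαp hαm hθp hθm)
  have hweak : ∀ U F, (U, F) ∈ T.graph → IsWeakOpSolution νp νm αp αm U F := fun U F h =>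
    isWeakOpSolution_of_form hνp hνm ((hform U F).1 h).1 ((hform U F).1 h).2
  refine ⟨T, hT, hform, ⟨?_, fun U => (hweak U (T U) (T.mem_graph U)).mem_opDomain.2⟩, hsurj⟩
  refine Subset.antisymm (fun U hU => ?_) fun U hU => ?_
  · obtain ⟨F, hF⟩ := LinearPMap.mem_domain_iff.1 hU
    exact (hweak U F hF).mem_opDomain.1
  · obtain ⟨F, hF⟩ := exists_opAction hU
    -- Here `(T + 2)W = (A + 2)U`, so `U - W` solves the weak equations with right side `-2(U - W)`
    -- and thus lies in the domain of `A`. There the lower bound `-1` leaves only `U = W`.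
    obtain ⟨W, hW⟩ := hsurj (F + ((2 : ℝ) : ℂ) • U)
    have hUW := (isWeakOpSolution_of_mem_opDomain hU hF).sub (hweak _ _ hW)
    have h1 := neg_norm_sq_le_re_inner hνp hνm hαp hαm hθp.le hθm.le hUW.mem_opDomain.1
      hUW.mem_opDomain.2
    have e : F - (F + ((2 : ℝ) : ℂ) • U - ((2 : ℝ) : ℂ) • W) = -(((2 : ℝ) : ℂ) • (U - W)) := by
      rw [smul_sub]
      abel
    rw [e, inner_neg_right, inner_smul_right, inner_self_complex, ← Complex.ofReal_mul,
      Complex.neg_re, Complex.ofReal_re] at h1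
    have h2 : U - W = 0 := by
      refine norm_eq_zero.1 (pow_eq_zero_iff two_ne_zero |>.1 ?_)
      exact le_antisymm (by linarith) (by positivity)
    rw [sub_eq_zero.1 h2]
    exact LinearPMap.mem_domain_of_mem_graph hW

lemma form_zero (νp νm : ℝ) (U : GH) : form νp νm 0 0 U = formA νp νm U := by
  simp [form]

/-- The domain of `A_{0,ν}` is a dense subset of the energy space. -/
theorem opDomain_zero_dense (hνp : 0 < νp) (hνm : 0 < νm) :
    opDomain νp νm 0 0 ⊆ energySpace νp νm ∧ ∀ U ∈ energySpace νp νm, ∀ ε : ℝ, 0 < ε →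
      ∃ V ∈ opDomain νp νm 0 0, formA νp νm (U - V) < ε := by
  have hp : (0 : ℝ) / (νp * √2) < 1 := by simp
  have hm : (0 : ℝ) / (νm * √2) < 1 := by simp
  obtain ⟨-, hB, hq⟩ := polarForm_form hνp hνm 0 0
  obtain ⟨T, -, hform, hop, hsurj⟩ := exists_smilanskyOp hνp hνm le_rfl le_rfl hp hm
  have hsub : T.domain ≤ energySubmodule νp νm := fun U hU => by
    obtain ⟨F, hF⟩ := LinearPMap.mem_domain_iff.1 hU
    exact ((hform U F).1 hF).1
  refine ⟨fun U hU => hsub (hop.1.symm ▸ hU : U ∈ (T.domain : Set GH)), fun U hU ε hε => ?_⟩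
  obtain ⟨V, hV, hlt⟩ := exists_form_sub_lt hB hq
    (norm_sq_le_form_add hνp hνm le_rfl le_rfl hp.le hm.le)
    (formClosed_form hνp hνm le_rfl le_rfl hp hm) hsub (fun W hW h => by
      -- A `W` that is form-orthogonal to the domain of `T` is orthogonal in `L²(ℝ³)` to the range
      -- of `T + 2`. Choosing `V` with `(T + 2)V = W` gives `(W, W) = 0`.
      obtain ⟨V, hV⟩ := hsurj W
      have h1 := h V (LinearPMap.mem_domain_of_mem_graph hV)
      have hV' := (hform _ _).1 hV
      have h2 := hV'.2 W hW
      have h3 := congrArg star h1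
      rw [star_add, star_mul', hB.star_symm _ hW _ hV'.1, h2, Complex.star_def,
        Complex.conj_ofReal, inner_conj_symm, inner_sub_right, inner_smul_right, sub_add_cancel,
        map_zero] at h3
      exact inner_self_eq_zero.1 h3) hU hε
  refine ⟨V, hop.1 ▸ hV, lt_of_le_of_lt ?_ hlt⟩
  rw [form_zero]
  have : 0 ≤ ‖U - V‖ ^ 2 := by positivity
  linarith

end SelfAdjoint

end Smilansky

/-! ### The theorem -/

theorem theorem2p2 (νp νm αp αm : ℝ) (hνp : 0 < νp) (hνm : 0 < νm)
    (hαp : 0 ≤ αp) (hαm : 0 ≤ αm) :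
    -- the energy space is the completion of the domain for `α = 0` (completeness is the
    -- closedness below, for `α = 0`), and the series in the forms converge on it
    (Smilansky.opDomain νp νm 0 0 ⊆ Smilansky.energySpace νp νm ∧
      ∀ U ∈ Smilansky.energySpace νp νm, ∀ ε : ℝ, 0 < ε →
        ∃ V ∈ Smilansky.opDomain νp νm 0 0, Smilansky.formA νp νm (U - V) < ε) ∧
    (∀ U ∈ Smilansky.energySpace νp νm,
      Summable (Smilansky.bPlusTerm U) ∧ Summable (Smilansky.bMinusTerm U)) ∧
    -- boundedness below, on the energy space and on the operator domain
    (1 ≤ Smilansky.mu νp αp → 1 ≤ Smilansky.mu νm αm →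
      Smilansky.FormBoundedBelow (Smilansky.energySpace νp νm)
        (Smilansky.form νp νm αp αm) ∧
      ∃ c : ℝ, ∀ U ∈ Smilansky.opDomain νp νm αp αm, ∀ F : Smilansky.GH,
        Smilansky.OpAction νp νm U F → c * ‖U‖ ^ 2 ≤ (inner ℂ U F).re) ∧
    -- closedness, and coincidence of the operators
    (1 < Smilansky.mu νp αp → 1 < Smilansky.mu νm αm →
      Smilansky.FormClosed (Smilansky.energySpace νp νm) (Smilansky.form νp νm αp αm) ∧
      ∃ T : Smilansky.GH →ₗ.[ℂ] Smilansky.GH, IsSelfAdjoint T ∧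
        Smilansky.IsFormOperator (Smilansky.energySpace νp νm)
          (Smilansky.form νp νm αp αm) T ∧
        Smilansky.IsSmilanskyOp νp νm αp αm T) := by
  refine ⟨Smilansky.opDomain_zero_dense hνp hνm, fun U hU =>
    ⟨(Smilansky.summable_norm_bPlusTerm hνp hU).1.of_norm,
      (Smilansky.summable_norm_bMinusTerm hνm hU).1.of_norm⟩, fun h1 h2 => ?_, fun h1 h2 => ?_⟩
  · have hp := Smilansky.le_of_one_le_mu hνp hαp h1
    have hm := Smilansky.le_of_one_le_mu hνm hαm h2
    exact ⟨⟨-1, fun U hU => Smilansky.neg_norm_sq_le_form hνp hνm hαp hαm hp hm hU⟩,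
      -1, fun U hU F hF => Smilansky.neg_norm_sq_le_re_inner hνp hνm hαp hαm hp hm hU hF⟩
  · have hp := Smilansky.lt_of_one_lt_mu hνp hαp h1
    have hm := Smilansky.lt_of_one_lt_mu hνm hαm h2
    obtain ⟨T, hT, hform, hop, -⟩ := Smilansky.exists_smilanskyOp hνp hνm hαp hαm hp hm
    exact ⟨Smilansky.formClosed_form hνp hνm hαp hαm hp hm, T, hT, hform, hop⟩
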